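/- Let $k$ be a field with $\operatorname{char} k\notin\{2,3\}$, let $q\in k^\times$ be not a root of unity, let $n$ be a natural number and $I=\{1,\dots,n\}$. For a vector space $V$ with basis $x_1,\dots,x_n$ and a matrix $\mathbf q=(q_{ij})_{i,j\in I}$ of non-zero scalars, consider the braiding $c(x_i\otimes x_j)=q_{ij}\,x_j\otimes x_i$ of diagonal type. The tensor algebra $T(V)$ is a braided bialgebra whose coproduct $\Delta$ is the algebra map to the braided tensor product $T(V)\otimes T(V)$ with $\Delta(x_i)=x_i\otimes 1+1\otimes x_i$, and the Nichols algebra is $\mathcal B(V)=T(V)/\mathcal I$, where $\mathcal I$ is the sum of all homogeneous two-sided ideals $J\subseteq\bigoplus_{m\ge 2}V^{\otimes m}$ of $T(V)$ with $\Delta(J)\subseteq J\otimes T(V)+T(V)\otimes J$. We write $\mathcal B(V)=T(V)$ if the projection $T(V)\to\mathcal B(V)$ is bijective. Let $e_1,\dots,e_n$ be the standard basis vectors, $|m|=\sum_i m_i$ for $m\in\mathbb N_0^n$, and $(r)_t=1+t+\dots+t^{r-1}$. For $|m|\ge 2$ define $P_m\in\mathbb Z[p_{ij}\mid i,j\in I]$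 as follows, where $i\neq j$ and $s_{ij}=p_{ij}p_{ji}$: - $P_{r e_i}=(r)_{p_{ii}}$ for $r\ge2$; - $P_{e_i+re_j}=1-p_{jj}^{r-1}s_{ij}$ for $r\ge1$; - $P_{2e_i+re_j}=1+p_{jj}^{r(r-1)/2}(-s_{ij})^{r}p_{ii}$ for $r\ge1$; - $P_{3e_i+3e_j}=(3)_{p_{ii}^2s_{ij}^3p_{jj}^2}$; - $P_{3e_i+4e_j}=(1-p_{ii}^2s_{ij}^4p_{jj}^4)\,(3)_{p_{ii}s_{ij}^2p_{jj}^2}$; - $P_{3e_i+6e_j}=(1-p_{ii}s_{ij}^3p_{jj}^5)\,(3)_{p_{ii}^2s_{ij}^6p_{jj}^{10}}$; - $P_{4e_i+4e_j}=(1+p_{ii}^3s_{ij}^4p_{jj}^3)(1+p_{ii}^6s_{ij}^8p_{jj}^6)$; - $P_m=1-\prod_{i}p_{ii}^{m_i(m_i-1)}\prod_{i<j}s_{ij}^{m_im_j}$ for all other $m$. (1) Let $(a_{ij})\in\mathbb Z^{n\times n}$ and $q_{ij}=q^{a_{ij}}$. Put $K(m)=\sum_{i,j}a_{ij}m_im_j$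 and $\lambda(m)=\sum_i a_{ii}m_i$ for $m\in\mathbb N_0^n$. Call the following degrees exceptional: $re_i$ with $r\ge2$ and ($a_{ii}\ne0$ or $r\neq 0$ in $k$); $2e_i+2re_j$ with $r\ge1$, $i\ne j$; $3e_i+3e_j$ and $4e_i+4e_j$ with $i\ne j$. (The condition "$a_{ii}\ne0$ or $r\ne0$ in $k$" is automatic if $\operatorname{char}k=0$ or if all $a_{ii}\neq0$.) Then $P_m(\mathbf q)\ne0$ for every exceptional $m$, and for every other $m\in\mathbb N_0^n$ with $|m|\ge2$ we have $P_m(\mathbf q)=0$ if and only if $K(m)=\lambda(m)$. Moreover, $\mathcal B(V)=T(V)$ if and only if the equation $K(m)=\lambda(m)$ has no solution $m\in\mathbb N_0^n$ with $|m|\ge2$ that is not exceptional. (2) Let $n=2$, let $a>b>0$ be integers, and let $q_{11}=q_{22}=q^a$ and $q_{12},q_{21}\in q^{\mathbb Z}$ with $q_{12}q_{21}=q^{-b}$. Then $\mathcal B(V)=T(V)$. -/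

import Mathlib

open scoped TensorProduct

/-! ### The Nichols algebra of a braided vector space of diagonal type

`V` is a vector space with basis `x_1, …, x_n` and braiding `c (x_i ⊗ x_j) = q_{ij} x_j ⊗ x_i`. -/

namespace DiagonalNichols

section Nichols

variable {k : Type*} [Field k] {n : ℕ} {V : Type*} [AddCommGroup V] [Module k V]

/-- The braiding `c` of diagonal type with braiding matrix `Q` with respect to the basis `x`,
`c (x_i ⊗ x_j) = q_{ij} x_j ⊗ x_i`. -/
noncomputable def braiding (x : Module.Basis (Fin n) k V) (Q : Matrix (Fin n) (Fin n) k) :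
    V ⊗[k] V →ₗ[k] V ⊗[k] V :=
  (x.tensorProduct x).constr k fun p => Q p.1 p.2 • (x p.2 ⊗ₜ[k] x p.1)

/-- The algebra endomorphism `g_i` of `T(V)` with `g_i (x_j) = q_{ij} x_j`. The braiding of `V`
extends to `T(V)` by `c (x_i ⊗ u) = g_i (u) ⊗ x_i`. -/
noncomputable def scaling (x : Module.Basis (Fin n) k V) (Q : Matrix (Fin n) (Fin n) k)
    (i : Fin n) : TensorAlgebra k V →ₐ[k] TensorAlgebra k V :=
  TensorAlgebra.lift k
    (x.constr k fun j => Q i j • TensorAlgebra.ι k (x j) : V →ₗ[k] TensorAlgebra k V)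

/-- Left multiplication by `x_i ⊗ 1 + 1 ⊗ x_i` in the braided tensor product algebra
`T(V) ⊗ T(V)`, whose product is `(a ⊗ b)(c' ⊗ d) = a c(b ⊗ c') d`; explicitly
`u ⊗ v ↦ x_i u ⊗ v + g_i (u) ⊗ x_i v`. -/
noncomputable def mulPrimitive (x : Module.Basis (Fin n) k V) (Q : Matrix (Fin n) (Fin n) k)
    (i : Fin n) : Module.End k (TensorAlgebra k V ⊗[k] TensorAlgebra k V) :=
  TensorProduct.map (LinearMap.mulLeft k (TensorAlgebra.ι k (x i))) LinearMap.id +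
    TensorProduct.map (scaling x Q i).toLinearMap
      (LinearMap.mulLeft k (TensorAlgebra.ι k (x i)))

/-- The coproduct of the braided bialgebra `T(V)`: the unique algebra map from `T(V)` to the
braided tensor product `T(V) ⊗ T(V)` with `x_i ↦ x_i ⊗ 1 + 1 ⊗ x_i` for all `i`. On a product
`x_{i_1} ⋯ x_{i_m}` it is computed by applying to `1 ⊗ 1` the left multiplications by
`x_{i_m} ⊗ 1 + 1 ⊗ x_{i_m}`, …, `x_{i_1} ⊗ 1 + 1 ⊗ x_{i_1}`. -/
noncomputable def coproduct (x : Module.Basis (Fin n) k V) (Q : Matrix (Fin n) (Fin n) k) :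
    TensorAlgebra k V →ₗ[k] TensorAlgebra k V ⊗[k] TensorAlgebra k V :=
  LinearMap.applyₗ (1 ⊗ₜ[k] 1) ∘ₗ
    (TensorAlgebra.lift k (x.constr k (mulPrimitive x Q))).toLinearMap

/-- The braiding, on basis vectors. -/
theorem braiding_basis (x : Module.Basis (Fin n) k V) (Q : Matrix (Fin n) (Fin n) k)
    (i j : Fin n) : braiding x Q (x i ⊗ₜ[k] x j) = Q i j • (x j ⊗ₜ[k] x i) := by
  have h := (x.tensorProduct x).constr_basis k
    (fun p => Q p.1 p.2 • (x p.2 ⊗ₜ[k] x p.1)) (i, j)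
  rw [Module.Basis.tensorProduct_apply] at h
  exact h

/-- On `V ⊗ V` the extended braiding `u ↦ g_i (u) ⊗ x_i` is the braiding of `V`. -/
theorem scaling_braiding (x : Module.Basis (Fin n) k V) (Q : Matrix (Fin n) (Fin n) k)
    (i : Fin n) (v : V) :
    scaling x Q i (TensorAlgebra.ι k v) ⊗ₜ[k] TensorAlgebra.ι k (x i) =
      TensorProduct.map (TensorAlgebra.ι k) (TensorAlgebra.ι k) (braiding x Q (x i ⊗ₜ[k] v)) := by
  have h : ∀ v : V,
      (((TensorProduct.mk k _ _).flip (TensorAlgebra.ι k (x i))) ∘ₗ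
        (scaling x Q i).toLinearMap ∘ₗ TensorAlgebra.ι k) v =
      (TensorProduct.map (TensorAlgebra.ι k) (TensorAlgebra.ι k) ∘ₗ braiding x Q ∘ₗ
        TensorProduct.mk k V V (x i)) v := by
    intro v
    congr 1
    apply x.ext
    intro j
    simp [scaling, braiding_basis, TensorProduct.smul_tmul']
  exact h v

/-- `Δ(1) = 1 ⊗ 1`. -/
theorem coproduct_one (x : Module.Basis (Fin n) k V) (Q : Matrix (Fin n) (Fin n) k) :
    coproduct x Q 1 = 1 ⊗ₜ[k] 1 := by
  simp [coproduct]

/-- `Δ(x_i w) = (x_i ⊗ 1 + 1 ⊗ x_i) Δ(w)`. -/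
theorem coproduct_mul (x : Module.Basis (Fin n) k V) (Q : Matrix (Fin n) (Fin n) k)
    (i : Fin n) (w : TensorAlgebra k V) :
    coproduct x Q (TensorAlgebra.ι k (x i) * w) = mulPrimitive x Q i (coproduct x Q w) := by
  simp [coproduct]

/-- The graded components `V^{⊗ m}` of `T(V)`. -/
abbrev tensorPower (k V : Type*) [Field k] [AddCommGroup V] [Module k V] (m : ℕ) :
    Submodule k (TensorAlgebra k V) :=
  LinearMap.range (TensorAlgebra.ι k : V →ₗ[k] TensorAlgebra k V) ^ m

/-- A two-sided ideal of `T(V)`, as a subspace. -/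
def idealSubmodule (I : TwoSidedIdeal (TensorAlgebra k V)) : Submodule k (TensorAlgebra k V) :=
  (TwoSidedIdeal.asIdeal I).restrictScalars k

/-- The two-sided ideals `I` of `T(V)` which are homogeneous, are contained in
`⨁_{m ≥ 2} V^{⊗ m}`, and are coideals: `Δ(I) ⊆ I ⊗ T(V) + T(V) ⊗ I`. -/
structure IsHomogeneousBiideal (x : Module.Basis (Fin n) k V) (Q : Matrix (Fin n) (Fin n) k)
    (I : TwoSidedIdeal (TensorAlgebra k V)) : Prop where
  homogeneous : ∀ r ∈ I, ∀ m : ℕ, GradedAlgebra.proj (tensorPower k V) m r ∈ I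
  degree_ge_two : ∀ r ∈ I, ∀ m < 2, GradedAlgebra.proj (tensorPower k V) m r = 0
  coideal : ∀ r ∈ I, coproduct x Q r ∈
    LinearMap.range (TensorProduct.map (idealSubmodule I).subtype
      (LinearMap.id : TensorAlgebra k V →ₗ[k] TensorAlgebra k V)) ⊔
    LinearMap.range (TensorProduct.map
      (LinearMap.id : TensorAlgebra k V →ₗ[k] TensorAlgebra k V) (idealSubmodule I).subtype)

/-- The defining ideal of the Nichols algebra: the sum of all homogeneous two-sided ideals of
`T(V)` in degrees at least two which are coideals. -/
noncomputable def nicholsIdeal (x : Module.Basis (Fin n) k V) (Q : Matrix (Fin n) (Fin n) k) :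
    TwoSidedIdeal (TensorAlgebra k V) :=
  sSup {I | IsHomogeneousBiideal x Q I}

/-- The Nichols algebra `B(V)` of the braided vector space of diagonal type with basis `x` and
braiding matrix `Q`, as a quotient of the tensor algebra `T(V)`. -/
abbrev NicholsAlgebra (x : Module.Basis (Fin n) k V) (Q : Matrix (Fin n) (Fin n) k) : Type _ :=
  (nicholsIdeal x Q).ringCon.Quotient

/-- The canonical projection `T(V) → B(V)`. -/
noncomputable def nicholsProj (x : Module.Basis (Fin n) k V) (Q : Matrix (Fin n) (Fin n) k) :
    TensorAlgebra k V →+* NicholsAlgebra x Q :=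
  (nicholsIdeal x Q).ringCon.mk'

/-- `B(V) = T(V)`: the canonical projection `T(V) → B(V)` is bijective. -/
def NicholsIsFree (x : Module.Basis (Fin n) k V) (Q : Matrix (Fin n) (Fin n) k) : Prop :=
  Function.Bijective (nicholsProj x Q)

end Nichols

/-! ### The polynomials `P_m` -/

section Polynomials

variable {n : ℕ}

/-- `(m)_t = 1 + t + ⋯ + t^{m-1}`. -/
def qNumber {R : Type*} [CommRing R] (m : ℕ) (t : R) : R :=
  ∑ s ∈ Finset.range m, t ^ s

/-- The total degree `|m| = m_1 + ⋯ + m_n`. -/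
def totalDegree (m : Fin n → ℕ) : ℕ := ∑ i, m i

/-- The indeterminate `p_{ij}`. -/
noncomputable def p (i j : Fin n) : MvPolynomial (Fin n × Fin n) ℤ := MvPolynomial.X (i, j)

/-- `m = c e_i + d e_j` with `i ≠ j` and `c, d > 0`, where `ij = (i, j)`. -/
def IsPair (m : Fin n → ℕ) (ij : Fin n × Fin n) (c d : ℕ) : Prop :=
  ij.1 ≠ ij.2 ∧ 0 < c ∧ 0 < d ∧ m = Pi.single ij.1 c + Pi.single ij.2 d

open Classical in
/-- The polynomials `P_m ∈ ℤ[p_{ij}]`, to be used for `|m| ≥ 2`. In the cases in which `m` is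
supported on two indices, `i` is the index of the coefficient that is written first; when the
indices can be exchanged the polynomial does not depend on the choice. -/
noncomputable def P (m : Fin n → ℕ) : MvPolynomial (Fin n × Fin n) ℤ :=
  if h : ∃ i, m = Pi.single i (m i) then
    qNumber (m h.choose) (p h.choose h.choose)
  else if h : ∃ ij : Fin n × Fin n, IsPair m ij 1 (m ij.2) then
    let i := h.choose.1
    let j := h.choose.2
    1 - p j j ^ (m j - 1) * (p i j * p j i)
  else if h : ∃ ij : Fin n × Fin n, IsPair m ij 2 (m ij.2) then
    let i := h.choose.1
    let j := h.choose.2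
    1 + p j j ^ (m j * (m j - 1) / 2) * (-(p i j * p j i)) ^ m j * p i i
  else if h : ∃ ij : Fin n × Fin n, IsPair m ij 3 3 then
    let i := h.choose.1
    let j := h.choose.2
    qNumber 3 (p i i ^ 2 * (p i j * p j i) ^ 3 * p j j ^ 2)
  else if h : ∃ ij : Fin n × Fin n, IsPair m ij 3 4 then
    let i := h.choose.1
    let j := h.choose.2
    (1 - p i i ^ 2 * (p i j * p j i) ^ 4 * p j j ^ 4) *
      qNumber 3 (p i i * (p i j * p j i) ^ 2 * p j j ^ 2)
  else if h : ∃ ij : Fin n × Fin n, IsPair m ij 3 6 then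
    let i := h.choose.1
    let j := h.choose.2
    (1 - p i i * (p i j * p j i) ^ 3 * p j j ^ 5) *
      qNumber 3 (p i i ^ 2 * (p i j * p j i) ^ 6 * p j j ^ 10)
  else if h : ∃ ij : Fin n × Fin n, IsPair m ij 4 4 then
    let i := h.choose.1
    let j := h.choose.2
    (1 + p i i ^ 3 * (p i j * p j i) ^ 4 * p j j ^ 3) *
      (1 + p i i ^ 6 * (p i j * p j i) ^ 8 * p j j ^ 6)
  else
    1 - (∏ i, p i i ^ (m i * (m i - 1))) *
      ∏ i, ∏ j ∈ Finset.Ioi i, (p i j * p j i) ^ (m i * m j)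

/-- The value `P_m(Q)` of `P_m` at a matrix `Q`. -/
noncomputable def evalP {k : Type*} [Field k] (Q : Matrix (Fin n) (Fin n) k) (m : Fin n → ℕ) : k :=
  MvPolynomial.aeval (fun ij : Fin n × Fin n => Q ij.1 ij.2) (P m)

theorem IsPair.unique {m : Fin n → ℕ} {i j : Fin n} {ij : Fin n × Fin n} {c d c' d' : ℕ}
    (h : IsPair m (i, j) c d) (h' : IsPair m ij c' d') :
    (ij = (i, j) ∧ c = c' ∧ d = d') ∨ (ij = (j, i) ∧ c = d' ∧ d = c') := by
  obtain ⟨i', j'⟩ := ij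
  obtain ⟨hij, hc, hd, hm⟩ := h
  obtain ⟨hij', hc', hd', hm'⟩ := h'
  simp only at hij hij' hm hm'
  rw [hm] at hm'
  have e := fun t => congrFun hm' t
  simp only [Pi.add_apply, Pi.single_apply] at e
  have e1 := e i
  have e2 := e j
  have e3 := e i'
  have e4 := e j'
  grind

theorem IsPair.not_single {m : Fin n → ℕ} {i j : Fin n} {c d : ℕ} (h : IsPair m (i, j) c d) :
    ¬ ∃ l, m = Pi.single l (m l) := by
  rintro ⟨l, hl⟩
  obtain ⟨hij, hc, hd, hm⟩ := h
  simp only at hij hm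
  have e := fun t => (congrFun hm t).symm.trans (congrFun hl t)
  simp only [Pi.add_apply, Pi.single_apply] at e
  have e1 := e i
  have e2 := e j
  grind

theorem IsPair.snd {m : Fin n → ℕ} {ij : Fin n × Fin n} {c d : ℕ} (h : IsPair m ij c d) :
    m ij.2 = d := by
  obtain ⟨hij, hc, hd, rfl⟩ := h
  simp [hij]

theorem IsPair.symm {m : Fin n → ℕ} {i j : Fin n} {c d : ℕ} (h : IsPair m (i, j) c d) :
    IsPair m (j, i) d c :=
  ⟨h.1.symm, h.2.2.1, h.2.1, by rw [h.2.2.2]; exact add_comm _ _⟩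

theorem P_single (i : Fin n) {c : ℕ} (hc : 0 < c) : P (Pi.single i c) = qNumber c (p i i) := by
  have h : ∃ l, (Pi.single i c : Fin n → ℕ) = Pi.single l ((Pi.single i c : Fin n → ℕ) l) :=
    ⟨i, by simp⟩
  have hl : h.choose = i := by
    have e := congrFun h.choose_spec i
    by_contra hne
    rw [Pi.single_eq_same, Pi.single_eq_of_ne (Ne.symm hne)] at e
    omega
  rw [P, dif_pos h, hl, Pi.single_eq_same]

theorem P_one {m : Fin n → ℕ} {i j : Fin n} {d : ℕ} (h : IsPair m (i, j) 1 d) :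
    P m = 1 - p j j ^ (d - 1) * (p i j * p j i) := by
  have h2 : ∃ ij : Fin n × Fin n, IsPair m ij 1 (m ij.2) := ⟨(i, j), by rw [h.snd]; exact h⟩
  rw [P, dif_neg h.not_single, dif_pos h2]
  rcases h.unique (h2.choose_spec) with ⟨e, -, -⟩ | ⟨e, e3, e4⟩
  · simp only [e, h.snd]
  · simp only [e, h.symm.snd] at e4 ⊢
    subst e4
    simp [mul_comm]

theorem P_two {m : Fin n → ℕ} {i j : Fin n} {d : ℕ} (h : IsPair m (i, j) 2 d) :
    P m = 1 + p j j ^ (d * (d - 1) / 2) * (-(p i j * p j i)) ^ d * p i i := by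
  by_cases hd : d = 1
  · subst hd
    rw [P_one h.symm]
    simp
    ring
  have h1 : ¬ ∃ ij : Fin n × Fin n, IsPair m ij 1 (m ij.2) := by
    rintro ⟨⟨a, b⟩, hab⟩
    have := h.unique hab
    grind
  have h2 : ∃ ij : Fin n × Fin n, IsPair m ij 2 (m ij.2) := ⟨(i, j), by rw [h.snd]; exact h⟩
  rw [P, dif_neg h.not_single, dif_neg h1, dif_pos h2]
  rcases h.unique (h2.choose_spec) with ⟨e, -, -⟩ | ⟨e, e3, e4⟩
  · simp only [e, h.snd]
  · simp only [e, h.symm.snd] at e4 ⊢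
    subst e4
    norm_num
    ring

theorem P_three_three {m : Fin n → ℕ} {i j : Fin n} (h : IsPair m (i, j) 3 3) :
    P m = qNumber 3 (p i i ^ 2 * (p i j * p j i) ^ 3 * p j j ^ 2) := by
  have h1 : ¬ ∃ ij : Fin n × Fin n, IsPair m ij 1 (m ij.2) := by
    rintro ⟨⟨a, b⟩, hab⟩
    have := h.unique hab
    grind
  have h2 : ¬ ∃ ij : Fin n × Fin n, IsPair m ij 2 (m ij.2) := by
    rintro ⟨⟨a, b⟩, hab⟩
    have := h.unique hab
    grind
  have h3 : ∃ ij : Fin n × Fin n, IsPair m ij 3 3 := ⟨(i, j), h⟩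
  rw [P, dif_neg h.not_single, dif_neg h1, dif_neg h2, dif_pos h3]
  rcases h.unique (h3.choose_spec) with ⟨e, -, -⟩ | ⟨e, e3, e4⟩
  · simp only [e]
  · simp only [e]
    congr 1
    ring

theorem P_three_four {m : Fin n → ℕ} {i j : Fin n} (h : IsPair m (i, j) 3 4) :
    P m = (1 - p i i ^ 2 * (p i j * p j i) ^ 4 * p j j ^ 4) *
      qNumber 3 (p i i * (p i j * p j i) ^ 2 * p j j ^ 2) := by
  have h1 : ¬ ∃ ij : Fin n × Fin n, IsPair m ij 1 (m ij.2) := by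
    rintro ⟨⟨a, b⟩, hab⟩
    have := h.unique hab
    grind
  have h2 : ¬ ∃ ij : Fin n × Fin n, IsPair m ij 2 (m ij.2) := by
    rintro ⟨⟨a, b⟩, hab⟩
    have := h.unique hab
    grind
  have h3 : ¬ ∃ ij : Fin n × Fin n, IsPair m ij 3 3 := by
    rintro ⟨⟨a, b⟩, hab⟩
    have := h.unique hab
    grind
  have h4 : ∃ ij : Fin n × Fin n, IsPair m ij 3 4 := ⟨(i, j), h⟩
  rw [P, dif_neg h.not_single, dif_neg h1, dif_neg h2, dif_neg h3, dif_pos h4]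
  rcases h.unique (h4.choose_spec) with ⟨e, -, -⟩ | ⟨e, e3, e4⟩
  · simp only [e]
  · omega

theorem P_three_six {m : Fin n → ℕ} {i j : Fin n} (h : IsPair m (i, j) 3 6) :
    P m = (1 - p i i * (p i j * p j i) ^ 3 * p j j ^ 5) *
      qNumber 3 (p i i ^ 2 * (p i j * p j i) ^ 6 * p j j ^ 10) := by
  have h1 : ¬ ∃ ij : Fin n × Fin n, IsPair m ij 1 (m ij.2) := by
    rintro ⟨⟨a, b⟩, hab⟩
    have := h.unique hab
    grind
  have h2 : ¬ ∃ ij : Fin n × Fin n, IsPair m ij 2 (m ij.2) := by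
    rintro ⟨⟨a, b⟩, hab⟩
    have := h.unique hab
    grind
  have h3 : ¬ ∃ ij : Fin n × Fin n, IsPair m ij 3 3 := by
    rintro ⟨⟨a, b⟩, hab⟩
    have := h.unique hab
    grind
  have h4 : ¬ ∃ ij : Fin n × Fin n, IsPair m ij 3 4 := by
    rintro ⟨⟨a, b⟩, hab⟩
    have := h.unique hab
    grind
  have h5 : ∃ ij : Fin n × Fin n, IsPair m ij 3 6 := ⟨(i, j), h⟩
  rw [P, dif_neg h.not_single, dif_neg h1, dif_neg h2, dif_neg h3, dif_neg h4, dif_pos h5]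
  rcases h.unique (h5.choose_spec) with ⟨e, -, -⟩ | ⟨e, e3, e4⟩
  · simp only [e]
  · omega

theorem P_four_four {m : Fin n → ℕ} {i j : Fin n} (h : IsPair m (i, j) 4 4) :
    P m = (1 + p i i ^ 3 * (p i j * p j i) ^ 4 * p j j ^ 3) *
      (1 + p i i ^ 6 * (p i j * p j i) ^ 8 * p j j ^ 6) := by
  have h1 : ¬ ∃ ij : Fin n × Fin n, IsPair m ij 1 (m ij.2) := by
    rintro ⟨⟨a, b⟩, hab⟩
    have := h.unique hab
    grind
  have h2 : ¬ ∃ ij : Fin n × Fin n, IsPair m ij 2 (m ij.2) := by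
    rintro ⟨⟨a, b⟩, hab⟩
    have := h.unique hab
    grind
  have h3 : ¬ ∃ ij : Fin n × Fin n, IsPair m ij 3 3 := by
    rintro ⟨⟨a, b⟩, hab⟩
    have := h.unique hab
    grind
  have h4 : ¬ ∃ ij : Fin n × Fin n, IsPair m ij 3 4 := by
    rintro ⟨⟨a, b⟩, hab⟩
    have := h.unique hab
    grind
  have h5 : ¬ ∃ ij : Fin n × Fin n, IsPair m ij 3 6 := by
    rintro ⟨⟨a, b⟩, hab⟩
    have := h.unique hab
    grind
  have h6 : ∃ ij : Fin n × Fin n, IsPair m ij 4 4 := ⟨(i, j), h⟩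
  rw [P, dif_neg h.not_single, dif_neg h1, dif_neg h2, dif_neg h3, dif_neg h4, dif_neg h5,
    dif_pos h6]
  rcases h.unique (h6.choose_spec) with ⟨e, -, -⟩ | ⟨e, e3, e4⟩
  · simp only [e]
  · simp only [e]
    ring

end Polynomials

/-! ### The diophantine equation -/

section Diophantine

variable {n : ℕ}

/-- The matrix `(q^{a_{ij}})`. -/
def powerMatrix {k : Type*} [Field k] (q : k) (a : Matrix (Fin n) (Fin n) ℤ) :
    Matrix (Fin n) (Fin n) k :=
  Matrix.of fun i j => q ^ a i j

/-- `K(m) = ∑_{i,j} a_{ij} m_i m_j`. -/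
def quadForm (a : Matrix (Fin n) (Fin n) ℤ) (m : Fin n → ℕ) : ℤ :=
  ∑ i, ∑ j, a i j * (m i : ℤ) * (m j : ℤ)

/-- `λ(m) = ∑_i a_{ii} m_i`. -/
def linForm (a : Matrix (Fin n) (Fin n) ℤ) (m : Fin n → ℕ) : ℤ :=
  ∑ i, a i i * (m i : ℤ)

/-- The exceptional degrees. In the first case, the degree `m e_i` is exceptional unless both
`a_{ii} = 0` and `m = 0` in `k`; the latter cannot happen in characteristic zero. -/
def IsExceptional (k : Type*) [Field k] (a : Matrix (Fin n) (Fin n) ℤ) (m : Fin n → ℕ) : Prop :=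
  (∃ i : Fin n, ∃ c : ℕ, 2 ≤ c ∧ (a i i ≠ 0 ∨ (c : k) ≠ 0) ∧ m = Pi.single i c) ∨
  (∃ i j : Fin n, i ≠ j ∧ ∃ c : ℕ, 1 ≤ c ∧ m = Pi.single i 2 + Pi.single j (2 * c)) ∨
  (∃ i j : Fin n, i ≠ j ∧
    (m = Pi.single i 3 + Pi.single j 3 ∨ m = Pi.single i 4 + Pi.single j 4))

end Diophantine

end DiagonalNichols

/-! The Nichols ideal is the radical of the family of functionals `ε ∂_{i_1} ⋯ ∂_{i_m}`, where `∂_j`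
are the skew derivations of `T(V)` (`nicholsIdeal_eq_radicalIdeal`). Hence `B(V) = T(V)` exactly
when the component `Δ_{m-1,1}` of the coproduct, written `der` in coordinates on words, is injective
in every nonzero multidegree `m` (`nicholsIsFree_iff_injectiveAt`). Multidegrees are treated by
induction on `|m|`.

The engine is the identity `der (1 - γ) = (1 - γ') derTail` of `der_one_sub_rot`. Here `γ = rot` is
the braided rotation of words, `γ' = rotTail` rotates only the tail, and `derTail` is `der` in
degree `|m| - 1`, hence bijective by induction. Both `γ ^ |m|` and `γ' ^ (|m| - 1)` act in degree
`m` by the full monodromy `q ^ (K(m) - λ(m))`.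

If `K(m) ≠ λ(m)`, this scalar is not 1, so `1 - γ'` is injective, and `der` is surjective and
therefore injective (`injectiveAt_of_monodromy_ne_one`). If `K(m) = λ(m)`, then `ker (1 - γ)` is
contained in the kernel of `(1 - γ') derTail`, whose dimension is that of `ker (1 - γ')`. Different
dimensions produce a kernel vector of `der` (`not_injectiveAt_of_finrank_ne`). Equal dimensions give
injectivity when some `m_i (m_i - 1)` is nonzero in `k`: `q_{ii}` is deformed over the dual numbers
so that the monodromy becomes `1 + M ε` with `M` invertible (`injectiveAt_of_finrank_eq`).

It remains to compare the dimensions. Since `q` is not a root of unity, the scalars along orbits can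
be untwisted, and the two dimensions count cyclic words and words with a cyclic tail
(`finrank_twisted_invariants`). Burnside's lemma and growth estimates for multinomial coefficients
(`sum_gcd_lt`) show that, on supports with at least two indices, the numbers agree only in the
exceptional degrees. Degrees `r e_i` are settled directly by `(r)_{q_{ii}}`.

The statements on `P_m` follow by evaluation at `(q^{a_{ij}})`: every factor is `1 - q^e`, `1 + q^e`
or some `(r)_{q^e}`, whose zeros are known (`detects`). Part (2) follows because `a (x(x-1) +
y(y-1)) - b x y` has no zero with `x + y ≥ 2` (`not_exists_solution`). -/

namespace DiagonalNichols

/-! ### Skew derivations, and the Nichols ideal as the radical of their iterates -/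

section Criterion

variable {k : Type*} [Field k] {n : ℕ} {V : Type*} [AddCommGroup V] [Module k V]

/-- The monomial `x_{i_1} ⋯ x_{i_m}` of `T(V)`. -/
noncomputable def word (x : Module.Basis (Fin n) k V) (w : List (Fin n)) : TensorAlgebra k V :=
  (w.map fun i => TensorAlgebra.ι k (x i)).prod

@[simp] theorem word_nil (x : Module.Basis (Fin n) k V) : word x [] = 1 := rfl

theorem word_cons (x : Module.Basis (Fin n) k V) (i : Fin n) (w : List (Fin n)) :
    word x (i :: w) = TensorAlgebra.ι k (x i) * word x w := by
  simp [word]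

/-- The monomials form a basis of `T(V)`. -/
noncomputable def wordBasis (x : Module.Basis (Fin n) k V) :
    Module.Basis (List (Fin n)) k (TensorAlgebra k V) :=
  x.tensorAlgebra.reindex FreeMonoid.toList

theorem wordBasis_apply (x : Module.Basis (Fin n) k V) (w : List (Fin n)) :
    wordBasis x w = word x w := by
  have h : ∀ w : FreeMonoid (Fin n), x.tensorAlgebra w = word x w.toList := by
    intro w
    rw [Module.Basis.tensorAlgebra, Module.Basis.map_apply]
    have : FreeAlgebra.basisFreeMonoid k (Fin n) w =
        FreeAlgebra.equivMonoidAlgebraFreeMonoid.symm (MonoidAlgebra.single w 1) := rfl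
    rw [this]
    induction w using FreeMonoid.recOn with
    | one => simp [← MonoidAlgebra.one_def]
    | of_mul i w ih =>
      have e : (MonoidAlgebra.single (FreeMonoid.of i * w) (1 : k)) =
          MonoidAlgebra.single (FreeMonoid.of i) 1 * MonoidAlgebra.single w 1 := by
        simp [MonoidAlgebra.single_mul_single]
      rw [e, map_mul]
      replace ih := ih rfl
      simp only [AlgEquiv.toLinearEquiv_apply] at ih ⊢
      rw [map_mul, ih, FreeMonoid.toList_mul, FreeMonoid.toList_of, List.singleton_append,
        word_cons]
      congr 1
      simp [FreeAlgebra.equivMonoidAlgebraFreeMonoid]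
  rw [wordBasis, Module.Basis.reindex_apply, h]
  rfl

theorem hom_ext_word (x : Module.Basis (Fin n) k V) {M : Type*} [AddCommMonoid M] [Module k M]
    {f g : TensorAlgebra k V →ₗ[k] M} (h : ∀ w, f (word x w) = g (word x w)) : f = g :=
  (wordBasis x).ext fun w => by simpa [wordBasis_apply] using h w

theorem word_induction (x : Module.Basis (Fin n) k V) {M : Type*} [AddCommMonoid M] [Module k M]
    {f g : TensorAlgebra k V →ₗ[k] M} (h1 : f 1 = g 1)
    (h : ∀ i u, f u = g u → f (TensorAlgebra.ι k (x i) * u) = g (TensorAlgebra.ι k (x i) * u)) :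
    f = g :=
  hom_ext_word x fun w => by
    induction w with
    | nil => simpa using h1
    | cons i w ih => rw [word_cons]; exact h i _ ih

/-- The coefficient of a monomial. -/
noncomputable def wordCoeff (x : Module.Basis (Fin n) k V) (w : List (Fin n)) :
    TensorAlgebra k V →ₗ[k] k :=
  (wordBasis x).coord w

theorem wordCoeff_word (x : Module.Basis (Fin n) k V) (w u : List (Fin n)) :
    wordCoeff x w (word x u) = if u = w then 1 else 0 := by
  rw [wordCoeff, ← wordBasis_apply, Module.Basis.coord_apply, Module.Basis.repr_self,
    Finsupp.single_apply]

theorem wordCoeff_nil_one (x : Module.Basis (Fin n) k V) : wordCoeff x [] 1 = 1 := by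
  simpa using wordCoeff_word x [] []

theorem wordCoeff_nil_mul (x : Module.Basis (Fin n) k V) (i : Fin n) (u : TensorAlgebra k V) :
    wordCoeff x [] (TensorAlgebra.ι k (x i) * u) = 0 := by
  have : wordCoeff x [] ∘ₗ LinearMap.mulLeft k (TensorAlgebra.ι k (x i)) = 0 :=
    hom_ext_word x fun w => by simp [← word_cons, wordCoeff_word]
  exact LinearMap.congr_fun this u

theorem wordCoeff_singleton_mul (x : Module.Basis (Fin n) k V) (i j : Fin n)
    (u : TensorAlgebra k V) :
    wordCoeff x [j] (TensorAlgebra.ι k (x i) * u) = if i = j then wordCoeff x [] u else 0 := by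
  have : wordCoeff x [j] ∘ₗ LinearMap.mulLeft k (TensorAlgebra.ι k (x i)) =
      (if i = j then (1 : k) else 0) • wordCoeff x [] :=
    hom_ext_word x fun w => by
      by_cases h : i = j <;> simp [← word_cons, wordCoeff_word, h]
  have := LinearMap.congr_fun this u
  split_ifs with h <;> simpa [h] using this

variable (x : Module.Basis (Fin n) k V) (Q : Matrix (Fin n) (Fin n) k)

theorem scaling_ι (i j : Fin n) :
    scaling x Q i (TensorAlgebra.ι k (x j)) = Q i j • TensorAlgebra.ι k (x j) := by
  simp [scaling]

theorem mulPrimitive_tmul (i : Fin n) (u v : TensorAlgebra k V) :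
    mulPrimitive x Q i (u ⊗ₜ v) = (TensorAlgebra.ι k (x i) * u) ⊗ₜ v +
      scaling x Q i u ⊗ₜ (TensorAlgebra.ι k (x i) * v) := by
  simp [mulPrimitive]

/-- The skew derivation `(id ⊗ ε_j) Δ`, where `ε_j` is the coefficient of `x_j`. -/
noncomputable def skewDer (j : Fin n) : TensorAlgebra k V →ₗ[k] TensorAlgebra k V :=
  (TensorProduct.rid k _).toLinearMap ∘ₗ
    TensorProduct.map LinearMap.id (wordCoeff x [j]) ∘ₗ coproduct x Q

theorem coproduct_counit (u : TensorAlgebra k V) :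
    TensorProduct.rid k _ (TensorProduct.map LinearMap.id (wordCoeff x []) (coproduct x Q u)) =
      u := by
  have : (TensorProduct.rid k _).toLinearMap ∘ₗ
      TensorProduct.map LinearMap.id (wordCoeff x []) ∘ₗ coproduct x Q = LinearMap.id := by
    refine word_induction x (by simp [coproduct_one, wordCoeff_nil_one]) fun i u hu => ?_
    have h : ∀ z, TensorProduct.rid k _ (TensorProduct.map LinearMap.id (wordCoeff x [])
        (mulPrimitive x Q i z)) = TensorAlgebra.ι k (x i) *
        TensorProduct.rid k _ (TensorProduct.map LinearMap.id (wordCoeff x []) z) := by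
      intro z
      induction z with
      | zero => simp
      | add a b ha hb => simp only [map_add, ha, hb, mul_add]
      | tmul a b => simp [mulPrimitive_tmul, wordCoeff_nil_mul]
    simp only [LinearMap.comp_apply, LinearEquiv.coe_coe, LinearMap.id_apply] at hu ⊢
    rw [coproduct_mul, h, hu]
  exact LinearMap.congr_fun this u

@[simp] theorem skewDer_one (j : Fin n) : skewDer x Q j 1 = 0 := by
  have : wordCoeff x [j] (1 : TensorAlgebra k V) = 0 := by
    simpa using wordCoeff_word x [j] []
  simp [skewDer, coproduct_one, this]

/-- The skew Leibniz rule for a letter on the left: the twist by `g_i` arises because `∂_j` must hit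
`x_i` after `x_i` is braided past `u`. -/
theorem skewDer_mul (i j : Fin n) (u : TensorAlgebra k V) :
    skewDer x Q j (TensorAlgebra.ι k (x i) * u) = TensorAlgebra.ι k (x i) * skewDer x Q j u +
      if i = j then scaling x Q i u else 0 := by
  have h : ∀ z, TensorProduct.rid k _ (TensorProduct.map LinearMap.id (wordCoeff x [j])
      (mulPrimitive x Q i z)) = TensorAlgebra.ι k (x i) *
      TensorProduct.rid k _ (TensorProduct.map LinearMap.id (wordCoeff x [j]) z) +
      if i = j then scaling x Q i (TensorProduct.rid k _
        (TensorProduct.map LinearMap.id (wordCoeff x []) z)) else 0 := by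
    intro z
    induction z with
    | zero => simp
    | add a b ha hb =>
      simp only [map_add, ha, hb, mul_add]
      split_ifs <;> abel
    | tmul a b =>
      simp only [mulPrimitive_tmul, map_add, TensorProduct.map_tmul, LinearMap.id_apply,
        TensorProduct.rid_tmul, wordCoeff_singleton_mul]
      split_ifs <;> simp
  simp only [skewDer, LinearMap.comp_apply, LinearEquiv.coe_coe]
  rw [coproduct_mul, h, coproduct_counit]

theorem coproduct_scaling (i : Fin n) (u : TensorAlgebra k V) :
    coproduct x Q (scaling x Q i u) =
      TensorProduct.map (scaling x Q i).toLinearMap (scaling x Q i).toLinearMap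
        (coproduct x Q u) := by
  have : coproduct x Q ∘ₗ (scaling x Q i).toLinearMap =
      TensorProduct.map (scaling x Q i).toLinearMap (scaling x Q i).toLinearMap ∘ₗ
        coproduct x Q := by
    refine word_induction x (by simp [coproduct_one]) fun j u hu => ?_
    have comm : ∀ u, scaling x Q i (scaling x Q j u) = scaling x Q j (scaling x Q i u) := by
      intro u
      have : (scaling x Q i).toLinearMap ∘ₗ (scaling x Q j).toLinearMap =
        (scaling x Q j).toLinearMap ∘ₗ (scaling x Q i).toLinearMap := by
        refine word_induction x (by simp) fun l u hu => ?_
        simp only [LinearMap.comp_apply, AlgHom.toLinearMap_apply] at hu ⊢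
        simp [scaling_ι, hu, smul_smul, mul_comm]
      exact LinearMap.congr_fun this u
    have h : ∀ z, TensorProduct.map (scaling x Q i).toLinearMap (scaling x Q i).toLinearMap
        (mulPrimitive x Q j z) = Q i j • mulPrimitive x Q j
        (TensorProduct.map (scaling x Q i).toLinearMap (scaling x Q i).toLinearMap z) := by
      intro z
      induction z with
      | zero => simp
      | add a b ha hb => simp only [map_add, ha, hb, smul_add]
      | tmul a b =>
        simp [mulPrimitive_tmul, scaling_ι, TensorProduct.smul_tmul', comm]
    simp only [LinearMap.comp_apply, AlgHom.toLinearMap_apply] at hu ⊢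
    rw [coproduct_mul, h, map_mul, scaling_ι, smul_mul_assoc, map_smul, coproduct_mul, hu]
  exact LinearMap.congr_fun this u

/-- Coassociativity, in the form `(id ⊗ ∂_j) Δ = Δ ∂_j`. -/
theorem coproduct_skewDer (j : Fin n) (u : TensorAlgebra k V) :
    TensorProduct.map LinearMap.id (skewDer x Q j) (coproduct x Q u) =
      coproduct x Q (skewDer x Q j u) := by
  have : TensorProduct.map LinearMap.id (skewDer x Q j) ∘ₗ coproduct x Q =
      coproduct x Q ∘ₗ skewDer x Q j := by
    refine word_induction x (by simp [coproduct_one]) fun i u hu => ?_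
    have h : ∀ z, TensorProduct.map LinearMap.id (skewDer x Q j) (mulPrimitive x Q i z) =
        mulPrimitive x Q i (TensorProduct.map LinearMap.id (skewDer x Q j) z) +
        if i = j then TensorProduct.map (scaling x Q i).toLinearMap
          (scaling x Q i).toLinearMap z else 0 := by
      intro z
      induction z with
      | zero => simp
      | add a b ha hb =>
        simp only [map_add, ha, hb]
        split_ifs <;> abel
      | tmul a b =>
        simp only [mulPrimitive_tmul, map_add, TensorProduct.map_tmul, LinearMap.id_apply,
          skewDer_mul, TensorProduct.tmul_add]
        split_ifs <;> simp [add_assoc]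
    simp only [LinearMap.comp_apply] at hu ⊢
    rw [coproduct_mul, h, hu, skewDer_mul, map_add, coproduct_mul]
    split_ifs <;> simp [coproduct_scaling]
  exact LinearMap.congr_fun this u

/-- The functional `ε ∂_{i_1} ⋯ ∂_{i_m}`. -/
noncomputable def pairing : List (Fin n) → TensorAlgebra k V →ₗ[k] k
  | [] => wordCoeff x []
  | j :: w => pairing w ∘ₗ skewDer x Q j

/-- The functionals multiply by concatenation under the product dual to `Δ`. This is what turns the
radical into a coideal. -/
theorem pairing_coproduct (w w' : List (Fin n)) (u : TensorAlgebra k V) :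
    TensorProduct.map (pairing x Q w) (pairing x Q w') (coproduct x Q u) =
      (pairing x Q (w' ++ w) u) ⊗ₜ 1 := by
  induction w' generalizing u with
  | nil =>
    have h : ∀ z : TensorAlgebra k V ⊗[k] TensorAlgebra k V,
        TensorProduct.map (pairing x Q w) (wordCoeff x []) z =
        pairing x Q w (TensorProduct.rid k _ (TensorProduct.map LinearMap.id (wordCoeff x []) z))
          ⊗ₜ 1 := by
      intro z
      induction z with
      | zero => simp
      | add a b ha hb => simp only [map_add, ha, hb, TensorProduct.add_tmul]
      | tmul a b =>
        simp only [TensorProduct.map_tmul, LinearMap.id_apply, TensorProduct.rid_tmul, map_smul]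
        rw [TensorProduct.smul_tmul, smul_eq_mul, mul_one]
    rw [pairing, h, coproduct_counit]
    rfl
  | cons j w' ih =>
    rw [List.cons_append, pairing, pairing, LinearMap.comp_apply, ← ih, ← coproduct_skewDer,
      TensorProduct.map_map, LinearMap.comp_id]

theorem skewDer_scaling (i j : Fin n) (u : TensorAlgebra k V) :
    skewDer x Q j (scaling x Q i u) = Q i j • scaling x Q i (skewDer x Q j u) := by
  have hc : wordCoeff x [j] ∘ₗ (scaling x Q i).toLinearMap = Q i j • wordCoeff x [j] := by
    refine hom_ext_word x fun w => ?_
    have h : ∀ w, ∃ c : k, scaling x Q i (word x w) = c • word x w ∧ (w = [j] → c = Q i j) := by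
      intro w
      induction w with
      | nil => exact ⟨1, by simp⟩
      | cons l w ih =>
        obtain ⟨c, hc, -⟩ := ih
        by_cases hw : w = []
        · subst hw
          exact ⟨Q i l, by simp [word_cons, scaling_ι], by simp +contextual⟩
        · exact ⟨Q i l * c, by simp [word_cons, scaling_ι, hc, smul_smul, mul_comm], by simp [hw]⟩
    obtain ⟨c, hc, hj⟩ := h w
    simp only [LinearMap.comp_apply, AlgHom.toLinearMap_apply, hc, map_smul, wordCoeff_word,
      LinearMap.smul_apply]
    split_ifs with hw
    · rw [hj hw]
    · simp
  have h : ∀ z : TensorAlgebra k V ⊗[k] TensorAlgebra k V,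
      TensorProduct.rid k _ (TensorProduct.map LinearMap.id (wordCoeff x [j])
        (TensorProduct.map (scaling x Q i).toLinearMap (scaling x Q i).toLinearMap z)) =
      Q i j • scaling x Q i (TensorProduct.rid k _ (TensorProduct.map LinearMap.id
        (wordCoeff x [j]) z)) := by
    intro z
    induction z with
    | zero => simp
    | add a b ha hb => simp only [map_add, ha, hb, smul_add]
    | tmul a b =>
      have := LinearMap.congr_fun hc b
      simp only [LinearMap.comp_apply, AlgHom.toLinearMap_apply, LinearMap.smul_apply] at this
      simp [this, smul_smul]
  simp only [skewDer, LinearMap.comp_apply, LinearEquiv.coe_coe]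
  rw [coproduct_scaling, h]

/-- The mirror image of `skewDer_mul`, needed for the radical to be a right ideal. Here the twist is
only the scalar `q_{ji}`. -/
theorem skewDer_mul_ι (i j : Fin n) (u : TensorAlgebra k V) :
    skewDer x Q j (u * TensorAlgebra.ι k (x i)) = (if i = j then u else 0) +
      Q j i • (skewDer x Q j u * TensorAlgebra.ι k (x i)) := by
  have : skewDer x Q j ∘ₗ LinearMap.mulRight k (TensorAlgebra.ι k (x i)) =
      (if i = j then LinearMap.id else 0) +
        Q j i • (LinearMap.mulRight k (TensorAlgebra.ι k (x i)) ∘ₗ skewDer x Q j) := by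
    refine word_induction x ?_ fun l u hu => ?_
    · have := skewDer_mul x Q i j 1
      simp only [mul_one, skewDer_one, mul_zero, zero_add, map_one] at this
      simp only [LinearMap.comp_apply, LinearMap.mulRight_apply, one_mul, this,
        LinearMap.add_apply, LinearMap.smul_apply, skewDer_one, zero_mul, smul_zero, add_zero]
      split_ifs <;> simp
    · simp only [LinearMap.comp_apply, LinearMap.mulRight_apply, LinearMap.add_apply,
        LinearMap.smul_apply] at hu ⊢
      rw [mul_assoc, skewDer_mul, hu, skewDer_mul, map_mul, scaling_ι]
      split_ifs <;> subst_vars <;>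
        simp [mul_add, add_mul, mul_assoc, add_assoc]
  have := LinearMap.congr_fun this u
  simp only [LinearMap.comp_apply, LinearMap.mulRight_apply, LinearMap.add_apply,
    LinearMap.smul_apply] at this
  rw [this]
  split_ifs <;> simp

theorem word_mem_tensorPower (w : List (Fin n)) : word x w ∈ tensorPower k V w.length := by
  induction w with
  | nil => simp [Submodule.one_le.mp le_rfl]
  | cons i w ih =>
    rw [word_cons, List.length_cons, tensorPower, pow_succ']
    exact Submodule.mul_mem_mul (LinearMap.mem_range_self _ _) ih

theorem proj_word (m : ℕ) (w : List (Fin n)) :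
    GradedAlgebra.proj (tensorPower k V) m (word x w) = if w.length = m then word x w else 0 := by
  rw [GradedAlgebra.proj_apply]
  split_ifs with h
  · subst h
    exact DirectSum.decompose_of_mem_same _ (word_mem_tensorPower x w)
  · exact DirectSum.decompose_of_mem_ne _ (word_mem_tensorPower x w) h

theorem skewDer_word_mem_span (j : Fin n) (u : List (Fin n)) :
    skewDer x Q j (word x u) ∈
      Submodule.span k (word x '' {v : List (Fin n) | v.length + 1 = u.length}) := by
  have hs : ∀ (i : Fin n) (u : List (Fin n)), ∃ c : k,
      scaling x Q i (word x u) = c • word x u := by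
    intro i u
    induction u with
    | nil => exact ⟨1, by simp⟩
    | cons l w ih =>
      obtain ⟨c, hc⟩ := ih
      exact ⟨Q i l * c, by simp [word_cons, scaling_ι, hc, smul_smul, mul_comm]⟩
  induction u with
  | nil => simp
  | cons i u ih =>
    rw [word_cons, skewDer_mul]
    refine add_mem ?_ ?_
    · have : Submodule.span k (word x '' {v : List (Fin n) | v.length + 1 = u.length}) ≤
        (Submodule.span k (word x '' {v : List (Fin n) | v.length + 1 = (i :: u).length})).comap
          (LinearMap.mulLeft k (TensorAlgebra.ι k (x i))) := by
        rw [Submodule.span_le]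
        rintro _ ⟨v, hv, rfl⟩
        refine Submodule.subset_span ⟨i :: v, ?_, word_cons _ _ _⟩
        simpa using hv
      exact this ih
    · split_ifs
      · obtain ⟨c, hc⟩ := hs i u
        rw [hc]
        exact Submodule.smul_mem _ _ (Submodule.subset_span ⟨u, by simp, rfl⟩)
      · exact zero_mem _

theorem pairing_word (w u : List (Fin n)) (h : u.length ≠ w.length) :
    pairing x Q w (word x u) = 0 := by
  induction w generalizing u with
  | nil =>
    rw [pairing, wordCoeff_word, if_neg]
    rintro rfl
    exact h rfl
  | cons j w ih =>
    rw [pairing, LinearMap.comp_apply]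
    have : Submodule.span k (word x '' {v : List (Fin n) | v.length + 1 = u.length}) ≤
        LinearMap.ker (pairing x Q w) := by
      rw [Submodule.span_le]
      rintro _ ⟨v, hv, rfl⟩
      refine ih v fun e => h ?_
      rw [← hv, e, List.length_cons]
    exact this (skewDer_word_mem_span x Q j u)

theorem pairing_proj (w : List (Fin n)) (m : ℕ) (u : TensorAlgebra k V) :
    pairing x Q w (GradedAlgebra.proj (tensorPower k V) m u) =
      if w.length = m then pairing x Q w u else 0 := by
  have : pairing x Q w ∘ₗ GradedAlgebra.proj (tensorPower k V) m =
      (if w.length = m then (1 : k) else 0) • pairing x Q w := by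
    refine hom_ext_word x fun v => ?_
    rw [LinearMap.comp_apply, proj_word, LinearMap.smul_apply]
    by_cases hv : v.length = w.length
    · rw [hv]
      split_ifs <;> simp
    · rw [pairing_word x Q w v hv]
      split_ifs <;> simp [pairing_word x Q w v hv]
  have := LinearMap.congr_fun this u
  simp only [LinearMap.comp_apply, LinearMap.smul_apply] at this
  rw [this]
  split_ifs <;> simp

/-- Every functional is an eigenvector for `g_i`, because `∂_j` and `g_i` commute up to `q_{ij}`.
Therefore the twist in the Leibniz rule does not leave the radical. -/
theorem pairing_scaling (w : List (Fin n)) (i : Fin n) :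
    ∃ c : k, ∀ u, pairing x Q w (scaling x Q i u) = c * pairing x Q w u := by
  induction w with
  | nil =>
    refine ⟨1, fun u => ?_⟩
    have : wordCoeff x [] ∘ₗ (scaling x Q i).toLinearMap = wordCoeff x [] := by
      refine word_induction x (by simp) fun l u hu => ?_
      simp [scaling_ι, wordCoeff_nil_mul]
    simpa [pairing] using LinearMap.congr_fun this u
  | cons j w ih =>
    obtain ⟨c, hc⟩ := ih
    refine ⟨Q i j * c, fun u => ?_⟩
    rw [pairing, LinearMap.comp_apply, skewDer_scaling, map_smul, hc, LinearMap.comp_apply,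
      smul_eq_mul, mul_assoc]

/-- The radical `{u | ε ∂_{i_1} ⋯ ∂_{i_m} u = 0}`, as a subspace of `T(V)`. -/
noncomputable def radical : Submodule k (TensorAlgebra k V) :=
  ⨅ w, LinearMap.ker (pairing x Q w)

theorem mem_radical {u : TensorAlgebra k V} : u ∈ radical x Q ↔ ∀ w, pairing x Q w u = 0 := by
  simp [radical]

theorem skewDer_mem_radical {u : TensorAlgebra k V} (hu : u ∈ radical x Q) (j : Fin n) :
    skewDer x Q j u ∈ radical x Q :=
  (mem_radical x Q).2 fun w => (mem_radical x Q).1 hu (j :: w)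

theorem ι_mul_mem_radical {u : TensorAlgebra k V} (hu : u ∈ radical x Q) (i : Fin n) :
    TensorAlgebra.ι k (x i) * u ∈ radical x Q := by
  rw [mem_radical]
  intro w
  induction w generalizing u with
  | nil => exact wordCoeff_nil_mul x i u
  | cons j w ih =>
    rw [pairing, LinearMap.comp_apply, skewDer_mul, map_add, ih (skewDer_mem_radical x Q hu j),
      zero_add]
    split_ifs
    · obtain ⟨c, hc⟩ := pairing_scaling x Q w i
      rw [hc, (mem_radical x Q).1 hu, mul_zero]
    · simp

theorem mul_ι_mem_radical {u : TensorAlgebra k V} (hu : u ∈ radical x Q) (i : Fin n) :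
    u * TensorAlgebra.ι k (x i) ∈ radical x Q := by
  rw [mem_radical]
  intro w
  induction w generalizing u with
  | nil =>
    have : wordCoeff x [] ∘ₗ LinearMap.mulRight k (TensorAlgebra.ι k (x i)) = 0 := by
      refine word_induction x ?_ fun l u hu => ?_
      · simpa using wordCoeff_nil_mul x i 1
      · simp [wordCoeff_nil_mul, mul_assoc]
    exact LinearMap.congr_fun this u
  | cons j w ih =>
    rw [pairing, LinearMap.comp_apply, skewDer_mul_ι, map_add, map_smul,
      ih (skewDer_mem_radical x Q hu j), smul_zero, add_zero]
    split_ifs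
    · exact (mem_radical x Q).1 hu w
    · simp

theorem ι_eq_sum (v : V) :
    TensorAlgebra.ι k v = ∑ i, x.repr v i • TensorAlgebra.ι k (x i) := by
  conv_lhs => rw [← x.sum_repr v]
  simp only [map_sum, map_smul]

theorem mul_mem_radical (a : TensorAlgebra k V) :
    ∀ u ∈ radical x Q, a * u ∈ radical x Q ∧ u * a ∈ radical x Q := by
  induction a using TensorAlgebra.induction with
  | algebraMap r =>
    intro u hu
    rw [← Algebra.commutes, ← Algebra.smul_def]
    exact ⟨Submodule.smul_mem _ _ hu, Submodule.smul_mem _ _ hu⟩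
  | ι v =>
    intro u hu
    rw [ι_eq_sum x v, Finset.sum_mul, Finset.mul_sum]
    constructor <;> refine Submodule.sum_mem _ fun i _ => ?_
    · rw [smul_mul_assoc]
      exact Submodule.smul_mem _ _ (ι_mul_mem_radical x Q hu i)
    · rw [mul_smul_comm]
      exact Submodule.smul_mem _ _ (mul_ι_mem_radical x Q hu i)
  | mul a b ha hb =>
    intro u hu
    rw [mul_assoc, ← mul_assoc u]
    exact ⟨(ha _ (hb u hu).1).1, (hb _ (ha u hu).2).2⟩
  | add a b ha hb =>
    intro u hu
    rw [add_mul, mul_add]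
    exact ⟨add_mem (ha u hu).1 (hb u hu).1, add_mem (ha u hu).2 (hb u hu).2⟩

/-- The radical, as a two-sided ideal of `T(V)`. -/
noncomputable def radicalIdeal : TwoSidedIdeal (TensorAlgebra k V) :=
  .mk' (radical x Q) (zero_mem _) add_mem neg_mem (fun h => (mul_mem_radical x Q _ _ h).1)
    (fun h => (mul_mem_radical x Q _ _ h).2)

theorem mem_radicalIdeal {u : TensorAlgebra k V} : u ∈ radicalIdeal x Q ↔ u ∈ radical x Q := by
  simp [radicalIdeal]

/-- A tensor in `X ⊗ Y` which is killed by `f ⊗ g` for all `f`, `g` in families of functionals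
which separate the points of `X` and `Y` is zero. -/
theorem tensor_eq_zero_of_separating {X Y ι κ : Type*} [AddCommGroup X] [Module k X]
    [AddCommGroup Y] [Module k Y] (f : ι → X →ₗ[k] k) (g : κ → Y →ₗ[k] k)
    (hf : ∀ a, (∀ i, f i a = 0) → a = 0) (hg : ∀ b, (∀ i, g i b = 0) → b = 0) (z : X ⊗[k] Y)
    (hz : ∀ i j, TensorProduct.map (f i) (g j) z = 0) : z = 0 := by
  classical
  let B := Module.Free.chooseBasis k X
  refine (TensorProduct.equivFinsuppOfBasisLeft (N := Y) B).injective ?_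
  rw [map_zero]
  ext i
  refine hg _ fun j => ?_
  have h1 : TensorProduct.rid k _ (TensorProduct.map LinearMap.id (g j) z) = 0 := by
    refine hf _ fun l => ?_
    have : ∀ z, f l (TensorProduct.rid k _ (TensorProduct.map LinearMap.id (g j) z)) =
        TensorProduct.rid k k (TensorProduct.map (f l) (g j) z) := by
      intro z
      induction z with
      | zero => simp
      | add a b ha hb => simp only [map_add, ha, hb]
      | tmul a b => simp
    rw [this, hz, map_zero]
  have h2 : ∀ z : X ⊗[k] Y, g j (TensorProduct.equivFinsuppOfBasisLeft B z i) =
      B.coord i (TensorProduct.rid k _ (TensorProduct.map LinearMap.id (g j) z)) := by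
    intro z
    induction z with
    | zero => simp
    | add a b ha hb => simp only [map_add, Finsupp.add_apply, ha, hb]
    | tmul a b => simp [mul_comm]
  rw [h2, h1, map_zero]

/-- The sum `J ⊗ X + X ⊗ J` is the kernel of `X ⊗ X → X/J ⊗ X/J`, and the induced functionals
separate the points of `X/J`. -/
theorem mem_range_sup_of_pairing {F : Type*} {X : Type*} [AddCommGroup X] [Module k X]
    (f : F → X →ₗ[k] k) (J : Submodule k X) (hJ : ∀ u, u ∈ J ↔ ∀ i, f i u = 0) (z : X ⊗[k] X)
    (hz : ∀ i j, TensorProduct.map (f i) (f j) z = 0) :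
    z ∈ LinearMap.range (TensorProduct.map J.subtype (LinearMap.id : X →ₗ[k] X)) ⊔
      LinearMap.range (TensorProduct.map (LinearMap.id : X →ₗ[k] X) J.subtype) := by
  have hle : ∀ i, J ≤ LinearMap.ker (f i) := fun i u hu => (hJ u).1 hu i
  have hex : Function.Exact J.subtype J.mkQ := by
    intro u
    simp
  have hker := TensorProduct.map_ker hex J.mkQ_surjective hex J.mkQ_surjective
  rw [sup_comm]
  change z ∈ LinearMap.range (J.subtype.lTensor X) ⊔ LinearMap.range (J.subtype.rTensor X)
  rw [← hker, LinearMap.mem_ker]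
  have hsep : ∀ a : X ⧸ J, (∀ i, J.liftQ (f i) (hle i) a = 0) → a = 0 := by
    intro a ha
    obtain ⟨u, rfl⟩ := J.mkQ_surjective a
    rw [Submodule.mkQ_apply, Submodule.Quotient.mk_eq_zero, hJ]
    exact ha
  refine tensor_eq_zero_of_separating (fun i => J.liftQ (f i) (hle i))
    (fun i => J.liftQ (f i) (hle i)) hsep hsep _ fun i j => ?_
  rw [TensorProduct.map_map, Submodule.liftQ_mkQ, Submodule.liftQ_mkQ, hz]

theorem radicalIdeal_isHomogeneousBiideal : IsHomogeneousBiideal x Q (radicalIdeal x Q) where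
  homogeneous r hr m := by
    rw [mem_radicalIdeal, mem_radical] at hr ⊢
    intro w
    rw [pairing_proj, hr, ite_self]
  degree_ge_two r hr m hm := by
    rw [mem_radicalIdeal, mem_radical] at hr
    refine (wordBasis x).ext_elem fun w => ?_
    have key : ∀ s : TensorAlgebra k V, (wordBasis x).repr
        (GradedAlgebra.proj (tensorPower k V) m s) w =
        if w.length = m then (wordBasis x).repr s w else 0 := by
      intro s
      have : wordCoeff x w ∘ₗ GradedAlgebra.proj (tensorPower k V) m =
          (if w.length = m then (1 : k) else 0) • wordCoeff x w := by
        refine hom_ext_word x fun v => ?_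
        rw [LinearMap.comp_apply, proj_word, LinearMap.smul_apply]
        by_cases hv : v = w
        · subst hv
          split_ifs <;> simp
        · split_ifs <;> simp [wordCoeff_word, hv]
      have := LinearMap.congr_fun this s
      simp only [LinearMap.comp_apply, LinearMap.smul_apply, wordCoeff,
        Module.Basis.coord_apply] at this
      rw [this]
      split_ifs <;> simp
    rw [key, map_zero, Finsupp.zero_apply]
    split_ifs with h
    · match w, h with
      | [], _ => exact hr []
      | [j], _ =>
        have h1 := hr [j]
        rw [pairing, pairing, LinearMap.comp_apply] at h1
        have : wordCoeff x [] ∘ₗ skewDer x Q j = wordCoeff x [j] := by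
          refine word_induction x ?_ fun i u hu => ?_
          · simpa using (wordCoeff_word x [j] []).symm
          · rw [LinearMap.comp_apply, skewDer_mul, map_add, wordCoeff_nil_mul, zero_add,
              wordCoeff_singleton_mul]
            -- Evaluation at `1` shows that the eigenvalue of the counit under `g_i` is 1.
            obtain ⟨c, hc⟩ := pairing_scaling x Q [] i
            have hc1 := hc 1
            simp only [pairing, map_one, wordCoeff_nil_one, mul_one] at hc1
            split_ifs
            · have := hc u
              rwa [← hc1, one_mul] at this
            · simp
        rw [← LinearMap.comp_apply, this] at h1
        exact h1
      | _ :: _ :: _, h => simp only [List.length_cons] at h; omega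
    · rfl
  coideal r hr := by
    rw [mem_radicalIdeal, mem_radical] at hr
    refine mem_range_sup_of_pairing (pairing x Q) (idealSubmodule (radicalIdeal x Q)) ?_ _ ?_
    · intro u
      rw [← mem_radical, ← mem_radicalIdeal]
      simp [idealSubmodule]
    · intro w w'
      rw [pairing_coproduct, hr, TensorProduct.zero_tmul]

/-- Since the ideal has no components in degrees 0 and 1, the counit and all `ε_j` vanish on it. The
coideal condition then makes it stable under each `∂_j`, so every iterated functional vanishes as
well. -/
theorem le_radicalIdeal {I : TwoSidedIdeal (TensorAlgebra k V)} (hI : IsHomogeneousBiideal x Q I) :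
    I ≤ radicalIdeal x Q := by
  have hmem : ∀ {u}, u ∈ idealSubmodule I ↔ u ∈ I := by simp [idealSubmodule]
  have hcoeff : ∀ w : List (Fin n), w.length < 2 → ∀ r ∈ I, wordCoeff x w r = 0 := by
    intro w hw r hr
    have h := hI.degree_ge_two r hr _ hw
    have : wordCoeff x w ∘ₗ GradedAlgebra.proj (tensorPower k V) w.length = wordCoeff x w := by
      refine hom_ext_word x fun v => ?_
      rw [LinearMap.comp_apply, proj_word]
      split_ifs with hv
      · rfl
      · rw [map_zero, wordCoeff_word, if_neg]
        rintro rfl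
        exact hv rfl
    rw [← this, LinearMap.comp_apply, h, map_zero]
  have hder : ∀ r ∈ I, ∀ j, skewDer x Q j r ∈ I := by
    intro r hr j
    rw [← hmem]
    have hle : LinearMap.range (TensorProduct.map (idealSubmodule I).subtype
        (LinearMap.id : TensorAlgebra k V →ₗ[k] TensorAlgebra k V)) ⊔
      LinearMap.range (TensorProduct.map
        (LinearMap.id : TensorAlgebra k V →ₗ[k] TensorAlgebra k V) (idealSubmodule I).subtype) ≤
      (idealSubmodule I).comap ((TensorProduct.rid k _).toLinearMap ∘ₗ
        TensorProduct.map LinearMap.id (wordCoeff x [j])) := by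
      refine sup_le ?_ ?_
      · rintro _ ⟨z, rfl⟩
        induction z with
        | zero => simp
        | add a b ha hb => rw [map_add]; exact add_mem ha hb
        | tmul a b =>
          simpa using Submodule.smul_mem _ _ a.2
      · rintro _ ⟨z, rfl⟩
        induction z with
        | zero => simp
        | add a b ha hb => rw [map_add]; exact add_mem ha hb
        | tmul a b =>
          simp [hcoeff [j] (by simp) b.1 (hmem.1 b.2)]
    exact hle (hI.coideal r hr)
  intro r hr
  rw [mem_radicalIdeal, mem_radical]
  intro w
  induction w generalizing r with
  | nil => exact hcoeff [] (by simp) r hr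
  | cons j w ih => exact ih (hder r hr j)

theorem nicholsIdeal_eq_radicalIdeal : nicholsIdeal x Q = radicalIdeal x Q :=
  le_antisymm (sSup_le fun _ hI => le_radicalIdeal x Q hI)
    (le_sSup (radicalIdeal_isHomogeneousBiideal x Q))

theorem nicholsIsFree_iff_radical : NicholsIsFree x Q ↔ radical x Q = ⊥ := by
  rw [NicholsIsFree, nicholsProj, Function.Bijective,
    and_iff_left (RingCon.mk'_surjective _), injective_iff_map_eq_zero, Submodule.eq_bot_iff]
  refine forall_congr' fun u => ?_
  rw [← mem_radicalIdeal, ← nicholsIdeal_eq_radicalIdeal, TwoSidedIdeal.mem_iff, ← RingCon.eq]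
  exact Iff.rfl

end Criterion

/-! ### Combinations of words: the operators `der` and `rot`, and the key identity -/

section Words

variable {n : ℕ} {R : Type*} [CommRing R]

/-- The scalar of the braiding `x_i ⊗ w ↦ χ_i(w) w ⊗ x_i` for a word `w`. -/
def chi (Q : Matrix (Fin n) (Fin n) R) (i : Fin n) (w : List (Fin n)) : R :=
  (w.map (Q i)).prod

/-- The scalar of the braiding `w ⊗ x_i ↦ χ'_i(w) x_i ⊗ w` for a word `w`. -/
def chiOp (Q : Matrix (Fin n) (Fin n) R) (i : Fin n) (w : List (Fin n)) : R :=
  (w.map fun l => Q l i).prod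

@[simp] theorem chi_nil (Q : Matrix (Fin n) (Fin n) R) (i : Fin n) : chi Q i [] = 1 := rfl

@[simp] theorem chi_cons (Q : Matrix (Fin n) (Fin n) R) (i l : Fin n) (w : List (Fin n)) :
    chi Q i (l :: w) = Q i l * chi Q i w := by simp [chi]

@[simp] theorem chi_append (Q : Matrix (Fin n) (Fin n) R) (i : Fin n) (w w' : List (Fin n)) :
    chi Q i (w ++ w') = chi Q i w * chi Q i w' := by simp [chi]

@[simp] theorem chiOp_nil (Q : Matrix (Fin n) (Fin n) R) (i : Fin n) : chiOp Q i [] = 1 := rfl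

@[simp] theorem chiOp_cons (Q : Matrix (Fin n) (Fin n) R) (i l : Fin n) (w : List (Fin n)) :
    chiOp Q i (l :: w) = Q l i * chiOp Q i w := by simp [chiOp]

theorem chi_perm (Q : Matrix (Fin n) (Fin n) R) (i : Fin n) {w w' : List (Fin n)}
    (h : w.Perm w') : chi Q i w = chi Q i w' :=
  (h.map _).prod_eq

/-- The linear map which inserts the letter `i` in the second position. -/
noncomputable def insertSecond (R : Type*) [CommRing R] (i : Fin n) :
    (List (Fin n) →₀ R) →ₗ[R] (List (Fin n) →₀ R) :=
  Finsupp.linearCombination R fun w => match w with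
    | [] => 0
    | y :: v => Finsupp.single (y :: i :: v) 1

@[simp] theorem insertSecond_nil (i : Fin n) (c : R) :
    insertSecond R i (Finsupp.single [] c) = 0 := by
  simp [insertSecond]

@[simp] theorem insertSecond_cons (i y : Fin n) (v : List (Fin n)) (c : R) :
    insertSecond R i (Finsupp.single (y :: v) c) = Finsupp.single (y :: i :: v) c := by
  simp [insertSecond]

/-- The part `Δ_{m-1,1}` of the coproduct of a word; the word `y v` stands for `v ⊗ x_y`. -/
noncomputable def derWord (Q : Matrix (Fin n) (Fin n) R) : List (Fin n) → (List (Fin n) →₀ R)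
  | [] => 0
  | i :: w => insertSecond R i (derWord Q w) + Finsupp.single (i :: w) (chi Q i w)

/-- The linear extension of `derWord`. -/
noncomputable def der (Q : Matrix (Fin n) (Fin n) R) :
    (List (Fin n) →₀ R) →ₗ[R] (List (Fin n) →₀ R) :=
  Finsupp.linearCombination R (derWord Q)

/-- The operator `id ⊗ Δ_{m-2,1}`. -/
noncomputable def derTail (Q : Matrix (Fin n) (Fin n) R) :
    (List (Fin n) →₀ R) →ₗ[R] (List (Fin n) →₀ R) :=
  Finsupp.linearCombination R fun w => match w with
    | [] => 0
    | i :: w => insertSecond R i (derWord Q w)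

/-- The braided rotation `x_i w ↦ χ_i(w) w x_i`. -/
noncomputable def rot (Q : Matrix (Fin n) (Fin n) R) :
    (List (Fin n) →₀ R) →ₗ[R] (List (Fin n) →₀ R) :=
  Finsupp.linearCombination R fun w => match w with
    | [] => 0
    | i :: w => Finsupp.single (w ++ [i]) (chi Q i w)

/-- The braided rotation of the tail of a word, twisted by the monodromy with the first letter. -/
noncomputable def rotTail (Q : Matrix (Fin n) (Fin n) R) :
    (List (Fin n) →₀ R) →ₗ[R] (List (Fin n) →₀ R) :=
  Finsupp.linearCombination R fun w => match w with
    | [] => 0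
    | [_] => 0
    | y :: i :: w => Finsupp.single (y :: (w ++ [i])) (chi Q i w * (Q i y * Q y i))

theorem single_eq_smul (w : List (Fin n)) (c : R) :
    Finsupp.single w c = c • Finsupp.single w (1 : R) := by simp

theorem der_single (Q : Matrix (Fin n) (Fin n) R) (w : List (Fin n)) (c : R) :
    der Q (Finsupp.single w c) = c • derWord Q w := by simp [der]

@[simp] theorem der_nil (Q : Matrix (Fin n) (Fin n) R) (c : R) :
    der Q (Finsupp.single [] c) = 0 := by simp [der_single, derWord]

theorem der_cons (Q : Matrix (Fin n) (Fin n) R) (i : Fin n) (w : List (Fin n)) (c : R) :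
    der Q (Finsupp.single (i :: w) c) = insertSecond R i (der Q (Finsupp.single w c)) +
      Finsupp.single (i :: w) (c * chi Q i w) := by
  rw [der_single, der_single, derWord, smul_add, map_smul, Finsupp.smul_single, smul_eq_mul]

@[simp] theorem derTail_nil (Q : Matrix (Fin n) (Fin n) R) (c : R) :
    derTail Q (Finsupp.single [] c) = 0 := by simp [derTail]

theorem derTail_cons (Q : Matrix (Fin n) (Fin n) R) (i : Fin n) (w : List (Fin n)) (c : R) :
    derTail Q (Finsupp.single (i :: w) c) = insertSecond R i (der Q (Finsupp.single w c)) := by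
  simp [derTail, der_single]

@[simp] theorem rot_nil (Q : Matrix (Fin n) (Fin n) R) (c : R) :
    rot Q (Finsupp.single [] c) = 0 := by simp [rot]

theorem rot_cons (Q : Matrix (Fin n) (Fin n) R) (i : Fin n) (w : List (Fin n)) (c : R) :
    rot Q (Finsupp.single (i :: w) c) = Finsupp.single (w ++ [i]) (c * chi Q i w) := by
  simp [rot]

@[simp] theorem rotTail_nil (Q : Matrix (Fin n) (Fin n) R) (c : R) :
    rotTail Q (Finsupp.single [] c) = 0 := by simp [rotTail]

@[simp] theorem rotTail_singleton (Q : Matrix (Fin n) (Fin n) R) (y : Fin n) (c : R) :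
    rotTail Q (Finsupp.single [y] c) = 0 := by simp [rotTail]

theorem rotTail_cons (Q : Matrix (Fin n) (Fin n) R) (y i : Fin n) (w : List (Fin n)) (c : R) :
    rotTail Q (Finsupp.single (y :: i :: w) c) =
      Finsupp.single (y :: (w ++ [i])) (c * (chi Q i w * (Q i y * Q y i))) := by
  simp only [rotTail, Finsupp.linearCombination_single, Finsupp.smul_single, smul_eq_mul]

/-- Linear maps which agree on the words in `s` agree on the combinations of words in `s`. -/
theorem eqOn_supported {M : Type*} [AddCommGroup M] [Module R M]
    {F G : (List (Fin n) →₀ R) →ₗ[R] M} {s : Set (List (Fin n))}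
    (h : ∀ w ∈ s, F (Finsupp.single w 1) = G (Finsupp.single w 1)) {f : List (Fin n) →₀ R}
    (hf : f ∈ Finsupp.supported R R s) : F f = G f := by
  rw [Finsupp.supported_eq_span_single] at hf
  refine LinearMap.eqOn_span (R := R) ?_ hf
  rintro _ ⟨w, hw, rfl⟩
  exact h w hw

theorem mapsTo_supported {F : (List (Fin n) →₀ R) →ₗ[R] (List (Fin n) →₀ R)}
    {s t : Set (List (Fin n))}
    (h : ∀ w ∈ s, F (Finsupp.single w 1) ∈ Finsupp.supported R R t) {f : List (Fin n) →₀ R}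
    (hf : f ∈ Finsupp.supported R R s) : F f ∈ Finsupp.supported R R t := by
  rw [Finsupp.supported_eq_span_single] at hf
  have : Submodule.span R ((fun i => Finsupp.single i 1) '' s) ≤
      (Finsupp.supported R R t).comap F := by
    rw [Submodule.span_le]
    rintro _ ⟨w, hw, rfl⟩
    exact h w hw
  exact this hf

theorem linear_ext_word {M : Type*} [AddCommGroup M] [Module R M]
    {F G : (List (Fin n) →₀ R) →ₗ[R] M}
    (h : ∀ w, F (Finsupp.single w 1) = G (Finsupp.single w 1)) : F = G := by
  ext w
  simpa using h w

theorem insertSecond_mem_supported (i : Fin n) (w : List (Fin n)) {f : List (Fin n) →₀ R}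
    (hf : f ∈ Finsupp.supported R R {v | v.Perm w}) :
    insertSecond R i f ∈ Finsupp.supported R R {v | v.Perm (i :: w)} := by
  refine mapsTo_supported (fun v hv => ?_) hf
  match v, hv with
  | [], _ => simp
  | y :: v, hv =>
    rw [insertSecond_cons]
    refine Finsupp.single_mem_supported R _ ?_
    exact (List.Perm.swap i y v).trans (List.Perm.cons i hv)

theorem der_word_mem_supported (Q : Matrix (Fin n) (Fin n) R) (w : List (Fin n)) (c : R) :
    der Q (Finsupp.single w c) ∈ Finsupp.supported R R {v | v.Perm w} := by
  induction w with
  | nil => simp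
  | cons i w ih =>
    rw [der_cons]
    exact add_mem (insertSecond_mem_supported i w ih)
      (Finsupp.single_mem_supported R _ (List.Perm.refl _))

/-- The right Leibniz rule in coordinates. The operator `T` appends `x_i` to the first tensor
factor, which costs the braiding of `x_y` past `x_i`. -/
theorem der_append_singleton (Q : Matrix (Fin n) (Fin n) R) (i : Fin n) :
    ∃ T : (List (Fin n) →₀ R) →ₗ[R] (List (Fin n) →₀ R),
      (∀ c, T (Finsupp.single [] c) = 0) ∧
      (∀ y v c, T (Finsupp.single (y :: v) c) = Finsupp.single (y :: (v ++ [i])) (c * Q y i)) ∧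
      ∀ u, der Q (Finsupp.single (u ++ [i]) 1) =
        Finsupp.single (i :: u) 1 + T (der Q (Finsupp.single u 1)) := by
  let T : (List (Fin n) →₀ R) →ₗ[R] (List (Fin n) →₀ R) :=
    Finsupp.linearCombination R fun w => match w with
      | [] => 0
      | y :: v => Finsupp.single (y :: (v ++ [i])) (Q y i)
  have h0 : ∀ c, T (Finsupp.single [] c) = 0 := by intro c; simp [T]
  have h1 : ∀ y v c,
      T (Finsupp.single (y :: v) c) = Finsupp.single (y :: (v ++ [i])) (c * Q y i) := by
    intro y v c
    simp [T]
  refine ⟨T, h0, h1, fun u => ?_⟩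
  induction u with
  | nil => simp [der_cons]
  | cons j u ih =>
    have comm : insertSecond R j ∘ₗ T = T ∘ₗ insertSecond R j := by
      refine linear_ext_word fun w => ?_
      match w with
      | [] => simp [h0]
      | y :: v => simp [h1]
    have comm' := LinearMap.congr_fun comm (der Q (Finsupp.single u 1))
    simp only [LinearMap.comp_apply] at comm'
    rw [List.cons_append, der_cons, ih, map_add, der_cons, map_add, comm', insertSecond_cons, h1]
    simp [add_assoc]

/-- The key identity `Δ_{m-1,1} (1 - γ) = (1 - γ') (id ⊗ Δ_{m-2,1})`. -/
theorem der_one_sub_rot (Q : Matrix (Fin n) (Fin n) R) (f : List (Fin n) →₀ R) :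
    der Q (f - rot Q f) = derTail Q f - rotTail Q (derTail Q f) := by
  have : der Q ∘ₗ (LinearMap.id - rot Q) = (LinearMap.id - rotTail Q) ∘ₗ derTail Q := by
    refine linear_ext_word fun w => ?_
    match w with
    | [] => simp
    | i :: u =>
      obtain ⟨T, h0, h1, hT⟩ := der_append_singleton Q i
      -- All words `y v` in the derivative of `u` are rearrangements of `u`, so `χ_i(u) = q_{iy}
      -- χ_i(v)`. With the factor `q_{yi}` from `T` this is exactly the monodromy built into
      -- `rotTail`; the remaining terms `χ_i(u) i u` cancel.
      have key : rotTail Q (insertSecond R i (der Q (Finsupp.single u 1))) =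
          chi Q i u • T (der Q (Finsupp.single u 1)) := by
        have := eqOn_supported (F := rotTail Q ∘ₗ insertSecond R i) (G := chi Q i u • T)
          (s := {v | v.Perm u}) ?_ (der_word_mem_supported Q u 1)
        · simpa using this
        · intro v hv
          match v, hv with
          | [], _ => simp [h0]
          | y :: v, hv =>
            rw [LinearMap.comp_apply, insertSecond_cons, rotTail_cons, LinearMap.smul_apply, h1,
              Finsupp.smul_single, ← chi_perm Q i hv, chi_cons, smul_eq_mul]
            congr 1
            ring
      simp only [LinearMap.comp_apply, LinearMap.sub_apply, LinearMap.id_apply, map_sub]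
      rw [derTail_cons, key, rot_cons, der_cons, single_eq_smul (u ++ [i]), map_smul, hT, smul_add,
        one_mul, ← single_eq_smul]
      abel
  simpa using LinearMap.congr_fun this f

/-- The product of `q_{ab}` over all pairs of different positions of a word. -/
def monodromy (Q : Matrix (Fin n) (Fin n) R) : List (Fin n) → R
  | [] => 1
  | i :: w => chi Q i w * chiOp Q i w * monodromy Q w

/-- The scalar of the braiding of two words. -/
def cross (Q : Matrix (Fin n) (Fin n) R) (u v : List (Fin n)) : R :=
  (u.map fun a => chi Q a v).prod

theorem cross_nil_right (Q : Matrix (Fin n) (Fin n) R) (u : List (Fin n)) :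
    cross Q u [] = 1 := by
  simp [cross]

theorem cross_append_singleton (Q : Matrix (Fin n) (Fin n) R) (u v : List (Fin n)) (i : Fin n) :
    cross Q u (v ++ [i]) = cross Q u v * chiOp Q i u := by
  simp [cross, chiOp, List.prod_map_mul]

theorem cross_cons (Q : Matrix (Fin n) (Fin n) R) (i : Fin n) (u v : List (Fin n)) :
    cross Q (i :: u) v = chi Q i v * cross Q u v := by
  simp [cross]

/-- Generalised to a suffix `v` so that the induction moves one letter of `u` at a time behind `v`.
Only the case of empty `v` is used afterwards. -/
theorem rot_pow_append (Q : Matrix (Fin n) (Fin n) R) (u v : List (Fin n)) (c : R) :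
    (rot Q ^ u.length) (Finsupp.single (u ++ v) c) =
      Finsupp.single (v ++ u) (c * (monodromy Q u * cross Q u v)) := by
  induction u generalizing v c with
  | nil => simp [monodromy, cross]
  | cons i u ih =>
    rw [List.length_cons, pow_succ, Module.End.mul_apply, List.cons_append, rot_cons,
      List.append_assoc, ih, chi_append, cross_append_singleton, cross_cons, monodromy,
      List.append_assoc, List.singleton_append]
    congr 1
    ring

theorem rot_pow_length (Q : Matrix (Fin n) (Fin n) R) (w : List (Fin n)) (c : R) :
    (rot Q ^ w.length) (Finsupp.single w c) = Finsupp.single w (c * monodromy Q w) := by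
  simpa [cross_nil_right] using rot_pow_append Q w [] c

/-- The extra factor collects the monodromy of `y` with the letters of `u`. It completes the
monodromy of `u` to that of `y u`, which explains why `rotTail` after one turn fewer gives the same
scalar as `rot`. -/
theorem rotTail_pow_append (Q : Matrix (Fin n) (Fin n) R) (y : Fin n) (u v : List (Fin n))
    (c : R) :
    (rotTail Q ^ u.length) (Finsupp.single (y :: (u ++ v)) c) = Finsupp.single (y :: (v ++ u))
      (c * (monodromy Q u * cross Q u v * (chiOp Q y u * chi Q y u))) := by
  induction u generalizing v c with
  | nil => simp [monodromy, cross]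
  | cons i u ih =>
    rw [List.length_cons, pow_succ, Module.End.mul_apply, List.cons_append, rotTail_cons,
      List.append_assoc, ih, chi_append, cross_append_singleton, cross_cons, monodromy,
      List.append_assoc, List.singleton_append, chiOp_cons, chi_cons]
    congr 1
    ring

theorem rotTail_pow_length (Q : Matrix (Fin n) (Fin n) R) (y : Fin n) (w : List (Fin n))
    (c : R) : (rotTail Q ^ w.length) (Finsupp.single (y :: w) c) =
      Finsupp.single (y :: w) (c * monodromy Q (y :: w)) := by
  have := rotTail_pow_append Q y w [] c
  rw [List.append_nil, List.nil_append, cross_nil_right] at this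
  rw [this, monodromy]
  congr 1
  ring

/-- The words with a given number of occurrences of each letter. -/
def wordsOf (m : Fin n → ℕ) : Set (List (Fin n)) := {w | ∀ i, w.count i = m i}

theorem mem_wordsOf {m : Fin n → ℕ} {w : List (Fin n)} : w ∈ wordsOf m ↔ ∀ i, w.count i = m i :=
  Iff.rfl

theorem length_of_mem_wordsOf {m : Fin n → ℕ} {w : List (Fin n)} (hw : w ∈ wordsOf m) :
    w.length = totalDegree m := by
  rw [totalDegree, ← Finset.sum_congr rfl fun i _ => hw i]
  simpa using (Multiset.sum_count_eq_card (s := Finset.univ) (m := (w : Multiset (Fin n)))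
    fun a _ => Finset.mem_univ a).symm

theorem mem_wordsOf_of_perm {m : Fin n → ℕ} {w w' : List (Fin n)} (h : w.Perm w')
    (hw : w ∈ wordsOf m) : w' ∈ wordsOf m := fun i => by
  rw [← h.count_eq, hw i]

theorem mem_supported_of_perm {m : Fin n → ℕ} {w : List (Fin n)} (hw : w ∈ wordsOf m)
    {f : List (Fin n) →₀ R} (hf : f ∈ Finsupp.supported R R {v | v.Perm w}) :
    f ∈ Finsupp.supported R R (wordsOf m) :=
  Finsupp.supported_mono (fun _ hv => mem_wordsOf_of_perm (List.Perm.symm hv) hw) hf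

variable (R) in
/-- The component of degree `m` of the space of combinations of words. -/
noncomputable abbrev component (m : Fin n → ℕ) : Submodule R (List (Fin n) →₀ R) :=
  Finsupp.supported R R (wordsOf m)

theorem der_mem_component (Q : Matrix (Fin n) (Fin n) R) {m : Fin n → ℕ}
    {f : List (Fin n) →₀ R} (hf : f ∈ component R m) : der Q f ∈ component R m :=
  mapsTo_supported (fun w hw => mem_supported_of_perm hw (der_word_mem_supported Q w 1)) hf

theorem derTail_mem_component (Q : Matrix (Fin n) (Fin n) R) {m : Fin n → ℕ}
    {f : List (Fin n) →₀ R} (hf : f ∈ component R m) : derTail Q f ∈ component R m := by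
  refine mapsTo_supported (fun w hw => ?_) hf
  match w, hw with
  | [], _ => simp
  | i :: w, hw =>
    rw [derTail_cons]
    exact mem_supported_of_perm hw
      (insertSecond_mem_supported i w (der_word_mem_supported Q w 1))

theorem rot_mem_component (Q : Matrix (Fin n) (Fin n) R) {m : Fin n → ℕ}
    {f : List (Fin n) →₀ R} (hf : f ∈ component R m) : rot Q f ∈ component R m := by
  refine mapsTo_supported (fun w hw => ?_) hf
  match w, hw with
  | [], _ => simp
  | i :: w, hw =>
    rw [rot_cons]
    exact Finsupp.single_mem_supported R _
      (mem_wordsOf_of_perm (List.perm_append_singleton i w).symm hw)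

theorem rotTail_mem_component (Q : Matrix (Fin n) (Fin n) R) {m : Fin n → ℕ}
    {f : List (Fin n) →₀ R} (hf : f ∈ component R m) : rotTail Q f ∈ component R m := by
  refine mapsTo_supported (fun w hw => ?_) hf
  match w, hw with
  | [], _ => simp
  | [y], _ => simp
  | y :: i :: w, hw =>
    rw [rotTail_cons]
    exact Finsupp.single_mem_supported R _
      (mem_wordsOf_of_perm ((List.perm_append_singleton i w).symm.cons y) hw)

/-- `Δ_{m-1,1}` is injective in degree `m`. -/
def InjectiveAt (Q : Matrix (Fin n) (Fin n) R) (m : Fin n → ℕ) : Prop :=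
  ∀ f ∈ component R m, der Q f = 0 → f = 0

/-- Removal of the first letter, if it is `i`. -/
noncomputable def uncons (R : Type*) [CommRing R] (i : Fin n) :
    (List (Fin n) →₀ R) →ₗ[R] (List (Fin n) →₀ R) :=
  Finsupp.lcomapDomain (i :: ·) (List.cons_injective)

theorem uncons_apply (i : Fin n) (f : List (Fin n) →₀ R) (w : List (Fin n)) :
    uncons R i f w = f (i :: w) := rfl

@[simp] theorem uncons_nil (i : Fin n) (c : R) : uncons R i (Finsupp.single [] c) = 0 := by
  ext w
  simp [uncons_apply]

theorem uncons_cons (i j : Fin n) (w : List (Fin n)) (c : R) :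
    uncons R i (Finsupp.single (j :: w) c) = if j = i then Finsupp.single w c else 0 := by
  classical
  ext v
  rw [uncons_apply]
  split_ifs with h
  · subst h
    simp [Finsupp.single_apply]
  · simp [h]

theorem insertSecond_apply (i y : Fin n) (v : List (Fin n)) (f : List (Fin n) →₀ R) :
    insertSecond R i f (y :: i :: v) = f (y :: v) := by
  have : Finsupp.lapply (y :: i :: v) ∘ₗ insertSecond R i = Finsupp.lapply (y :: v) := by
    refine linear_ext_word fun w => ?_
    match w with
    | [] => simp
    | z :: u => simp [Finsupp.single_apply]
  exact LinearMap.congr_fun this f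

theorem insertSecond_apply_ne {i l : Fin n} (h : i ≠ l) (y : Fin n) (v : List (Fin n))
    (f : List (Fin n) →₀ R) : insertSecond R i f (y :: l :: v) = 0 := by
  have : Finsupp.lapply (y :: l :: v) ∘ₗ insertSecond R i = 0 := by
    refine linear_ext_word fun w => ?_
    match w with
    | [] => simp
    | z :: u => simp [h]
  exact LinearMap.congr_fun this f

theorem derTail_apply (Q : Matrix (Fin n) (Fin n) R) (y i : Fin n) (v : List (Fin n))
    (f : List (Fin n) →₀ R) : derTail Q f (y :: i :: v) = der Q (uncons R i f) (y :: v) := by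
  have : Finsupp.lapply (y :: i :: v) ∘ₗ derTail Q =
      Finsupp.lapply (y :: v) ∘ₗ der Q ∘ₗ uncons R i := by
    refine linear_ext_word fun w => ?_
    match w with
    | [] => simp
    | l :: w =>
      simp only [LinearMap.comp_apply, derTail_cons, uncons_cons, Finsupp.lapply_apply]
      split_ifs with h
      · subst h
        rw [insertSecond_apply]
      · rw [insertSecond_apply_ne h, map_zero, Finsupp.zero_apply]
  exact LinearMap.congr_fun this f

theorem der_apply_nil (Q : Matrix (Fin n) (Fin n) R) (f : List (Fin n) →₀ R) :
    der Q f [] = 0 := by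
  have : Finsupp.lapply [] ∘ₗ der Q = 0 := by
    refine linear_ext_word fun w => ?_
    by_contra h
    have hmem := der_word_mem_supported Q w (1 : R)
    rw [Finsupp.mem_supported] at hmem
    have h' : ([] : List (Fin n)) ∈ (der Q (Finsupp.single w (1 : R))).support := by
      simpa using h
    have := hmem h'
    rw [Set.mem_ofPred_eq, List.nil_perm] at this
    subst this
    simp at h
  exact LinearMap.congr_fun this f

/-- Sorting words by their first letter `i` splits `derTail` in degree `m` into copies of `der` in
the degrees `m - e_i`. -/
theorem derTail_injective (Q : Matrix (Fin n) (Fin n) R) {m : Fin n → ℕ}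
    (h : ∀ m', totalDegree m' + 1 = totalDegree m → InjectiveAt Q m') (hm : 0 < totalDegree m)
    {f : List (Fin n) →₀ R} (hf : f ∈ component R m) (h0 : derTail Q f = 0) : f = 0 := by
  have hu : ∀ i, uncons R i f = 0 := by
    intro i
    have hd : der Q (uncons R i f) = 0 := by
      ext w
      match w with
      | [] => rw [der_apply_nil]; rfl
      | y :: v => rw [← derTail_apply, h0]; rfl
    by_cases hi : m i = 0
    · ext w
      rw [uncons_apply, Finsupp.zero_apply]
      by_contra hne
      have := (Finsupp.mem_supported R f).1 hf (Finsupp.mem_support_iff.2 hne) i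
      rw [hi] at this
      simp at this
    · have hm' : m = (m - Pi.single i 1) + Pi.single i 1 := by
        ext j
        by_cases hj : j = i
        · subst hj
          simp
          omega
        · simp [hj]
      refine h (m - Pi.single i 1) ?_ _ ?_ hd
      · conv_rhs => rw [hm']
        simp [totalDegree, Finset.sum_add_distrib]
      · rw [Finsupp.mem_supported]
        intro w hw j
        have hw' : uncons R i f w ≠ 0 := Finsupp.mem_support_iff.1 hw
        rw [uncons_apply] at hw'
        have := (Finsupp.mem_supported R f).1 hf (Finsupp.mem_support_iff.2 hw') j
        rw [List.count_cons] at this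
        by_cases hj : i = j
        · subst hj
          simp at this ⊢
          omega
        · simp [hj, Ne.symm hj] at this ⊢
          exact this
  ext w
  match w with
  | [] =>
    by_contra hne
    have := length_of_mem_wordsOf
      ((Finsupp.mem_supported R f).1 hf (Finsupp.mem_support_iff.2 hne))
    simp at this
    omega
  | i :: w => rw [← uncons_apply, hu]; rfl

end Words

/-! ### Passage from `T(V)` to coordinates on words -/

section Coordinates

variable {k : Type*} [Field k] {n : ℕ} {V : Type*} [AddCommGroup V] [Module k V]
  (x : Module.Basis (Fin n) k V) (Q : Matrix (Fin n) (Fin n) k)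

theorem scaling_word (i : Fin n) (w : List (Fin n)) :
    scaling x Q i (word x w) = chi Q i w • word x w := by
  induction w with
  | nil => simp
  | cons l w ih => simp [word_cons, scaling_ι, ih, smul_smul, mul_comm]

theorem uncons_insertSecond (i j : Fin n) (f : List (Fin n) →₀ k) :
    uncons k j (insertSecond k i f) = Finsupp.lmapDomain k k (i :: ·) (uncons k j f) := by
  have : uncons k j ∘ₗ insertSecond k i = Finsupp.lmapDomain k k (i :: ·) ∘ₗ uncons k j := by
    refine linear_ext_word fun w => ?_
    match w with
    | [] => simp
    | y :: v =>
      simp only [LinearMap.comp_apply, insertSecond_cons, uncons_cons]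
      split_ifs <;> simp
  exact LinearMap.congr_fun this f

/-- In the encoding of `v ⊗ x_y` as `y v`, the coefficient of `x_j` in the last tensor factor is
read off by removing a first letter `j`. -/
theorem skewDer_repr_symm (j : Fin n) (f : List (Fin n) →₀ k) :
    skewDer x Q j ((wordBasis x).repr.symm f) =
      (wordBasis x).repr.symm (uncons k j (der Q f)) := by
  have hs : ∀ w c, (wordBasis x).repr.symm (Finsupp.single w c) = c • word x w := by
    intro w c
    rw [Module.Basis.repr_symm_single, wordBasis_apply]
  have hc : ∀ i f, (wordBasis x).repr.symm (Finsupp.lmapDomain k k (i :: ·) f) =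
      TensorAlgebra.ι k (x i) * (wordBasis x).repr.symm f := by
    intro i f
    have : (wordBasis x).repr.symm.toLinearMap ∘ₗ Finsupp.lmapDomain k k (i :: ·) =
        LinearMap.mulLeft k (TensorAlgebra.ι k (x i)) ∘ₗ (wordBasis x).repr.symm.toLinearMap := by
      refine linear_ext_word fun w => ?_
      simp only [LinearMap.comp_apply, LinearEquiv.coe_coe, Finsupp.lmapDomain_apply,
        Finsupp.mapDomain_single, LinearMap.mulLeft_apply, hs, one_smul, word_cons]
    exact LinearMap.congr_fun this f
  have : skewDer x Q j ∘ₗ (wordBasis x).repr.symm.toLinearMap =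
      (wordBasis x).repr.symm.toLinearMap ∘ₗ uncons k j ∘ₗ der Q := by
    refine linear_ext_word fun w => ?_
    simp only [LinearMap.comp_apply, LinearEquiv.coe_coe]
    induction w with
    | nil => simp [hs]
    | cons i w ih =>
      rw [hs, one_smul] at ih
      rw [hs, one_smul, word_cons, skewDer_mul, ih, der_cons, map_add, map_add,
        uncons_insertSecond, hc, uncons_cons]
      split_ifs with h
      · simp [hs, scaling_word]
      · simp
  exact LinearMap.congr_fun this f

theorem der_filter (p : List (Fin n) → Prop) [DecidablePred p]
    (hp : ∀ w w', w.Perm w' → (p w ↔ p w')) (f : List (Fin n) →₀ k) :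
    der Q (f.filter p) = (der Q f).filter p := by
  induction f using Finsupp.induction_linear with
  | zero => rw [map_zero, Finsupp.filter_zero, map_zero]
  | add f g hf hg => rw [Finsupp.filter_add, map_add, hf, hg, map_add, Finsupp.filter_add]
  | single w c =>
    have hmem := (Finsupp.mem_supported k _).1 (der_word_mem_supported Q w c)
    by_cases hw : p w
    · rw [Finsupp.filter_single_of_pos _ hw, eq_comm, Finsupp.filter_eq_self_iff]
      intro v hv
      exact (hp v w (hmem (Finsupp.mem_support_iff.2 hv))).2 hw
    · rw [Finsupp.filter_single_of_neg _ hw, map_zero, eq_comm, Finsupp.filter_eq_zero_iff]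
      intro v hv
      by_contra hne
      exact hw ((hp v w (hmem (Finsupp.mem_support_iff.2 hne))).1 hv)

/-- An element without constant term and with zero derivative lies in the radical. Conversely, the
derivatives of an element of the radical are again in the radical and shorter, so induction on the
length makes them vanish. -/
theorem radical_eq_bot_iff : radical x Q = ⊥ ↔
    ∀ f : List (Fin n) →₀ k, f [] = 0 → der Q f = 0 → f = 0 := by
  have h0 : ∀ f : List (Fin n) →₀ k, wordCoeff x [] ((wordBasis x).repr.symm f) = f [] := by
    intro f
    simp [wordCoeff]
  constructor
  · intro h f hf hd
    have : (wordBasis x).repr.symm f ∈ radical x Q := by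
      rw [mem_radical]
      intro w
      match w with
      | [] => rw [pairing, h0, hf]
      | j :: w => rw [pairing, LinearMap.comp_apply, skewDer_repr_symm, hd]; simp
    rw [h, Submodule.mem_bot] at this
    exact (LinearEquiv.map_eq_zero_iff _).1 this
  · intro h
    have key : ∀ N : ℕ, ∀ f : List (Fin n) →₀ k,
        f ∈ Finsupp.supported k k {w | w.length ≤ N} →
        (wordBasis x).repr.symm f ∈ radical x Q → f = 0 := by
      intro N
      induction N with
      | zero =>
        intro f hf hr
        ext w
        match w with
        | [] => rw [← h0]; exact (mem_radical x Q).1 hr []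
        | i :: w =>
          by_contra hne
          have := (Finsupp.mem_supported k f).1 hf (Finsupp.mem_support_iff.2 hne)
          simp at this
      | succ N ih =>
        intro f hf hr
        refine h f ?_ ?_
        · rw [← h0]; exact (mem_radical x Q).1 hr []
        · have hd : der Q f ∈ Finsupp.supported k k {w | w.length ≤ N + 1} := by
            refine mapsTo_supported (fun w hw => ?_) hf
            refine Finsupp.supported_mono (fun v hv => ?_) (der_word_mem_supported Q w 1)
            have := List.Perm.length_eq hv
            simp only [Set.mem_ofPred_eq] at hw ⊢
            omega
          ext w
          match w with
          | [] => rw [der_apply_nil]; rfl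
          | j :: w =>
            rw [← uncons_apply, ih (uncons k j (der Q f)) ?_ ?_]
            · rfl
            · rw [Finsupp.mem_supported]
              intro v hv
              have hv' : uncons k j (der Q f) v ≠ 0 := Finsupp.mem_support_iff.1 hv
              rw [uncons_apply] at hv'
              have := (Finsupp.mem_supported k _).1 hd (Finsupp.mem_support_iff.2 hv')
              simpa using this
            · rw [← skewDer_repr_symm]
              exact skewDer_mem_radical x Q hr j
    rw [Submodule.eq_bot_iff]
    intro u hu
    have := key (((wordBasis x).repr u).support.sup List.length) ((wordBasis x).repr u) ?_ ?_
    · simpa using this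
    · rw [Finsupp.mem_supported]
      intro w hw
      exact Finset.le_sup (f := List.length) hw
    · simpa using hu

/-- `B(V) = T(V)` if and only if `Δ_{m-1,1}` is injective in all nonzero degrees. -/
theorem nicholsIsFree_iff_injectiveAt :
    NicholsIsFree x Q ↔ ∀ m : Fin n → ℕ, 0 < totalDegree m → InjectiveAt Q m := by
  classical
  rw [nicholsIsFree_iff_radical, radical_eq_bot_iff]
  constructor
  · intro h m hm f hf hd
    refine h f ?_ hd
    by_contra hne
    have := length_of_mem_wordsOf
      ((Finsupp.mem_supported k f).1 hf (Finsupp.mem_support_iff.2 hne))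
    simp at this
    omega
  · intro h f h0 hd
    ext w
    by_cases hw : w = []
    · subst hw
      exact h0
    · let m : Fin n → ℕ := fun i => w.count i
      have hwm : w ∈ wordsOf m := fun i => rfl
      have hlen := length_of_mem_wordsOf hwm
      have hpos : 0 < totalDegree m := by
        rw [← hlen]
        exact List.length_pos_iff.2 hw
      -- Because `der` only rearranges letters, the part of `f` in the multidegree of `w` is again
      -- in its kernel.
      have hz := h m hpos (f.filter (· ∈ wordsOf m)) ?_ ?_
      · have := DFunLike.congr_fun hz w
        rwa [Finsupp.filter_apply_pos _ _ hwm] at this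
      · rw [Finsupp.mem_supported]
        intro v hv
        rw [Finset.mem_coe, Finsupp.support_filter, Finset.mem_filter] at hv
        exact hv.2
      · rw [der_filter Q (· ∈ wordsOf m) (fun w w' hww => ⟨mem_wordsOf_of_perm hww,
          mem_wordsOf_of_perm hww.symm⟩), hd, Finsupp.filter_zero]

end Coordinates

/-! ### Burnside's lemma with scalars -/

section Orbits

open Finset

/-- Burnside's lemma for a permutation `σ` with `σ ^ N = 1`, in a form which counts the functions
`f` with `f (σ w) = q ^ κ w * f w`, where `κ` has sum zero over each orbit. -/
theorem finrank_twisted_invariants {k : Type*} [Field k] {q : k} (hq0 : q ≠ 0) {α : Type*}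
    [Fintype α] [DecidableEq α] (σ : Equiv.Perm α) {N : ℕ} (hN : 0 < N) (hσ : σ ^ N = 1)
    (κ : α → ℤ) (hκ : ∀ w, ∑ s ∈ range N, κ ((σ ^ s) w) = 0) (K : Submodule k (α → k))
    (hK : ∀ f, f ∈ K ↔ ∀ w, f (σ w) = q ^ κ w * f w) :
    N * Module.finrank k K = ∑ s ∈ range N, Fintype.card {w // (σ ^ s) w = w} := by
  classical
  obtain ⟨N, rfl⟩ := Nat.exists_eq_succ_of_ne_zero hN.ne'
  let act : MulAction (Multiplicative (ZMod (N + 1))) α :=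
    { smul := fun s w => (σ ^ (ZMod.val s.toAdd)) w
      one_smul := fun w => by
        change (σ ^ (ZMod.val (0 : ZMod (N + 1)))) w = w
        simp
      mul_smul := fun a b w => by
        change (σ ^ (ZMod.val (a.toAdd + b.toAdd))) w =
          (σ ^ (ZMod.val a.toAdd)) ((σ ^ (ZMod.val b.toAdd)) w)
        rw [ZMod.val_add, ← Equiv.Perm.mul_apply, ← pow_add, ← pow_eq_pow_mod _ hσ] }
  have smul_def : ∀ (s : Multiplicative (ZMod (N + 1))) (w : α),
      s • w = (σ ^ (ZMod.val s.toAdd)) w := fun _ _ => rfl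
  -- Summation by parts: since the total of `κ` around an orbit is zero, this weighted sum satisfies
  -- `F (σ w) = F w + (N + 1) κ w`.
  let F : α → ℤ := fun w => ∑ s ∈ range (N + 1), (s : ℤ) * κ ((σ ^ s) w)
  have hF : ∀ w, F (σ w) = F w + ((N + 1 : ℕ) : ℤ) * κ w := by
    intro w
    have h1 := sum_range_succ (fun s => (s : ℤ) * κ ((σ ^ s) w)) (N + 1)
    have h2 := sum_range_succ' (fun s => (s : ℤ) * κ ((σ ^ s) w)) (N + 1)
    have h3 := hκ (σ w)
    have h4 : ∀ s, κ ((σ ^ s) (σ w)) = κ ((σ ^ (s + 1)) w) := by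
      intro s
      rw [pow_succ, Equiv.Perm.mul_apply]
    simp only [h4] at h3
    simp only [F, h4]
    rw [h1] at h2
    rw [hσ] at h2
    simp only [Nat.cast_add, Nat.cast_one, add_mul, sum_add_distrib, one_mul, h3] at h2
    simp at h2 ⊢
    linarith
  -- The increments of `F` are multiples of `N + 1`, so integer division commutes with them. Thus
  -- `h` is a nowhere vanishing solution of the twisted equation, and division by `h` turns
  -- solutions into functions on orbits.
  let h : α → k := fun w => q ^ (F w / ((N + 1 : ℕ) : ℤ))
  have h0 : ∀ w, h w ≠ 0 := fun w => zpow_ne_zero _ hq0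
  have hh : ∀ w, h (σ w) = q ^ κ w * h w := by
    intro w
    simp only [h]
    rw [hF, Int.add_mul_ediv_left _ _ (by positivity), zpow_add₀ hq0, mul_comm]
  let Ω := Quotient (MulAction.orbitRel (Multiplicative (ZMod (N + 1))) α)
  have hmk : ∀ w, (Quotient.mk _ (σ w) : Ω) = Quotient.mk _ w := by
    intro w
    refine Quotient.sound ?_
    rw [← Quotient.eq_iff_equiv, Quotient.eq, MulAction.orbitRel_apply]
    refine ⟨Multiplicative.ofAdd ((1 : ℕ) : ZMod (N + 1)), ?_⟩
    change (σ ^ (ZMod.val ((1 : ℕ) : ZMod (N + 1)))) w = σ w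
    rw [ZMod.val_natCast, ← pow_eq_pow_mod _ hσ, pow_one]
  let Φ : (Ω → k) →ₗ[k] K :=
    { toFun := fun g => ⟨fun w => h w * g (Quotient.mk _ w), by
        rw [hK]
        intro w
        rw [hmk, hh, mul_assoc]⟩
      map_add' := fun a b => by
        ext w
        simp [mul_add]
      map_smul' := fun c a => by
        ext w
        simp [mul_left_comm] }
  have hΦ : Function.Bijective Φ := by
    constructor
    · intro a b hab
      ext c
      induction c using Quotient.inductionOn with
      | h w =>
        have := congrFun (congrArg Subtype.val hab) w
        exact mul_left_cancel₀ (h0 w) this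
    · rintro ⟨f, hf⟩
      rw [hK] at hf
      have step : ∀ (s : ℕ) w, f ((σ ^ s) w) / h ((σ ^ s) w) = f w / h w := by
        intro s w
        induction s with
        | zero => simp
        | succ s ih =>
          rw [pow_succ', Equiv.Perm.mul_apply, hf, hh,
            mul_div_mul_left _ _ (zpow_ne_zero _ hq0), ih]
      refine ⟨Quotient.lift (fun w => f w / h w) ?_, ?_⟩
      · intro a b hab
        have hab' : (MulAction.orbitRel (Multiplicative (ZMod (N + 1))) α) a b := hab
        rw [MulAction.orbitRel_apply] at hab'
        obtain ⟨s, rfl⟩ := hab'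
        exact step _ b
      · ext w
        exact mul_div_cancel₀ _ (h0 w)
  rw [← (LinearEquiv.ofBijective Φ hΦ).finrank_eq, Module.finrank_fintype_fun_eq_card, mul_comm]
  have burnside := MulAction.sum_card_fixedBy_eq_card_orbits_mul_card_group
    (Multiplicative (ZMod (N + 1))) α
  rw [Fintype.card_multiplicative, ZMod.card] at burnside
  rw [← burnside, Finset.sum_range]
  refine Fintype.sum_equiv (Multiplicative.toAdd) _ _ fun s => ?_
  refine Fintype.card_congr (Equiv.refl _)

end Orbits

/-! ### Dimensions of the fixed spaces of the two rotations -/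

section FixedSpace

open Finset

theorem wordsOf_finite {n : ℕ} (m : Fin n → ℕ) : (wordsOf m).Finite := by
  refine (List.finite_length_eq (Fin n) (totalDegree m)).subset fun w hw => ?_
  exact length_of_mem_wordsOf hw

instance {n : ℕ} (m : Fin n → ℕ) : Finite (wordsOf m) := wordsOf_finite m

instance {k : Type*} [Field k] {n : ℕ} (m : Fin n → ℕ) : FiniteDimensional k (component k m) :=
  Module.Finite.equiv (Finsupp.supportedEquivFinsupp (R := k) (M := k) (wordsOf m)).symm

variable {k : Type*} [Field k] {q : k} {n : ℕ}

theorem zpow_eq_one_iff_of_not_root (hq : ∀ N : ℕ, 0 < N → q ^ N ≠ 1) (a : ℤ) :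
    q ^ a = 1 ↔ a = 0 := by
  refine ⟨fun h => ?_, fun h => by simp [h]⟩
  by_contra hne
  refine hq a.natAbs (Int.natAbs_pos.2 hne) ?_
  rcases Int.natAbs_eq a with e | e
  · rw [e, zpow_natCast] at h
    exact h
  · rw [e, zpow_neg, zpow_natCast, inv_eq_one] at h
    exact h

/-- The dimension of the fixed space of an operator which permutes words up to scalars, if its
`N`-th power is the identity. -/
theorem finrank_fixed (hq0 : q ≠ 0) (hq : ∀ N : ℕ, 0 < N → q ^ N ≠ 1) (m : Fin n → ℕ) {N : ℕ}
    (hN : 0 < N) (ρ : ℕ → List (Fin n) → List (Fin n))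
    (hρm : ∀ s, ∀ w ∈ wordsOf m, ρ s w ∈ wordsOf m) (hρ0 : ∀ w ∈ wordsOf m, ρ 0 w = w)
    (hρadd : ∀ s t w, ρ s (ρ t w) = ρ (t + s) w) (hρN : ∀ w ∈ wordsOf m, ρ N w = w)
    (F : (List (Fin n) →₀ k) →ₗ[k] (List (Fin n) →₀ k)) (c : List (Fin n) → ℤ)
    (hF : ∀ w ∈ wordsOf m, F (Finsupp.single w 1) = Finsupp.single (ρ 1 w) (q ^ c w))
    (hFN : ∀ w ∈ wordsOf m, (F ^ N) (Finsupp.single w 1) = Finsupp.single w 1) :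
    N * Module.finrank k ↥(component k m ⊓ LinearMap.ker (LinearMap.id - F)) =
      ∑ s ∈ range N, {w ∈ wordsOf m | ρ s w = w}.ncard := by
  classical
  have : Fintype (wordsOf m) := Fintype.ofFinite _
  let r : ℕ → wordsOf m → wordsOf m := fun s w => ⟨ρ s w, hρm s w w.2⟩
  have radd : ∀ s t w, r s (r t w) = r (t + s) w := fun s t w => Subtype.ext (hρadd s t w)
  have rN : ∀ w, r N w = w := fun w => Subtype.ext (hρN w w.2)
  let σ : Equiv.Perm (wordsOf m) :=
    { toFun := r 1
      invFun := r (N - 1)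
      left_inv := fun w => by rw [radd, Nat.add_sub_cancel' hN, rN]
      right_inv := fun w => by rw [radd, Nat.sub_add_cancel hN, rN] }
  have hσ : ∀ s w, (σ ^ s) w = r s w := by
    intro s
    induction s with
    | zero => exact fun w => Subtype.ext (hρ0 w w.2).symm
    | succ s ih =>
      intro w
      rw [pow_succ', Equiv.Perm.mul_apply, ih]
      exact radd 1 s w
  have hσN : σ ^ N = 1 := by
    ext1 w
    rw [hσ, rN]
    rfl
  have hpow : ∀ s, ∀ w ∈ wordsOf m, (F ^ s) (Finsupp.single w 1) =
      Finsupp.single (ρ s w) (q ^ ∑ t ∈ range s, c (ρ t w)) := by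
    intro s w hw
    induction s with
    | zero => simp [hρ0 w hw]
    | succ s ih =>
      rw [pow_succ', Module.End.mul_apply, ih, single_eq_smul, map_smul, hF _ (hρm s w hw), hρadd,
        Finsupp.smul_single, smul_eq_mul, sum_range_succ, zpow_add₀ hq0]
  let κ : wordsOf m → ℤ := fun w => c w
  -- The scalar accumulated over `N` steps is 1 because `F ^ N` is the identity. As `q` is not a
  -- root of unity, its exponent is zero.
  have hκ : ∀ w, ∑ s ∈ range N, κ ((σ ^ s) w) = 0 := by
    intro w
    have h1 := hpow N w w.2
    rw [hFN w w.2, hρN w w.2] at h1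
    have h2 := DFunLike.congr_fun h1 w.1
    rw [Finsupp.single_eq_same, Finsupp.single_eq_same, eq_comm,
      zpow_eq_one_iff_of_not_root hq] at h2
    rw [← h2]
    refine sum_congr rfl fun s _ => ?_
    rw [hσ]
  let e : component k m ≃ₗ[k] (wordsOf m → k) :=
    Finsupp.supportedEquivFinsupp (wordsOf m) ≪≫ₗ Finsupp.linearEquivFunOnFinite k k (wordsOf m)
  have he : ∀ (v : component k m) (w : wordsOf m), e v w = v.1 w.1 := fun v w => rfl
  let A := component k m ⊓ LinearMap.ker (LinearMap.id - F)
  let K : Submodule k (wordsOf m → k) := (A.submoduleOf (component k m)).map e.toLinearMap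
  have hval : ∀ v ∈ component k m, ∀ w ∈ wordsOf m, F v (ρ 1 w) = q ^ c w * v w := by
    intro v hv w hw
    have := eqOn_supported (F := Finsupp.lapply (ρ 1 w) ∘ₗ F) (G := q ^ c w • Finsupp.lapply w)
      (s := wordsOf m) ?_ hv
    · simpa using this
    · intro u hu
      rw [LinearMap.comp_apply, hF u hu, LinearMap.smul_apply, Finsupp.lapply_apply,
        Finsupp.lapply_apply, Finsupp.single_apply, Finsupp.single_apply]
      by_cases huw : u = w
      · subst huw
        simp
      · rw [if_neg huw, if_neg, smul_zero]
        intro e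
        have := σ.injective (a₁ := ⟨u, hu⟩) (a₂ := ⟨w, hw⟩) (Subtype.ext e)
        exact huw (congrArg Subtype.val this)
  have hmaps : ∀ v ∈ component k m, F v ∈ component k m := fun v hv =>
    mapsTo_supported (fun w hw => by
      rw [hF w hw]
      exact Finsupp.single_mem_supported k _ (hρm 1 w hw)) hv
  have hK : ∀ f, f ∈ K ↔ ∀ w, f (σ w) = q ^ κ w * f w := by
    intro f
    obtain ⟨v, rfl⟩ := e.surjective f
    have : e v ∈ K ↔ F v.1 = v.1 := by
      simp only [K, A, Submodule.mem_map, Submodule.submoduleOf, Submodule.mem_comap]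
      constructor
      · rintro ⟨y, hy, hyv⟩
        obtain rfl := e.injective hyv
        have h2 := LinearMap.mem_ker.1 hy.2
        rw [LinearMap.sub_apply, sub_eq_zero] at h2
        exact h2.symm
      · intro h
        refine ⟨v, ⟨v.2, LinearMap.mem_ker.2 ?_⟩, rfl⟩
        rw [LinearMap.sub_apply, sub_eq_zero]
        exact h.symm
    rw [this]
    constructor
    · intro h w
      rw [he, he]
      change v.1 (ρ 1 w.1) = q ^ c w.1 * v.1 w.1
      rw [← hval v.1 v.2 w.1 w.2, h]
    · intro h
      ext u
      by_cases hu : u ∈ wordsOf m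
      · obtain ⟨w, hw⟩ := σ.surjective ⟨u, hu⟩
        have hw' : ρ 1 w.1 = u := congrArg Subtype.val hw
        have := h w
        rw [he, he] at this
        change v.1 (ρ 1 w.1) = q ^ c w.1 * v.1 w.1 at this
        rw [← hval v.1 v.2 w.1 w.2, hw'] at this
        exact this.symm
      · rw [Finsupp.notMem_support_iff.1 fun h => hu ((Finsupp.mem_supported k _).1
          (hmaps v.1 v.2) h), Finsupp.notMem_support_iff.1 fun h => hu
          ((Finsupp.mem_supported k _).1 v.2 h)]
  have hrank : Module.finrank k A = Module.finrank k K := by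
    rw [LinearEquiv.finrank_map_eq e,
      (Submodule.submoduleOfEquivOfLe (inf_le_left : A ≤ component k m)).finrank_eq]
  rw [hrank, finrank_twisted_invariants hq0 σ hN hσN κ hκ K hK]
  refine sum_congr rfl fun s _ => ?_
  rw [← Nat.card_eq_fintype_card, ← Nat.card_coe_set_eq]
  refine Nat.card_congr ?_
  exact
    { toFun := fun w => ⟨w.1.1, w.1.2, by
        have := w.2
        rw [hσ] at this
        exact congrArg Subtype.val this⟩
      invFun := fun w => ⟨⟨w.1, w.2.1⟩, by
        rw [hσ]
        exact Subtype.ext w.2.2⟩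
      left_inv := fun _ => rfl
      right_inv := fun _ => rfl }

/-- Rotation of the tail of a word. -/
def tailRotate (s : ℕ) : List (Fin n) → List (Fin n)
  | [] => []
  | y :: v => y :: v.rotate s

theorem chi_powerMatrix (hq0 : q ≠ 0) (a : Matrix (Fin n) (Fin n) ℤ) (i : Fin n)
    (w : List (Fin n)) : chi (powerMatrix q a) i w = q ^ (w.map (a i)).sum := by
  induction w with
  | nil => simp
  | cons l w ih => rw [chi_cons, ih, List.map_cons, List.sum_cons, zpow_add₀ hq0]; rfl

theorem chiOp_powerMatrix (hq0 : q ≠ 0) (a : Matrix (Fin n) (Fin n) ℤ) (i : Fin n)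
    (w : List (Fin n)) :
    chiOp (powerMatrix q a) i w = q ^ (w.map fun l => a l i).sum := by
  induction w with
  | nil => simp
  | cons l w ih => rw [chiOp_cons, ih, List.map_cons, List.sum_cons, zpow_add₀ hq0]; rfl

theorem sum_map_eq_sum_count (b : Fin n → ℤ) (w : List (Fin n)) :
    (w.map b).sum = ∑ l, b l * (w.count l : ℤ) := by
  induction w with
  | nil => simp
  | cons l w ih =>
    rw [List.map_cons, List.sum_cons, ih]
    simp [List.count_cons, mul_add, sum_add_distrib, add_comm]

/-- Summing `a` over all ordered pairs of positions gives `K`; the pairs of equal positions, which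
the monodromy omits, contribute `λ`. -/
theorem monodromy_powerMatrix_count (hq0 : q ≠ 0) (a : Matrix (Fin n) (Fin n) ℤ)
    (w : List (Fin n)) : monodromy (powerMatrix q a) w =
      q ^ (quadForm a (fun i => w.count i) - linForm a (fun i => w.count i)) := by
  induction w with
  | nil => simp [monodromy, quadForm, linForm]
  | cons i w ih =>
    rw [monodromy, ih, chi_powerMatrix hq0, chiOp_powerMatrix hq0, ← zpow_add₀ hq0,
      ← zpow_add₀ hq0, sum_map_eq_sum_count, sum_map_eq_sum_count]
    congr 1
    have hc : ∀ l, (((i :: w).count l : ℕ) : ℤ) = w.count l + if i = l then 1 else 0 := by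
      intro l
      simp [List.count_cons]
    simp only [quadForm, linForm, hc, mul_add, add_mul, sum_add_distrib, mul_ite, ite_mul,
      mul_one, mul_zero, zero_mul, sum_ite_eq, mem_univ, if_true]
    simp
    ring

theorem monodromy_powerMatrix (hq0 : q ≠ 0) (a : Matrix (Fin n) (Fin n) ℤ) {m : Fin n → ℕ}
    {w : List (Fin n)} (hw : w ∈ wordsOf m) :
    monodromy (powerMatrix q a) w = q ^ (quadForm a m - linForm a m) := by
  rw [monodromy_powerMatrix_count hq0]
  have : (fun i => w.count i) = m := funext hw
  rw [this]

theorem finrank_rot (hq0 : q ≠ 0) (hq : ∀ N : ℕ, 0 < N → q ^ N ≠ 1)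
    (a : Matrix (Fin n) (Fin n) ℤ) (m : Fin n → ℕ) (hm : 0 < totalDegree m)
    (hKm : quadForm a m = linForm a m) :
    totalDegree m * Module.finrank k
      ↥(component k m ⊓ LinearMap.ker (LinearMap.id - rot (powerMatrix q a))) =
      ∑ s ∈ range (totalDegree m), {w ∈ wordsOf m | w.rotate s = w}.ncard := by
  refine finrank_fixed hq0 hq m hm (fun s w => w.rotate s)
    (fun s w hw => mem_wordsOf_of_perm (List.rotate_perm w s).symm hw)
    (fun w _ => List.rotate_zero w) (fun s t w => List.rotate_rotate w t s)
    (fun w hw => by rw [← length_of_mem_wordsOf hw, List.rotate_length]) _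
    (fun w => match w with
      | [] => 0
      | i :: w => (w.map (a i)).sum) (fun w hw => ?_) (fun w hw => ?_)
  · match w, hw with
    | [], hw =>
      have := length_of_mem_wordsOf hw
      simp at this
      omega
    | i :: w, hw => simp [rot_cons, chi_powerMatrix hq0]
  · rw [← length_of_mem_wordsOf hw, rot_pow_length, monodromy_powerMatrix hq0 a hw, hKm]
    simp

theorem finrank_rotTail (hq0 : q ≠ 0) (hq : ∀ N : ℕ, 0 < N → q ^ N ≠ 1)
    (a : Matrix (Fin n) (Fin n) ℤ) (m : Fin n → ℕ) {N : ℕ} (hN : 0 < N)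
    (hm : totalDegree m = N + 1) (hKm : quadForm a m = linForm a m) :
    N * Module.finrank k
      ↥(component k m ⊓ LinearMap.ker (LinearMap.id - rotTail (powerMatrix q a))) =
      ∑ s ∈ range N, {w ∈ wordsOf m | tailRotate s w = w}.ncard := by
  refine finrank_fixed hq0 hq m hN tailRotate
    (fun s w hw => ?_) (fun w _ => ?_) (fun s t w => ?_)
    (fun w hw => ?_) _
    (fun w => match w with
      | [] => 0
      | [_] => 0
      | y :: i :: w => (w.map (a i)).sum + (a i y + a y i)) (fun w hw => ?_) (fun w hw => ?_)
  · match w, hw with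
    | [], hw => exact hw
    | y :: v, hw => exact mem_wordsOf_of_perm ((List.rotate_perm v s).symm.cons y) hw
  · match w with
    | [] => rfl
    | y :: v => simp [tailRotate]
  · match w with
    | [] => rfl
    | y :: v => simp [tailRotate, List.rotate_rotate]
  · have hl := length_of_mem_wordsOf hw
    match w, hw, hl with
    | [], _, _ => rfl
    | y :: v, hw, hl =>
      rw [List.length_cons, hm, Nat.add_right_cancel_iff] at hl
      rw [tailRotate, ← hl, List.rotate_length]
  · have hl := length_of_mem_wordsOf hw
    match w, hw, hl with
    | [], hw, hl => simp at hl; omega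
    | [y], hw, hl => simp at hl; omega
    | y :: i :: w, hw, hl =>
      rw [rotTail_cons, chi_powerMatrix hq0]
      simp [tailRotate, zpow_add₀ hq0, powerMatrix]
  · have hl := length_of_mem_wordsOf hw
    match w, hw, hl with
    | [], hw, hl => simp at hl; omega
    | y :: v, hw, hl =>
      rw [List.length_cons, hm, Nat.add_right_cancel_iff] at hl
      rw [← hl, rotTail_pow_length, monodromy_powerMatrix hq0 a hw, hKm]
      simp

end FixedSpace

/-! ### Functoriality in the coefficients -/

section ChangeOfScalars

variable {n : ℕ} {S R : Type*} [CommRing S] [CommRing R]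

/-- Application of an additive map to the coefficients. -/
noncomputable def mapCoeff (φ : S →+ R) : (List (Fin n) →₀ S) →+ (List (Fin n) →₀ R) :=
  Finsupp.mapRange.addMonoidHom φ

@[simp] theorem mapCoeff_apply (φ : S →+ R) (f : List (Fin n) →₀ S) (w : List (Fin n)) :
    mapCoeff φ f w = φ (f w) := by
  simp [mapCoeff]

@[simp] theorem mapCoeff_single (φ : S →+ R) (w : List (Fin n)) (c : S) :
    mapCoeff φ (Finsupp.single w c) = Finsupp.single w (φ c) := by
  simp [mapCoeff]

theorem mapCoeff_mem_component (φ : S →+ R) {m : Fin n → ℕ} {f : List (Fin n) →₀ S}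
    (hf : f ∈ component S m) : mapCoeff φ f ∈ component R m := by
  rw [Finsupp.mem_supported'] at hf ⊢
  intro w hw
  rw [mapCoeff_apply, hf w hw, map_zero]

theorem mapCoeff_insertSecond (φ : S →+ R) (i : Fin n) (f : List (Fin n) →₀ S) :
    mapCoeff φ (insertSecond S i f) = insertSecond R i (mapCoeff φ f) := by
  induction f using Finsupp.induction_linear with
  | zero => simp
  | add f g hf hg => simp only [map_add, hf, hg]
  | single w c =>
    match w with
    | [] => simp
    | y :: v => simp

variable {QS : Matrix (Fin n) (Fin n) S} {QR : Matrix (Fin n) (Fin n) R} {φ : S →+ R}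
  (hφ : ∀ i j c, φ (c * QS i j) = φ c * QR i j)

include hφ

/-- Only additivity and compatibility with the matrix entries are required of `φ`, so that besides
the reduction modulo `ε` the map `c ↦ c ε` into the dual numbers is covered. -/
theorem map_mul_chi (i : Fin n) (w : List (Fin n)) (c : S) :
    φ (c * chi QS i w) = φ c * chi QR i w := by
  induction w generalizing c with
  | nil => simp
  | cons l w ih => rw [chi_cons, chi_cons, ← mul_assoc, ih, hφ, mul_assoc]

theorem mapCoeff_der (f : List (Fin n) →₀ S) :
    mapCoeff φ (der QS f) = der QR (mapCoeff φ f) := by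
  induction f using Finsupp.induction_linear with
  | zero => simp
  | add f g hf hg => simp only [map_add, hf, hg]
  | single w c =>
    induction w with
    | nil => simp
    | cons i w ih =>
      rw [der_cons, map_add, mapCoeff_insertSecond, ih, mapCoeff_single, mapCoeff_single,
        mapCoeff_single, der_cons, map_mul_chi hφ]

theorem mapCoeff_derTail (f : List (Fin n) →₀ S) :
    mapCoeff φ (derTail QS f) = derTail QR (mapCoeff φ f) := by
  induction f using Finsupp.induction_linear with
  | zero => simp
  | add f g hf hg => simp only [map_add, hf, hg]
  | single w c =>
    match w with
    | [] => simp
    | i :: w =>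
      rw [derTail_cons, mapCoeff_insertSecond, mapCoeff_der hφ, mapCoeff_single, mapCoeff_single,
        derTail_cons]

theorem mapCoeff_rot (f : List (Fin n) →₀ S) :
    mapCoeff φ (rot QS f) = rot QR (mapCoeff φ f) := by
  induction f using Finsupp.induction_linear with
  | zero => simp
  | add f g hf hg => simp only [map_add, hf, hg]
  | single w c =>
    match w with
    | [] => simp
    | i :: w =>
      rw [rot_cons, mapCoeff_single, mapCoeff_single, rot_cons, map_mul_chi hφ]

end ChangeOfScalars

/-! ### Dependence of the monodromy on the braiding matrix -/

section Monodromy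

variable {n : ℕ} {S R : Type*} [CommRing S] [CommRing R]

theorem monodromy_mul (A B : Matrix (Fin n) (Fin n) R) (w : List (Fin n)) :
    monodromy (Matrix.of fun i j => A i j * B i j) w = monodromy A w * monodromy B w := by
  have h1 : ∀ i w, chi (Matrix.of fun i j => A i j * B i j) i w = chi A i w * chi B i w := by
    intro i w
    induction w with
    | nil => simp
    | cons l w ih =>
      rw [chi_cons, chi_cons, chi_cons, ih, Matrix.of_apply]
      ring
  have h2 : ∀ i w,
      chiOp (Matrix.of fun i j => A i j * B i j) i w = chiOp A i w * chiOp B i w := by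
    intro i w
    induction w with
    | nil => simp
    | cons l w ih =>
      rw [chiOp_cons, chiOp_cons, chiOp_cons, ih, Matrix.of_apply]
      ring
  induction w with
  | nil => simp [monodromy]
  | cons i w ih =>
    simp only [monodromy, ih, h1, h2]
    ring

theorem monodromy_map (φ : S →+* R) (A : Matrix (Fin n) (Fin n) S) (w : List (Fin n)) :
    monodromy (A.map φ) w = φ (monodromy A w) := by
  have h1 : ∀ i w, chi (A.map φ) i w = φ (chi A i w) := by
    intro i w
    induction w with
    | nil => simp
    | cons l w ih => rw [chi_cons, chi_cons, ih, Matrix.map_apply, map_mul]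
  have h2 : ∀ i w, chiOp (A.map φ) i w = φ (chiOp A i w) := by
    intro i w
    induction w with
    | nil => simp
    | cons l w ih => rw [chiOp_cons, chiOp_cons, ih, Matrix.map_apply, map_mul]
  induction w with
  | nil => simp [monodromy]
  | cons i w ih =>
    simp only [monodromy, ih, h1, h2, map_mul]

/-- Only ordered pairs of different occurrences of `i` contribute. This gives the exponent by which
the deformation of `q_{ii}` changes the monodromy. -/
theorem monodromy_single (i : Fin n) (t : R) (w : List (Fin n)) :
    monodromy (Matrix.of fun j l => if j = i ∧ l = i then t else 1) w =
      t ^ (w.count i * (w.count i - 1)) := by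
  have h1 : ∀ (j : Fin n) (w : List (Fin n)),
      chi (Matrix.of fun j l => if j = i ∧ l = i then t else 1) j w =
        if j = i then t ^ w.count i else 1 := by
    intro j w
    induction w with
    | nil => simp
    | cons l w ih =>
      rw [chi_cons, ih, List.count_cons, Matrix.of_apply]
      by_cases hj : j = i <;> by_cases hl : l = i <;> simp [hj, hl, pow_succ']
  have h2 : ∀ (j : Fin n) (w : List (Fin n)),
      chiOp (Matrix.of fun j l => if j = i ∧ l = i then t else 1) j w =
        if j = i then t ^ w.count i else 1 := by
    intro j w
    induction w with
    | nil => simp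
    | cons l w ih =>
      rw [chiOp_cons, ih, List.count_cons, Matrix.of_apply]
      by_cases hj : j = i <;> by_cases hl : l = i <;> simp [hj, hl, pow_succ']
  induction w with
  | nil => simp [monodromy]
  | cons j w ih =>
    rw [monodromy, ih, h1, h2, List.count_cons]
    by_cases hj : j = i
    · simp only [hj, if_true, ← pow_add, beq_self_eq_true, Nat.add_sub_cancel]
      congr 1
      cases List.count i w with
      | zero => rfl
      | succ c => simp; ring
    · simp [hj]

end Monodromy

/-! ### Criteria for injectivity in one multidegree -/

section Injectivity

variable {k : Type*} [Field k] {n : ℕ}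

theorem exists_of_injOn {F : (List (Fin n) →₀ k) →ₗ[k] (List (Fin n) →₀ k)} {m : Fin n → ℕ}
    (hF : ∀ f ∈ component k m, F f ∈ component k m) (hinj : ∀ f ∈ component k m, F f = 0 → f = 0)
    {g : List (Fin n) →₀ k} (hg : g ∈ component k m) : ∃ f ∈ component k m, F f = g := by
  let F' : component k m →ₗ[k] component k m := F.restrict hF
  have h1 : Function.Injective F' := by
    rw [injective_iff_map_eq_zero]
    rintro ⟨f, hf⟩ h
    exact Subtype.ext (hinj f hf (congrArg Subtype.val h))
  obtain ⟨f, hf⟩ := (LinearMap.injective_iff_surjective (K := k) (V := component k m)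
    (f := F')).1 h1 ⟨g, hg⟩
  exact ⟨f.1, f.2, congrArg Subtype.val hf⟩

theorem injOn_of_exists {F : (List (Fin n) →₀ k) →ₗ[k] (List (Fin n) →₀ k)} {m : Fin n → ℕ}
    (hF : ∀ f ∈ component k m, F f ∈ component k m)
    (hsurj : ∀ g ∈ component k m, ∃ f ∈ component k m, F f = g)
    {f : List (Fin n) →₀ k} (hf : f ∈ component k m) (h0 : F f = 0) : f = 0 := by
  let F' : component k m →ₗ[k] component k m := F.restrict hF
  have h1 : Function.Surjective F' := by
    rintro ⟨g, hg⟩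
    obtain ⟨f, hf, hfg⟩ := hsurj g hg
    exact ⟨⟨f, hf⟩, Subtype.ext hfg⟩
  have h2 := (LinearMap.injective_iff_surjective (K := k) (V := component k m) (f := F')).2 h1
  have : (⟨f, hf⟩ : component k m) = 0 := h2 (Subtype.ext (by simpa [F'] using h0))
  exact congrArg Subtype.val this

theorem rotTail_pow_component {R : Type*} [CommRing R] (Q : Matrix (Fin n) (Fin n) R)
    {m : Fin n → ℕ} {N : ℕ} (hm : totalDegree m = N + 1) {z : R}
    (hz : ∀ w ∈ wordsOf m, monodromy Q w = z) {f : List (Fin n) →₀ R}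
    (hf : f ∈ component R m) : (rotTail Q ^ N) f = z • f := by
  refine eqOn_supported (F := rotTail Q ^ N) (G := z • LinearMap.id) (fun w hw => ?_) hf
  have hl := length_of_mem_wordsOf hw
  match w, hw, hl with
  | [], hw, hl => simp at hl; omega
  | y :: v, hw, hl =>
    rw [List.length_cons, hm, Nat.add_right_cancel_iff] at hl
    rw [← hl, rotTail_pow_length, hz _ hw]
    simp

variable (Q : Matrix (Fin n) (Fin n) k) {m : Fin n → ℕ}

/-- A fixed vector of `rotTail` is fixed by its `N`-th power, the scalar `z`, hence is zero. So `der
(1 - rot)` is injective, `1 - rot` is bijective on the finite-dimensional component, and `der`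
inherits injectivity. -/
theorem injectiveAt_of_monodromy_ne_one
    (hlow : ∀ m', totalDegree m' + 1 = totalDegree m → InjectiveAt Q m') {N : ℕ}
    (hm : totalDegree m = N + 1) {z : k} (hz : ∀ w ∈ wordsOf m, monodromy Q w = z)
    (hz1 : z ≠ 1) : InjectiveAt Q m := by
  have h1 : ∀ f ∈ component k m, f - rotTail Q f = 0 → f = 0 := by
    intro f hf h
    have hfix : rotTail Q f = f := (sub_eq_zero.1 h).symm
    have hpow : ∀ s, (rotTail Q ^ s) f = f := by
      intro s
      induction s with
      | zero => rfl
      | succ s ih => rw [pow_succ, Module.End.mul_apply, hfix, ih]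
    have := rotTail_pow_component Q hm hz hf
    rw [hpow] at this
    have h2 : (z - 1) • f = 0 := by rw [sub_smul, one_smul, ← this, sub_self]
    exact (smul_eq_zero.1 h2).resolve_left (sub_ne_zero.2 hz1)
  have h2 : ∀ f ∈ component k m, der Q (f - rot Q f) = 0 → f = 0 := by
    intro f hf h
    rw [der_one_sub_rot] at h
    exact derTail_injective Q hlow (by omega) hf (h1 _ (derTail_mem_component Q hf) h)
  intro f hf h0
  obtain ⟨g, hg, hgf⟩ := exists_of_injOn (F := LinearMap.id - rot Q) (m := m)
    (fun f hf => sub_mem hf (rot_mem_component Q hf))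
    (fun f hf h => h2 f hf (by
      rw [LinearMap.sub_apply, LinearMap.id_apply] at h
      rw [h, map_zero])) hf
  rw [LinearMap.sub_apply, LinearMap.id_apply] at hgf
  rw [← hgf, h2 g hg (by rw [hgf, h0])]
  simp

/-- By the hypothesis in lower degree `derTail` is bijective on the component, so it identifies the
two kernels. -/
theorem finrank_ker_rotTail_derTail
    (hlow : ∀ m', totalDegree m' + 1 = totalDegree m → InjectiveAt Q m')
    (hm : 0 < totalDegree m) :
    Module.finrank k ↥(component k m ⊓ LinearMap.ker ((LinearMap.id - rotTail Q) ∘ₗ derTail Q)) =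
      Module.finrank k ↥(component k m ⊓ LinearMap.ker (LinearMap.id - rotTail Q)) := by
  have hE : ∀ f ∈ component k m ⊓ LinearMap.ker ((LinearMap.id - rotTail Q) ∘ₗ derTail Q),
      derTail Q f ∈ component k m ⊓ LinearMap.ker (LinearMap.id - rotTail Q) := fun f hf =>
    ⟨derTail_mem_component Q hf.1, hf.2⟩
  refine (LinearEquiv.ofBijective ((derTail Q).restrict hE) ⟨?_, ?_⟩).finrank_eq
  · rw [injective_iff_map_eq_zero]
    rintro ⟨f, hf⟩ h
    exact Subtype.ext (derTail_injective Q hlow hm hf.1 (congrArg Subtype.val h))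
  · rintro ⟨g, hg⟩
    obtain ⟨f, hf, hfg⟩ := exists_of_injOn (F := derTail Q)
      (fun f hf => derTail_mem_component Q hf)
      (fun f hf h => derTail_injective Q hlow hm hf h) hg.1
    subst hfg
    exact ⟨⟨f, hf, hg.2⟩, rfl⟩

theorem ker_one_sub_rot_le :
    component k m ⊓ LinearMap.ker (LinearMap.id - rot Q) ≤
      component k m ⊓ LinearMap.ker ((LinearMap.id - rotTail Q) ∘ₗ derTail Q) := by
  rintro f ⟨hf, hr⟩
  refine ⟨hf, LinearMap.mem_ker.2 ?_⟩
  have hr := LinearMap.mem_ker.1 hr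
  rw [LinearMap.sub_apply, LinearMap.id_apply] at hr
  rw [LinearMap.comp_apply, LinearMap.sub_apply, LinearMap.id_apply, ← der_one_sub_rot, hr,
    map_zero]

/-- If `der` were injective, `der (1 - rot)` would have the same kernel as `1 - rot`. By the key
identity the former kernel has the dimension of the fixed space of `rotTail`. -/
theorem not_injectiveAt_of_finrank_ne
    (hlow : ∀ m', totalDegree m' + 1 = totalDegree m → InjectiveAt Q m')
    (hm : 0 < totalDegree m)
    (hne : Module.finrank k ↥(component k m ⊓ LinearMap.ker (LinearMap.id - rot Q)) ≠
      Module.finrank k ↥(component k m ⊓ LinearMap.ker (LinearMap.id - rotTail Q))) :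
    ¬ InjectiveAt Q m := by
  intro hinj
  refine hne ?_
  rw [← finrank_ker_rotTail_derTail Q hlow hm]
  suffices h : component k m ⊓ LinearMap.ker (LinearMap.id - rot Q) =
      component k m ⊓ LinearMap.ker ((LinearMap.id - rotTail Q) ∘ₗ derTail Q) by rw [h]
  refine le_antisymm (ker_one_sub_rot_le Q) ?_
  rintro f ⟨hf, hr⟩
  refine ⟨hf, LinearMap.mem_ker.2 ?_⟩
  have hr := LinearMap.mem_ker.1 hr
  rw [LinearMap.comp_apply, LinearMap.sub_apply, LinearMap.id_apply, ← der_one_sub_rot] at hr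
  exact hinj _ (sub_mem hf (rot_mem_component Q hf)) hr

theorem one_add_eps_pow (M : ℕ) :
    (1 + DualNumber.eps : DualNumber k) ^ M = 1 + (M : DualNumber k) * DualNumber.eps := by
  induction M with
  | zero => simp
  | succ M ih =>
    rw [pow_succ, ih, Nat.cast_succ]
    have := DualNumber.eps_mul_eps (R := k)
    linear_combination (M : DualNumber k) * this

/-- Injectivity of `Δ_{m-1,1}` by a deformation of the entry `q_{ii}` over the dual numbers. -/
theorem injectiveAt_of_finrank_eq
    (hlow : ∀ m', totalDegree m' + 1 = totalDegree m → InjectiveAt Q m') {N : ℕ}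
    (hm : totalDegree m = N + 1) (hz : ∀ w ∈ wordsOf m, monodromy Q w = 1)
    (heq : Module.finrank k ↥(component k m ⊓ LinearMap.ker (LinearMap.id - rot Q)) =
      Module.finrank k ↥(component k m ⊓ LinearMap.ker (LinearMap.id - rotTail Q)))
    (i : Fin n) (hi : ((m i * (m i - 1) : ℕ) : k) ≠ 0) : InjectiveAt Q m := by
  have hpos : 0 < totalDegree m := by omega
  -- Equality of dimensions upgrades the inclusion to an equality: whatever `der (1 - rot)` kills is
  -- already invariant under `rot`.
  have hker := Submodule.eq_of_le_of_finrank_eq (ker_one_sub_rot_le Q (m := m))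
    (heq.trans (finrank_ker_rotTail_derTail Q hlow hpos).symm)
  let B : Matrix (Fin n) (Fin n) (DualNumber k) :=
    Matrix.of fun j l => if j = i ∧ l = i then 1 + DualNumber.eps else 1
  let QR : Matrix (Fin n) (Fin n) (DualNumber k) :=
    Matrix.of fun j l => (Q.map (TrivSqZeroExt.inlHom k k)) j l * B j l
  have hQR : ∀ j l, QR j l = TrivSqZeroExt.inl (Q j l) * B j l := fun _ _ => rfl
  have hBf : ∀ j l, (B j l).fst = 1 := by
    intro j l
    simp only [B, Matrix.of_apply]
    split_ifs <;> simp [DualNumber.fst_eps]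
  have hQf : ∀ j l, (QR j l).fst = Q j l := by
    intro j l
    rw [hQR, TrivSqZeroExt.fst_mul, hBf, TrivSqZeroExt.fst_inl, mul_one]
  let fst : DualNumber k →+ k := (TrivSqZeroExt.fstHom k k k : DualNumber k →+* k)
  let snd : DualNumber k →+ k := (TrivSqZeroExt.sndHom k k).toAddMonoidHom
  let inl : k →+ DualNumber k := (TrivSqZeroExt.inlHom k k : k →+* DualNumber k)
  let inr : k →+ DualNumber k := (TrivSqZeroExt.inrHom k k).toAddMonoidHom
  have fst_def : ∀ c, fst c = c.fst := fun _ => rfl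
  have snd_def : ∀ c, snd c = c.snd := fun _ => rfl
  have inl_def : ∀ c, inl c = TrivSqZeroExt.inl c := fun _ => rfl
  have inr_def : ∀ c, inr c = TrivSqZeroExt.inr c := fun _ => rfl
  have hfst : ∀ j l c, fst (c * QR j l) = fst c * Q j l := by
    intro j l c
    rw [fst_def, fst_def, TrivSqZeroExt.fst_mul, hQf]
  have hinr : ∀ j l c, inr (c * Q j l) = inr c * QR j l := by
    intro j l c
    rw [inr_def, inr_def]
    ext
    · simp
    · simp [hQf, mul_comm]
  have exact_of_fst : ∀ g : List (Fin n) →₀ DualNumber k, mapCoeff fst g = 0 →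
      g = mapCoeff inr (mapCoeff snd g) := by
    intro g hg
    ext1 w
    have := DFunLike.congr_fun hg w
    rw [mapCoeff_apply, fst_def] at this
    rw [mapCoeff_apply, mapCoeff_apply, inr_def, snd_def]
    ext
    · simpa using this
    · simp
  have fst_inl : ∀ g : List (Fin n) →₀ k, mapCoeff fst (mapCoeff inl g) = g := by
    intro g
    ext w
    simp [fst_def, inl_def]
  have fst_inr : ∀ g : List (Fin n) →₀ k, mapCoeff fst (mapCoeff inr g) = 0 := by
    intro g
    ext w
    simp [fst_def, inr_def]
  have snd_inr : ∀ g : List (Fin n) →₀ k, mapCoeff snd (mapCoeff inr g) = g := by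
    intro g
    ext w
    simp [snd_def, inr_def]
  set M : ℕ := m i * (m i - 1) with hM
  have hzR : ∀ w ∈ wordsOf m, monodromy QR w = 1 + (M : DualNumber k) * DualNumber.eps := by
    intro w hw
    have h1 := monodromy_mul (Q.map (TrivSqZeroExt.inlHom k k)) B w
    have h2 := monodromy_map (TrivSqZeroExt.inlHom k k) Q w
    have h3 := monodromy_single i (1 + DualNumber.eps : DualNumber k) w
    rw [hw i, one_add_eps_pow] at h3
    rw [h1, h2, hz w hw, map_one, one_mul, h3]
  -- Surjectivity lifts along the nilpotent `ε`: solve modulo `ε`, then correct the error, which is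
  -- a multiple of `ε`.
  have derTail_surj : ∀ g ∈ component (DualNumber k) m,
      ∃ f ∈ component (DualNumber k) m, derTail QR f = g := by
    intro g hg
    have hEs : ∀ g ∈ component k m, ∃ f ∈ component k m, derTail Q f = g := fun g hg =>
      exists_of_injOn (fun f hf => derTail_mem_component Q hf)
        (fun f hf h => derTail_injective Q hlow hpos hf h) hg
    obtain ⟨f0, hf0, hf0g⟩ := hEs _ (mapCoeff_mem_component fst hg)
    have hl := mapCoeff_mem_component inl hf0
    have hr : mapCoeff fst (g - derTail QR (mapCoeff inl f0)) = 0 := by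
      rw [map_sub, mapCoeff_derTail hfst, fst_inl, hf0g, sub_self]
    have hs := mapCoeff_mem_component snd (sub_mem hg (derTail_mem_component QR hl))
    obtain ⟨f1, hf1, hf1g⟩ := hEs _ hs
    refine ⟨mapCoeff inl f0 + mapCoeff inr f1, add_mem hl (mapCoeff_mem_component inr hf1), ?_⟩
    rw [map_add, ← mapCoeff_derTail hinr, hf1g, ← exact_of_fst _ hr, add_sub_cancel]
  -- In finite dimension it suffices that `der` is onto; a preimage of an arbitrary `w` is
  -- constructed.
  refine fun f hf h0 => injOn_of_exists (fun f hf => der_mem_component Q hf) (fun w hw => ?_) hf h0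
  -- Let `R` be the deformed `rotTail`, with `R ^ N = 1 + M ε`. Then `(1 - R)(1 + R + ⋯ + R^{N-1}) v
  -- = -M ε v`, and the factor `-1/M` makes this `ε w`.
  let v := mapCoeff inl (-(M : k)⁻¹ • w)
  have hv : v ∈ component (DualNumber k) m :=
    mapCoeff_mem_component inl (Submodule.smul_mem _ _ hw)
  let u := (∑ s ∈ Finset.range N, rotTail QR ^ s) v
  have hpow : ∀ s, (rotTail QR ^ s) v ∈ component (DualNumber k) m := by
    intro s
    induction s with
    | zero => exact hv
    | succ s ih =>
      rw [pow_succ', Module.End.mul_apply]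
      exact rotTail_mem_component QR ih
  have hu : u ∈ component (DualNumber k) m := by
    simp only [u, LinearMap.sum_apply]
    exact Submodule.sum_mem _ fun s _ => hpow s
  have hu' : u - rotTail QR u = mapCoeff inr w := by
    have h1 := congrArg (fun F => F v) (mul_neg_geom_sum (rotTail QR) N)
    simp only [Module.End.mul_apply, LinearMap.sub_apply, Module.End.one_apply] at h1
    rw [rotTail_pow_component QR hm hzR hv] at h1
    change u - rotTail QR u = _ at h1
    rw [h1]
    ext1 y
    rw [Finsupp.sub_apply, Finsupp.smul_apply, mapCoeff_apply, mapCoeff_apply,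
      Finsupp.smul_apply, inl_def, inr_def]
    ext
    · simp
    · have : ((M : k) : k) ≠ 0 := hi
      simp [DualNumber.snd_eps, DualNumber.fst_eps]
      field_simp
  obtain ⟨f, hf, hfu⟩ := derTail_surj u hu
  have hd : der QR (f - rot QR f) = mapCoeff inr w := by
    rw [der_one_sub_rot, hfu, hu']
  -- Modulo `ε` the element `f` is killed by `der (1 - rot)`, so by `hker` it is invariant under
  -- `rot`. Consequently `f - rot f = ε g`, and comparison of the coefficients of `ε` gives `der g =
  -- w`.
  have hf0 : mapCoeff fst f - rot Q (mapCoeff fst f) = 0 := by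
    have h1 : mapCoeff fst f ∈
        component k m ⊓ LinearMap.ker ((LinearMap.id - rotTail Q) ∘ₗ derTail Q) := by
      refine ⟨mapCoeff_mem_component fst hf, LinearMap.mem_ker.2 ?_⟩
      rw [LinearMap.comp_apply, LinearMap.sub_apply, LinearMap.id_apply, ← der_one_sub_rot,
        ← mapCoeff_rot hfst, ← map_sub, ← mapCoeff_der hfst, hd, fst_inr]
    rw [← hker] at h1
    exact LinearMap.mem_ker.1 h1.2
  have hg : mapCoeff fst (f - rot QR f) = 0 := by
    rw [map_sub, mapCoeff_rot hfst, hf0]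
  refine ⟨mapCoeff snd (f - rot QR f),
    mapCoeff_mem_component snd (sub_mem hf (rot_mem_component QR hf)), ?_⟩
  rw [exact_of_fst _ hg, ← mapCoeff_der hinr] at hd
  rw [← snd_inr (der Q _), hd, snd_inr]

theorem der_replicate (i : Fin n) (r : ℕ) (c : k) :
    der Q (Finsupp.single (List.replicate r i) c) =
      Finsupp.single (List.replicate r i) (c * qNumber r (Q i i)) := by
  induction r with
  | zero => simp [qNumber]
  | succ r ih =>
    rw [List.replicate_succ, der_cons, ih]
    have hchi : chi Q i (List.replicate r i) = Q i i ^ r := by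
      simp [chi]
    have hsum : qNumber (r + 1) (Q i i) = qNumber r (Q i i) + Q i i ^ r :=
      Finset.sum_range_succ _ _
    rw [hchi, hsum, mul_add, Finsupp.single_add]
    match r with
    | 0 => simp [qNumber]
    | r + 1 =>
      rw [List.replicate_succ, insertSecond_cons]

theorem wordsOf_single (i : Fin n) (r : ℕ) :
    wordsOf (Pi.single i r : Fin n → ℕ) = {List.replicate r i} := by
  ext w
  rw [Set.mem_singleton_iff, List.eq_replicate_iff]
  constructor
  · intro hw
    have hl := length_of_mem_wordsOf hw
    refine ⟨by rw [hl]; simp [totalDegree], fun b hb => ?_⟩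
    by_contra hne
    have := hw b
    rw [Pi.single_eq_of_ne hne, List.count_eq_zero] at this
    exact this hb
  · rintro ⟨hl, hw⟩
    have := List.eq_replicate_iff.2 ⟨hl, hw⟩
    subst this
    intro j
    rw [List.count_replicate]
    by_cases h : i = j
    · subst h
      simp
    · simp [h, Ne.symm h]

/-- The component is one-dimensional, spanned by `x_i^r`, on which `der` is multiplication by
`(r)_{q_{ii}}`. -/
theorem injectiveAt_single_iff (i : Fin n) (r : ℕ) :
    InjectiveAt Q (Pi.single i r) ↔ qNumber r (Q i i) ≠ 0 := by
  constructor
  · intro h h0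
    have hmem : Finsupp.single (List.replicate r i) (1 : k) ∈ component k (Pi.single i r) := by
      refine Finsupp.single_mem_supported k _ ?_
      rw [wordsOf_single]
      rfl
    have := h _ hmem (by rw [der_replicate, h0, mul_zero, Finsupp.single_zero])
    rw [Finsupp.single_eq_zero] at this
    exact one_ne_zero this
  · intro h f hf h0
    rw [component, wordsOf_single, Finsupp.mem_supported, ← Finset.coe_singleton,
      Finset.coe_subset, Finsupp.support_subset_singleton] at hf
    rw [hf, der_replicate, Finsupp.single_eq_zero] at h0
    rw [hf, (mul_eq_zero.1 h0).resolve_right h, Finsupp.single_zero]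

end Injectivity

/-! ### Counting words fixed by rotations -/

section Counting

open Finset

variable {n : ℕ}

theorem totalDegree_smul (t : ℕ) (b : Fin n → ℕ) : totalDegree (t • b) = t * totalDegree b := by
  simp [totalDegree, mul_sum]

theorem cons_mem_wordsOf_iff {m : Fin n → ℕ} {j : Fin n} {v : List (Fin n)} :
    j :: v ∈ wordsOf m ↔ m j ≠ 0 ∧ v ∈ wordsOf (m - Pi.single j 1) := by
  simp only [mem_wordsOf, List.count_cons]
  constructor
  · intro h
    have hj := h j
    simp only [beq_self_eq_true, if_true] at hj
    refine ⟨by omega, fun i => ?_⟩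
    by_cases hi : i = j
    · subst hi
      simp
      omega
    · have := h i
      simp [hi, Ne.symm hi] at this ⊢
      exact this
  · rintro ⟨h0, h⟩ i
    have := h i
    by_cases hi : i = j
    · subst hi
      simp at this ⊢
      omega
    · simp [hi, Ne.symm hi] at this ⊢
      exact this

theorem totalDegree_sub_single {m : Fin n → ℕ} {j : Fin n} (hj : m j ≠ 0) :
    totalDegree (m - Pi.single j 1) + 1 = totalDegree m := by
  have hm : m = (m - Pi.single j 1) + Pi.single j 1 := by
    ext i
    by_cases hi : i = j
    · subst hi
      simp
      omega
    · simp [hi]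
  conv_rhs => rw [hm]
  simp [totalDegree, sum_add_distrib]

/-- Words are sorted by their first letter `j`: by induction each class contributes `m_j L!`, and
these sum to `(L + 1)!`. -/
theorem prod_factorial_mul_ncard_wordsOf (m : Fin n → ℕ) :
    (∏ i, (m i).factorial) * (wordsOf m).ncard = (totalDegree m).factorial := by
  induction hL : totalDegree m generalizing m with
  | zero =>
    have h0 : ∀ i, m i = 0 := by
      intro i
      have := (sum_eq_zero_iff.1 hL) i (mem_univ i)
      exact this
    have : wordsOf m = {[]} := by
      ext w
      constructor
      · intro hw
        have := length_of_mem_wordsOf hw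
        rw [hL, List.length_eq_zero_iff] at this
        exact this
      · rintro rfl i
        rw [h0]
        simp
    simp [this, h0]
  | succ L ih =>
    have hcard : (wordsOf m).ncard = ∑ j, {v | j :: v ∈ wordsOf m}.ncard := by
      have hfin : ∀ j : Fin n, {v | j :: v ∈ wordsOf m}.Finite := fun j =>
        (wordsOf_finite (m - Pi.single j 1)).subset fun v hv => (cons_mem_wordsOf_iff.1 hv).2
      have (j : Fin n) : Finite {v | j :: v ∈ wordsOf m} := hfin j
      simp only [← Nat.card_coe_set_eq]
      rw [← Nat.card_sigma]
      refine (Nat.card_congr (Equiv.ofBijective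
        (fun p : (Σ j : Fin n, {v | j :: v ∈ wordsOf m}) =>
          (⟨p.1 :: p.2.1, p.2.2⟩ : wordsOf m)) ⟨?_, ?_⟩)).symm
      · rintro ⟨j, v, hv⟩ ⟨j', v', hv'⟩ h
        have := congrArg Subtype.val h
        simp only [List.cons.injEq] at this
        obtain ⟨rfl, rfl⟩ := this
        rfl
      · rintro ⟨w, hw⟩
        match w, hw with
        | [], hw =>
          have := length_of_mem_wordsOf hw
          simp [hL] at this
        | j :: v, hw => exact ⟨⟨j, v, hw⟩, rfl⟩
    have hterm : ∀ j, (∏ i, (m i).factorial) * {v | j :: v ∈ wordsOf m}.ncard =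
        m j * L.factorial := by
      intro j
      by_cases hj : m j = 0
      · have : {v | j :: v ∈ wordsOf m} = ∅ := by
          ext v
          simp [cons_mem_wordsOf_iff, hj]
        simp [this, hj]
      · have : {v | j :: v ∈ wordsOf m} = wordsOf (m - Pi.single j 1) := by
          ext v
          exact cons_mem_wordsOf_iff.trans (and_iff_right hj)
        have htd := totalDegree_sub_single hj
        rw [this, ← ih (m - Pi.single j 1) (by omega), ← mul_assoc]
        congr 1
        have e := mul_prod_erase univ
          (fun i => ((m - Pi.single j 1 : Fin n → ℕ) i).factorial) (mem_univ j)
        refine Eq.trans ?_ (congrArg (m j * ·) e)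
        rw [← mul_prod_erase _ _ (mem_univ j)]
        simp only [← mul_assoc]
        congr 1
        · simp only [Pi.sub_apply, Pi.single_eq_same]
          exact (Nat.mul_factorial_pred hj).symm
        · refine prod_congr rfl fun i hi => ?_
          simp [ne_of_mem_erase hi]
    rw [hcard, mul_sum, sum_congr rfl fun j _ => hterm j, ← sum_mul, Nat.factorial_succ]
    congr 1

theorem ncard_wordsOf (m : Fin n → ℕ) : (wordsOf m).ncard = Nat.multinomial univ m := by
  have h1 := prod_factorial_mul_ncard_wordsOf m
  have h2 := Nat.multinomial_spec univ m
  rw [totalDegree, ← h2] at h1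
  exact Nat.eq_of_mul_eq_mul_left (prod_pos fun i _ => Nat.factorial_pos _) h1

theorem rotate_gcd {α : Type*} {w : List α} {s : ℕ} (h : w.rotate s = w) :
    w.rotate (s.gcd w.length) = w := by
  have hmul : ∀ a, w.rotate (s * a) = w := by
    intro a
    induction a with
    | zero => simp
    | succ a ih => rw [Nat.mul_succ, ← List.rotate_rotate, ih, h]
  by_cases hlt : s.gcd w.length < w.length
  · obtain ⟨a, ha⟩ := Nat.exists_mul_mod_eq_gcd hlt
    rw [← ha.2, List.rotate_mod, hmul]
  · rcases Nat.eq_zero_or_pos w.length with h0 | h0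
    · rw [List.length_eq_zero_iff] at h0
      subst h0
      simp
    · have := Nat.le_antisymm (Nat.gcd_le_right s h0) (not_lt.1 hlt)
      rw [this, List.rotate_length]

theorem flatten_replicate_append {α : Type*} (u : List α) (d : ℕ) :
    (List.replicate d u).flatten ++ u = u ++ (List.replicate d u).flatten := by
  induction d with
  | zero => simp
  | succ d ih => rw [List.replicate_succ, List.flatten_cons, List.append_assoc, ih]

/-- Commuting with `u` forces `u` to be a prefix of `v`, which can be split off. -/
theorem eq_flatten_replicate_of_append_comm {α : Type*} {u v : List α} {d : ℕ}
    (h : u ++ v = v ++ u) (hl : v.length = d * u.length) : v = (List.replicate d u).flatten := by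
  induction d generalizing v with
  | zero => simpa using hl
  | succ d ih =>
    have hle : u.length ≤ v.length := by rw [hl]; exact Nat.le_mul_of_pos_left _ d.succ_pos
    have hp : u <+: v := by
      refine List.prefix_of_prefix_length_le (l₃ := u ++ v) (List.prefix_append _ _) ?_ hle
      rw [h]
      exact List.prefix_append _ _
    obtain ⟨v', rfl⟩ := hp
    rw [List.append_assoc, List.append_cancel_left_eq] at h
    rw [List.replicate_succ, List.flatten_cons, ← ih h]
    rw [List.length_append] at hl
    linarith [Nat.succ_mul d u.length]

theorem eq_flatten_replicate_take {α : Type*} {w : List α} {c d : ℕ} (hd : 0 < d)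
    (hl : w.length = d * c) (h : w.rotate c = w) : w = (List.replicate d (w.take c)).flatten := by
  obtain ⟨d, rfl⟩ := Nat.exists_eq_succ_of_ne_zero hd.ne'
  have hc : (w.take c).length = c := by
    rw [List.length_take, hl]
    exact min_eq_left (Nat.le_mul_of_pos_left _ d.succ_pos)
  have h1 := List.rotate_append_length_eq (w.take c) (w.drop c)
  rw [hc, List.take_append_drop, h] at h1
  have h2 : w.drop c = (List.replicate d (w.take c)).flatten := by
    refine eq_flatten_replicate_of_append_comm ?_ ?_
    · rw [List.take_append_drop, ← h1]
    · rw [hc, List.length_drop, hl, Nat.succ_mul, Nat.add_sub_cancel]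
  rw [List.replicate_succ, List.flatten_cons, ← h2, List.take_append_drop]

theorem count_flatten_replicate (u : List (Fin n)) (d : ℕ) (i : Fin n) :
    (List.replicate d u).flatten.count i = d * u.count i := by
  induction d with
  | zero => simp
  | succ d ih => rw [List.replicate_succ, List.flatten_cons, List.count_append, ih]; ring

theorem rotate_flatten_replicate {α : Type*} (u : List α) (d t : ℕ) :
    (List.replicate d u).flatten.rotate (u.length * t) = (List.replicate d u).flatten := by
  have h1 : (List.replicate d u).flatten.rotate u.length = (List.replicate d u).flatten := by
    cases d with
    | zero => simp
    | succ d =>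
      rw [List.replicate_succ, List.flatten_cons, List.rotate_append_length_eq,
        flatten_replicate_append]
  induction t with
  | zero => simp
  | succ t ih => rw [Nat.mul_succ, ← List.rotate_rotate, ih, h1]

/-- A word fixed by the rotation by `s` is fixed by the rotation by `c = gcd(s, |m|)`, hence is the
power with exponent `|m| / c` of its prefix of length `c`. -/
theorem dvd_of_rotate_eq {m : Fin n → ℕ} {s : ℕ} {w : List (Fin n)} (hw : w ∈ wordsOf m)
    (hm : 0 < totalDegree m) (h : w.rotate s = w) (i : Fin n) :
    totalDegree m / s.gcd (totalDegree m) ∣ m i := by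
  have hl := length_of_mem_wordsOf hw
  have hc := rotate_gcd h
  rw [hl] at hc
  have hdvd : s.gcd (totalDegree m) ∣ totalDegree m := Nat.gcd_dvd_right _ _
  have := eq_flatten_replicate_take (d := totalDegree m / s.gcd (totalDegree m))
    (Nat.div_pos (Nat.le_of_dvd hm hdvd) (Nat.gcd_pos_of_pos_right _ hm))
    (by rw [hl, Nat.div_mul_cancel hdvd]) hc
  rw [← hw i, this, count_flatten_replicate]
  exact dvd_mul_right _ _

/-- The fixed words are exactly the powers `u^d` with `u` of degree `b`. -/
theorem ncard_rotate_fixed {b : Fin n → ℕ} {d s : ℕ} (hd : 0 < d)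
    (hs : s.gcd (totalDegree (d • b)) = totalDegree b) :
    {w ∈ wordsOf (d • b) | w.rotate s = w}.ncard = (wordsOf b).ncard := by
  have hL := totalDegree_smul d b
  symm
  refine Set.ncard_congr (fun u _ => (List.replicate d u).flatten) ?_ ?_ ?_
  · intro u hu
    refine ⟨fun i => ?_, ?_⟩
    · rw [count_flatten_replicate, hu i]
      rfl
    · have hdvd : totalDegree b ∣ s := hs ▸ Nat.gcd_dvd_left _ _
      obtain ⟨t, rfl⟩ := hdvd
      have := rotate_flatten_replicate u d t
      rwa [length_of_mem_wordsOf hu] at this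
  · intro u v hu hv h
    obtain ⟨d, rfl⟩ := Nat.exists_eq_succ_of_ne_zero hd.ne'
    rw [List.replicate_succ, List.replicate_succ, List.flatten_cons, List.flatten_cons] at h
    exact (List.append_inj h
      (by rw [length_of_mem_wordsOf hu, length_of_mem_wordsOf hv])).1
  · rintro w ⟨hw, hr⟩
    have hl := length_of_mem_wordsOf hw
    have hc := rotate_gcd hr
    rw [hl, hs] at hc
    rw [hL] at hl
    have he := eq_flatten_replicate_take hd hl hc
    refine ⟨w.take (totalDegree b), fun i => ?_, he.symm⟩
    have := hw i
    rw [he, count_flatten_replicate] at this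
    exact Nat.eq_of_mul_eq_mul_left hd this

/-- The sum in Burnside's lemma for the rotations of the words of degree `g b`, where the
coefficients of `b` are coprime. -/
theorem sum_ncard_rotate_fixed {b : Fin n → ℕ} {g : ℕ} (hg : 0 < g) (hb : 0 < totalDegree b)
    (hcop : ∀ d, (∀ i, d ∣ b i) → d = 1) :
    ∑ s ∈ range (totalDegree (g • b)), {w ∈ wordsOf (g • b) | w.rotate s = w}.ncard =
      ∑ j ∈ range g, (wordsOf (j.gcd g • b)).ncard := by
  have hL := totalDegree_smul g b
  have hLpos : 0 < totalDegree (g • b) := by rw [hL]; exact Nat.mul_pos hg hb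
  symm
  refine sum_of_injOn (fun j => totalDegree b * j) ?_ ?_ ?_ ?_
  · intro x _ y _ h
    exact Nat.eq_of_mul_eq_mul_left hb h
  · intro j hj
    rw [mem_coe, mem_range] at hj ⊢
    rw [hL, mul_comm g]
    exact Nat.mul_lt_mul_of_pos_left hj hb
  · intro s hs hns
    rw [Set.ncard_eq_zero ((wordsOf_finite _).subset fun w hw => hw.1),
      Set.eq_empty_iff_forall_notMem]
    rintro w ⟨hw, hr⟩
    refine hns ?_
    have hdvd := fun i => dvd_of_rotate_eq hw hLpos hr i
    set c := s.gcd (totalDegree (g • b)) with hc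
    have hcL : c ∣ totalDegree (g • b) := Nat.gcd_dvd_right _ _
    obtain ⟨d, hd⟩ := hcL
    have hcpos : 0 < c := Nat.gcd_pos_of_pos_right _ hLpos
    rw [hd, Nat.mul_div_cancel_left _ hcpos] at hdvd
    -- From `d ∣ g b_i` for all `i` it follows that `d / gcd(d, g)` divides every `b_i`, so it
    -- equals 1 by coprimality. Thus only rotations by multiples of `|b|` have fixed words.
    have hdg : d ∣ g := by
      have h1 := hcop (d / d.gcd g) fun i => by
        have h2 : d ∣ g * b i := hdvd i
        have hpos : 0 < d.gcd g := Nat.gcd_pos_of_pos_right _ hg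
        exact Nat.Coprime.dvd_of_dvd_mul_left (Nat.coprime_div_gcd_div_gcd hpos)
          (by
            refine Nat.dvd_of_mul_dvd_mul_left hpos ?_
            rw [Nat.mul_div_cancel' (Nat.gcd_dvd_left _ _), ← mul_assoc,
              Nat.mul_div_cancel' (Nat.gcd_dvd_right _ _)]
            exact h2)
      have h3 := Nat.div_mul_cancel (Nat.gcd_dvd_left d g)
      rw [h1, one_mul] at h3
      rw [← h3]
      exact Nat.gcd_dvd_right _ _
    obtain ⟨e, rfl⟩ := hdg
    have hdpos : 0 < d := Nat.pos_of_mul_pos_right hg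
    have hce : c = totalDegree b * e := by
      have : c * d = d * e * totalDegree b := by rw [← hd, hL]
      refine Nat.eq_of_mul_eq_mul_right hdpos ?_
      rw [this]
      ring
    have hBs : totalDegree b ∣ s := (hce ▸ dvd_mul_right _ _ : totalDegree b ∣ c).trans
      (Nat.gcd_dvd_left _ _)
    obtain ⟨j, rfl⟩ := hBs
    refine ⟨j, ?_, rfl⟩
    rw [mem_coe, mem_range]
    rw [mem_range, hL, mul_comm _ (totalDegree b)] at hs
    exact Nat.lt_of_mul_lt_mul_left hs
  · intro j _
    have hpos : 0 < j.gcd g := Nat.gcd_pos_of_pos_right _ hg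
    obtain ⟨d, hd⟩ := Nat.gcd_dvd_right j g
    have hdpos : 0 < d := by
      rcases Nat.eq_zero_or_pos d with h | h
      · rw [h, mul_zero] at hd
        omega
      · exact h
    have hgb : g • b = d • (j.gcd g • b) := by
      conv_lhs => rw [hd, mul_comm, mul_smul]
    rw [hgb]
    refine (ncard_rotate_fixed hdpos ?_).symm
    rw [← hgb, hL, totalDegree_smul, mul_comm g, Nat.gcd_mul_left, mul_comm]

/-- Only the summand of the trivial rotation is kept; this lower bound suffices outside the
exceptional degrees. -/
theorem ncard_le_sum_tailRotate {m : Fin n → ℕ} {N : ℕ} (hN : 0 < N) :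
    (wordsOf m).ncard ≤ ∑ s ∈ range N, {w ∈ wordsOf m | tailRotate s w = w}.ncard := by
  have h0 : {w ∈ wordsOf m | tailRotate 0 w = w} = wordsOf m := by
    ext w
    refine and_iff_left ?_
    match w with
    | [] => rfl
    | y :: v => simp [tailRotate]
  conv_lhs => rw [← h0]
  exact single_le_sum (f := fun s => {w ∈ wordsOf m | tailRotate s w = w}.ncard)
    (fun _ _ => Nat.zero_le _) (mem_range.2 hN)

/-- A nontrivial rotation fixing a tail of degree `m - e_y` would give a common divisor greater than
1 of its entries. -/
theorem sum_tailRotate_eq {m : Fin n → ℕ} {N : ℕ} (hN : 0 < N) (hm : totalDegree m = N + 1)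
    (hcop : ∀ y, m y ≠ 0 → ∀ d, (∀ i, d ∣ (m - Pi.single y 1 : Fin n → ℕ) i) → d = 1) :
    ∑ s ∈ range N, {w ∈ wordsOf m | tailRotate s w = w}.ncard = (wordsOf m).ncard := by
  have h0 : {w ∈ wordsOf m | tailRotate 0 w = w} = wordsOf m := by
    ext w
    refine and_iff_left ?_
    match w with
    | [] => rfl
    | y :: v => simp [tailRotate]
  rw [sum_eq_single 0, h0]
  · intro s hs hs0
    rw [Set.ncard_eq_zero ((wordsOf_finite _).subset fun w hw => hw.1),
      Set.eq_empty_iff_forall_notMem]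
    rintro w ⟨hw, hr⟩
    match w, hw, hr with
    | [], hw, _ =>
      have := length_of_mem_wordsOf hw
      simp [hm] at this
    | y :: v, hw, hr =>
      obtain ⟨hy, hv⟩ := cons_mem_wordsOf_iff.1 hw
      have htd := totalDegree_sub_single hy
      have htd' : totalDegree (m - Pi.single y 1) = N := by omega
      rw [tailRotate, List.cons.injEq] at hr
      have h1 := hcop y hy _ fun i => dvd_of_rotate_eq hv (by omega) hr.2 i
      rw [htd', Nat.div_eq_iff_eq_mul_left (Nat.gcd_pos_of_pos_right _ hN)
        (Nat.gcd_dvd_right _ _), one_mul] at h1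
      have h2 := Nat.gcd_le_left N (Nat.pos_of_ne_zero hs0) (m := s)
      rw [mem_range] at hs
      omega
  · intro h
    exact absurd (mem_range.2 hN) h

end Counting

/-! ### Growth of binomial and multinomial coefficients -/

section Growth

open Finset

theorem add_le_choose {u v : ℕ} (hu : 1 ≤ u) (hv : 1 ≤ v) : u + v ≤ (u + v).choose u := by
  induction u, hu using Nat.le_induction with
  | base => rw [Nat.choose_one_right]
  | succ u hu ih =>
    have h1 : u + 1 + v = (u + v) + 1 := by ring
    have h2 : 0 < (u + v).choose (u + 1) := Nat.choose_pos (by omega)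
    rw [h1, Nat.choose_succ_succ, Nat.succ_eq_add_one]
    omega

/-- Three summands of the Vandermonde convolution: the central one and its two neighbours. -/
theorem three_terms_le_choose {u v t : ℕ} (hu : 1 ≤ u) (ht : 1 ≤ t) :
    (u + v).choose u * (t * (u + v)).choose (t * u) +
      (u + v).choose (u - 1) * (t * (u + v)).choose (t * u + 1) +
      (u + v).choose (u + 1) * (t * (u + v)).choose (t * u - 1) ≤
      ((t + 1) * (u + v)).choose ((t + 1) * u) := by
  have htu : 1 ≤ t * u := Nat.mul_pos ht hu
  have h1 : (t + 1) * (u + v) = (u + v) + t * (u + v) := by ring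
  have h2 : (t + 1) * u = u + t * u := by ring
  rw [h1, h2, Nat.add_choose_eq (u + v) (t * (u + v))]
  have hsub : ({(u, t * u), (u - 1, t * u + 1), (u + 1, t * u - 1)} : Finset (ℕ × ℕ)) ⊆
      antidiagonal (u + t * u) := by
    intro x hx
    simp only [mem_insert, mem_singleton] at hx
    rw [HasAntidiagonal.mem_antidiagonal]
    rcases hx with rfl | rfl | rfl <;> simp only <;> omega
  refine le_trans (le_of_eq ?_) (sum_le_sum_of_subset (f := fun ij : ℕ × ℕ =>
    (u + v).choose ij.1 * (t * (u + v)).choose ij.2) hsub)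
  rw [sum_insert, sum_insert, sum_singleton, add_assoc]
  · simp only [mem_singleton, Prod.mk.injEq]
    omega
  · simp only [mem_insert, mem_singleton, Prod.mk.injEq]
    omega

/-- Each neighbouring summand is at least `uv / ((u+1)(v+1))` times the central one, by the ratios
of consecutive binomial coefficients and `tu + 1 ≤ t(u + 1)`, `tv + 1 ≤ t(v + 1)`. Note that `1 +
2uv / ((u+1)(v+1))` has numerator `3uv + u + v + 1`. -/
theorem choose_growth_aux {u v t : ℕ} (hu : 1 ≤ u) (hv : 1 ≤ v) (ht : 1 ≤ t) :
    (u + v).choose u * (t * (u + v)).choose (t * u) * (3 * (u * v) + (u + v) + 1) ≤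
      (u + 1) * (v + 1) * ((t + 1) * (u + v)).choose ((t + 1) * u) := by
  have h := three_terms_le_choose (v := v) hu ht
  obtain ⟨u, rfl⟩ := Nat.exists_eq_add_of_le' hu
  have htu : 1 ≤ t * (u + 1) := Nat.mul_pos ht hu
  obtain ⟨r, hr⟩ := Nat.exists_eq_add_of_le' htu
  have e1 := Nat.choose_succ_right_eq (u + 1 + v) u
  have e2 := Nat.choose_succ_right_eq (u + 1 + v) (u + 1)
  have e3 := Nat.choose_succ_right_eq (t * (u + 1 + v)) (t * (u + 1))
  have e4 := Nat.choose_succ_right_eq (t * (u + 1 + v)) r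
  have s1 : u + 1 + v - u = v + 1 := by omega
  have s2 : u + 1 + v - (u + 1) = v := by omega
  have s3 : t * (u + 1 + v) - t * (u + 1) = t * v := by
    rw [← Nat.mul_sub, s2]
  have s4 : t * (u + 1 + v) - r = t * v + 1 := by
    have : t * (u + 1 + v) = t * (u + 1) + t * v := by ring
    omega
  rw [s1] at e1
  rw [s2] at e2
  rw [s3] at e3
  rw [s4, ← hr] at e4
  rw [hr, Nat.add_sub_cancel, Nat.add_sub_cancel, ← hr] at h
  set c := (u + 1 + v).choose (u + 1)
  set c1 := (u + 1 + v).choose u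
  set c2 := (u + 1 + v).choose (u + 1 + 1)
  set d := (t * (u + 1 + v)).choose (t * (u + 1))
  set d1 := (t * (u + 1 + v)).choose (t * (u + 1) + 1)
  set d2 := (t * (u + 1 + v)).choose r
  have hx : c * d * ((u + 1) * v) ≤ (u + 1 + 1) * (v + 1) * (c1 * d1) := by
    refine Nat.le_of_mul_le_mul_left ?_ (Nat.lt_of_lt_of_le Nat.zero_lt_one ht)
    calc t * (c * d * ((u + 1) * v)) = (c * (u + 1)) * (d * (t * v)) := by ring
      _ = (c1 * (v + 1)) * (d1 * (t * (u + 1) + 1)) := by rw [e1, e3]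
      _ ≤ (c1 * (v + 1)) * (d1 * (t * (u + 1) + t)) := by gcongr
      _ = t * ((u + 1 + 1) * (v + 1) * (c1 * d1)) := by ring
  have hy : c * d * ((u + 1) * v) ≤ (u + 1 + 1) * (v + 1) * (c2 * d2) := by
    refine Nat.le_of_mul_le_mul_left ?_ (Nat.lt_of_lt_of_le Nat.zero_lt_one ht)
    calc t * (c * d * ((u + 1) * v)) = (c * v) * (d * (t * (u + 1))) := by ring
      _ = (c2 * (u + 1 + 1)) * (d2 * (t * v + 1)) := by rw [← e2, e4]
      _ ≤ (c2 * (u + 1 + 1)) * (d2 * (t * v + t)) := by gcongr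
      _ = t * ((u + 1 + 1) * (v + 1) * (c2 * d2)) := by ring
  calc c * d * (3 * ((u + 1) * v) + (u + 1 + v) + 1)
      = (u + 1 + 1) * (v + 1) * (c * d) + c * d * ((u + 1) * v) + c * d * ((u + 1) * v) := by ring
    _ ≤ (u + 1 + 1) * (v + 1) * (c * d) + (u + 1 + 1) * (v + 1) * (c1 * d1) +
        (u + 1 + 1) * (v + 1) * (c2 * d2) := by gcongr
    _ = (u + 1 + 1) * (v + 1) * (c * d + c1 * d1 + c2 * d2) := by ring
    _ ≤ _ := Nat.mul_le_mul_left _ h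

/-- `C((t+1)(u+v), (t+1)u) ≥ (2(u+v)-1) C(t(u+v), tu)`. -/
theorem choose_growth {u v t : ℕ} (hu : 1 ≤ u) (hv : 1 ≤ v) (ht : 1 ≤ t) :
    (2 * (u + v) - 1) * (t * (u + v)).choose (t * u) ≤
      ((t + 1) * (u + v)).choose ((t + 1) * u) := by
  have h1 := choose_growth_aux hu hv ht
  have h2 := add_le_choose hu hv
  obtain ⟨u, rfl⟩ := Nat.exists_eq_add_of_le' hu
  obtain ⟨v, rfl⟩ := Nat.exists_eq_add_of_le' hv
  refine Nat.le_of_mul_le_mul_left ?_ (show 0 < (u + 1 + 1) * (v + 1 + 1) by positivity)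
  refine le_trans ?_ h1
  have h3 : 2 * (u + 1 + (v + 1)) - 1 = 2 * u + 2 * v + 3 := by omega
  rw [h3]
  set d := (t * (u + 1 + (v + 1))).choose (t * (u + 1))
  calc (u + 1 + 1) * (v + 1 + 1) * ((2 * u + 2 * v + 3) * d)
      = d * ((u + 2) * (v + 2) * (2 * u + 2 * v + 3)) := by ring
    _ ≤ d * ((u + 1 + (v + 1)) * (3 * ((u + 1) * (v + 1)) + (u + 1 + (v + 1)) + 1)) := by
        refine Nat.mul_le_mul_left _ ?_
        -- In the original variables the difference of the polynomial factors is `(u - 1)(v - 1)(u +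
        -- v + 1)`. It vanishes if `u = 1` or `v = 1`, and is positive for `u, v ≥ 2`, which is what
        -- `choose_growth_lt` uses.
        zify
        nlinarith [mul_nonneg (mul_nonneg (Nat.cast_nonneg (α := ℤ) u)
          (Nat.cast_nonneg (α := ℤ) v)) (by positivity : (0 : ℤ) ≤ u + v + 3)]
    _ = (u + 1 + (v + 1)) * d * (3 * ((u + 1) * (v + 1)) + (u + 1 + (v + 1)) + 1) := by ring
    _ ≤ _ := by gcongr

theorem choose_growth_lt {u v t : ℕ} (hu : 2 ≤ u) (hv : 2 ≤ v) (ht : 1 ≤ t) :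
    (2 * (u + v) - 1) * (t * (u + v)).choose (t * u) <
      ((t + 1) * (u + v)).choose ((t + 1) * u) := by
  have h1 := choose_growth_aux (by omega : 1 ≤ u) (by omega : 1 ≤ v) ht
  have h2 := add_le_choose (by omega : 1 ≤ u) (by omega : 1 ≤ v)
  have hd : 0 < (t * (u + v)).choose (t * u) :=
    Nat.choose_pos (Nat.mul_le_mul_left _ (Nat.le_add_right _ _))
  obtain ⟨u, rfl⟩ := Nat.exists_eq_add_of_le' hu
  obtain ⟨v, rfl⟩ := Nat.exists_eq_add_of_le' hv
  refine Nat.lt_of_mul_lt_mul_left (a := (u + 2 + 1) * (v + 2 + 1)) ?_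
  refine lt_of_lt_of_le ?_ h1
  have h3 : 2 * (u + 2 + (v + 2)) - 1 = 2 * u + 2 * v + 7 := by omega
  rw [h3]
  set d := (t * (u + 2 + (v + 2))).choose (t * (u + 2))
  calc (u + 2 + 1) * (v + 2 + 1) * ((2 * u + 2 * v + 7) * d)
      = d * ((u + 3) * (v + 3) * (2 * u + 2 * v + 7)) := by ring
    _ < d * ((u + 2 + (v + 2)) * (3 * ((u + 2) * (v + 2)) + (u + 2 + (v + 2)) + 1)) := by
        refine Nat.mul_lt_mul_of_pos_left ?_ hd
        zify
        nlinarith [mul_nonneg (mul_nonneg (Nat.cast_nonneg (α := ℤ) u)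
          (Nat.cast_nonneg (α := ℤ) v)) (by positivity : (0 : ℤ) ≤ u + v + 5),
          mul_nonneg (Nat.cast_nonneg (α := ℤ) u) (Nat.cast_nonneg (α := ℤ) v),
          sq_nonneg ((u : ℤ)), sq_nonneg ((v : ℤ))]
    _ = (u + 2 + (v + 2)) * d * (3 * ((u + 2) * (v + 2)) + (u + 2 + (v + 2)) + 1) := by ring
    _ ≤ _ := by gcongr

theorem choose_add_mono {x y x' y' : ℕ} (hx : x ≤ x') (hy : y ≤ y') :
    (x + y).choose x ≤ (x' + y').choose x' := by
  refine (Nat.choose_le_choose x (Nat.add_le_add_left hy x)).trans ?_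
  rw [Nat.choose_symm_add, Nat.choose_symm_add]
  exact Nat.choose_le_choose y' (Nat.add_le_add_right hx y')

variable {α : Type*} [DecidableEq α]

theorem multinomial_mono {s : Finset α} {f g : α → ℕ} (h : ∀ i, f i ≤ g i) :
    Nat.multinomial s f ≤ Nat.multinomial s g := by
  induction s using Finset.induction_on with
  | empty => simp
  | insert a s ha ih =>
    rw [Nat.multinomial_insert ha, Nat.multinomial_insert ha]
    exact Nat.mul_le_mul (choose_add_mono (h a) (sum_le_sum fun i _ => h i)) ih

theorem multinomial_smul_eq {s : Finset α} {i : α} (hi : i ∈ s) (b : α → ℕ) (t : ℕ) :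
    Nat.multinomial s (t • b) = (t * (b i + ∑ l ∈ s.erase i, b l)).choose (t * b i) *
      Nat.multinomial (s.erase i) (t • b) := by
  conv_lhs => rw [← insert_erase hi]
  rw [Nat.multinomial_insert (notMem_erase i s)]
  simp [mul_add, mul_sum]

/-- Splitting off the index `i` leaves a binomial coefficient, which supplies the whole factor, and
a multinomial coefficient, which does not decrease. -/
theorem multinomial_growth {s : Finset α} {i j : α} (hi : i ∈ s) (hj : j ∈ s) (hij : i ≠ j)
    {b : α → ℕ} (hbi : 1 ≤ b i) (hbj : 1 ≤ b j) {t : ℕ} (ht : 1 ≤ t) :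
    (2 * ∑ l ∈ s, b l - 1) * Nat.multinomial s (t • b) ≤ Nat.multinomial s ((t + 1) • b) := by
  have hv : 1 ≤ ∑ l ∈ s.erase i, b l :=
    hbj.trans (single_le_sum (f := b) (fun _ _ => Nat.zero_le _) (mem_erase.2 ⟨hij.symm, hj⟩))
  rw [multinomial_smul_eq hi, multinomial_smul_eq hi, ← add_sum_erase s b hi, ← mul_assoc]
  refine Nat.mul_le_mul (choose_growth hbi hv ht) (multinomial_mono fun l => ?_)
  exact Nat.mul_le_mul_right _ (Nat.le_succ t)

theorem multinomial_growth_lt_of_two {s : Finset α} {i : α} (hi : i ∈ s)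
    {b : α → ℕ} (hbi : 2 ≤ b i) (hb : 2 ≤ ∑ l ∈ s.erase i, b l) {t : ℕ} (ht : 1 ≤ t) :
    (2 * ∑ l ∈ s, b l - 1) * Nat.multinomial s (t • b) < Nat.multinomial s ((t + 1) • b) := by
  rw [multinomial_smul_eq hi, multinomial_smul_eq hi, ← add_sum_erase s b hi, ← mul_assoc]
  refine Nat.mul_lt_mul_of_lt_of_le (choose_growth_lt hbi hb ht) (multinomial_mono fun l => ?_)
    (Nat.multinomial_pos _ _)
  exact Nat.mul_le_mul_right _ (Nat.le_succ t)

/-- With a third index in the support the remaining multinomial coefficient also has at least two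
indices, hence grows strictly. -/
theorem multinomial_growth_lt_of_three {s : Finset α} {i j l : α} (hi : i ∈ s) (hj : j ∈ s)
    (hl : l ∈ s) (hij : i ≠ j) (hil : i ≠ l) (hjl : j ≠ l)
    {b : α → ℕ} (hbi : 1 ≤ b i) (hbj : 1 ≤ b j) (hbl : 1 ≤ b l) {t : ℕ} (ht : 1 ≤ t) :
    (2 * ∑ l ∈ s, b l - 1) * Nat.multinomial s (t • b) < Nat.multinomial s ((t + 1) • b) := by
  have hj' : j ∈ s.erase i := mem_erase.2 ⟨hij.symm, hj⟩
  have hl' : l ∈ s.erase i := mem_erase.2 ⟨hil.symm, hl⟩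
  have hv : b j + b l ≤ ∑ l ∈ s.erase i, b l := by
    rw [← sum_pair hjl]
    exact sum_le_sum_of_subset (by
      intro x hx
      rcases mem_insert.1 hx with rfl | hx
      · exact hj'
      · rw [mem_singleton.1 hx]
        exact hl')
  have h := multinomial_growth hj' hl' hjl hbj hbl ht
  have hpos := Nat.multinomial_pos (s.erase i) (t • b)
  rw [multinomial_smul_eq hi, multinomial_smul_eq hi, ← add_sum_erase s b hi, ← mul_assoc]
  refine Nat.mul_lt_mul_of_le_of_lt (choose_growth hbi (by omega) ht) ?_ ?_
  · refine lt_of_lt_of_le ?_ h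
    refine lt_of_eq_of_lt (one_mul _).symm (Nat.mul_lt_mul_of_pos_right ?_ hpos)
    omega
  · exact Nat.choose_pos (Nat.mul_le_mul_left _ (Nat.le_add_right _ _))

theorem multinomial_pair [Fintype α] {i j : α} (hij : i ≠ j) (c d : ℕ) :
    Nat.multinomial univ (Pi.single i c + Pi.single j d) = (c + d).choose c := by
  have := Nat.multinomial_congr_of_sdiff (s := {i, j}) (t := univ)
    (f := (Pi.single i c + Pi.single j d : α → ℕ)) (g := Pi.single i c + Pi.single j d)
    (subset_univ _) (fun a ha => ?_) (fun _ _ => rfl)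
  · rw [← this, Nat.binomial_eq_choose hij]
    simp [hij, hij.symm]
  · simp only [mem_sdiff, mem_univ, true_and, mem_insert, mem_singleton, not_or] at ha
    simp [ha.1, ha.2]

/-- The numerical estimate behind the comparison of the numbers of necklaces. -/
theorem sum_gcd_lt {f : ℕ → ℕ} {B g : ℕ} (hB : 2 ≤ B) (hg : 1 ≤ g) (hf1 : 1 ≤ f 1)
    (hf : ∀ t, 1 ≤ t → (2 * B - 1) * f t ≤ f (t + 1)) (h2 : g = 2 → (2 * B - 1) * f 1 < f 2)
    (h3 : B = 2 → g ≠ 3) (h4 : B = 2 → g ≠ 4) :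
    g * B * ∑ j ∈ Ico 1 g, f (j.gcd g) < f g + ∑ j ∈ Ico 1 g, f (j.gcd g) := by
  obtain ⟨β, rfl⟩ := Nat.exists_eq_add_of_le' hB
  have hρ : 2 * (β + 2) - 1 = 2 * β + 3 := by omega
  rw [hρ] at hf h2
  have hmono : ∀ s t, 1 ≤ s → s ≤ t → f s ≤ f t := by
    intro s t hs hst
    induction t, hst using Nat.le_induction with
    | base => exact le_rfl
    | succ t hst ih =>
      refine ih.trans (le_trans ?_ (hf t (hs.trans hst)))
      exact Nat.le_mul_of_pos_left _ (by omega)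
  have hpow : ∀ h s, 1 ≤ h → (2 * β + 3) ^ s * f h ≤ f (h + s) := by
    intro h s hh
    induction s with
    | zero => simp
    | succ s ih =>
      calc (2 * β + 3) ^ (s + 1) * f h = (2 * β + 3) * ((2 * β + 3) ^ s * f h) := by ring
        _ ≤ (2 * β + 3) * f (h + s) := Nat.mul_le_mul_left _ ih
        _ ≤ f (h + (s + 1)) := hf _ (by omega)
  have hG : ∀ h, 1 ≤ h → 2 * ∑ j ∈ Ico 1 (h + 1), f j + f 1 ≤ 3 * f h := by
    intro h hh
    induction h, hh using Nat.le_induction with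
    | base => simp; omega
    | succ h hh ih =>
      rw [sum_Ico_succ_top (by omega)]
      have := hf h hh
      have h3 : 3 * f h ≤ (2 * β + 3) * f h := Nat.mul_le_mul_right _ (by omega)
      omega
  have hS1 : ∀ h, ∑ j ∈ Ico 1 (h + 1), f (j.gcd g) ≤ ∑ j ∈ Ico 1 (h + 1), f j := by
    intro h
    refine sum_le_sum fun j hj => ?_
    have hj1 := (mem_Ico.1 hj).1
    exact hmono _ _ (Nat.gcd_pos_of_pos_left _ hj1) (Nat.gcd_le_left _ hj1)
  -- Beyond the middle, `gcd(j, g)` is bounded by `g - j`, which it divides. This reflects the upper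
  -- half of the sum onto the lower half.
  have hS2 : ∀ h, ∑ j ∈ Ico (h + 1) g, f (j.gcd g) ≤ ∑ j ∈ Ico 1 (g - h), f j := by
    intro h
    have := sum_Ico_reflect f (h + 1) (m := g) (n := g) (by omega)
    rw [show g + 1 - g = 1 by omega, show g + 1 - (h + 1) = g - h by omega] at this
    rw [← this]
    refine sum_le_sum fun j hj => ?_
    have hj1 := mem_Ico.1 hj
    have hpos : 0 < g - j := by omega
    refine hmono _ _ (Nat.gcd_pos_of_pos_left _ (by omega)) ?_
    have : j.gcd g ∣ g - j := Nat.dvd_sub (Nat.gcd_dvd_right _ _) (Nat.gcd_dvd_left _ _)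
    exact Nat.le_of_dvd hpos this
  have hsplit : ∀ h, h < g → ∑ j ∈ Ico 1 g, f (j.gcd g) =
      ∑ j ∈ Ico 1 (h + 1), f (j.gcd g) + ∑ j ∈ Ico (h + 1) g, f (j.gcd g) := by
    intro h hh
    exact (sum_Ico_consecutive _ (by omega) (by omega)).symm
  -- A bound `S < C f(h)` with `h + e = g` suffices once `(gB - 1) C ≤ (2B - 1)^e`. For `g = 2h` the
  -- constant is `C = 2`, and for `g = 2h + 1` it is `C = 3`.
  have finish : ∀ h e C, 1 ≤ h → h + e = g → ∑ j ∈ Ico 1 g, f (j.gcd g) < C * f h →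
      (g * (β + 2)) * C ≤ (2 * β + 3) ^ e + C →
      g * (β + 2) * ∑ j ∈ Ico 1 g, f (j.gcd g) < f g + ∑ j ∈ Ico 1 g, f (j.gcd g) := by
    intro h e C hh hhe hS hC
    have hp := hpow h e hh
    rw [hhe] at hp
    set S := ∑ j ∈ Ico 1 g, f (j.gcd g)
    obtain ⟨l, hl⟩ : ∃ l, g * (β + 2) = l + 1 := Nat.exists_eq_succ_of_ne_zero (by positivity)
    have hlpos : 0 < l := by nlinarith
    rw [hl] at hC ⊢
    have hC' : l * C ≤ (2 * β + 3) ^ e := by linarith [Nat.succ_mul l C]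
    have h1 : l * S < l * (C * f h) := Nat.mul_lt_mul_of_pos_left hS hlpos
    have h2 : l * (C * f h) ≤ (2 * β + 3) ^ e * f h := by
      rw [← mul_assoc]
      exact Nat.mul_le_mul_right _ hC'
    linarith [Nat.succ_mul l S]
  rcases Nat.even_or_odd' g with ⟨h, rfl | rfl⟩
  · have hh : 1 ≤ h := by omega
    rcases Nat.eq_or_lt_of_le hh with rfl | hh2
    · have := h2 rfl
      simp
      linarith
    · refine finish h h 2 hh (by omega) ?_ ?_
      · have e1 := hS1 h
        have e2 := hS2 h
        have e3 := hG h hh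
        rw [hsplit h (by omega)]
        rw [show 2 * h - h = h by omega] at e2
        rw [sum_Ico_succ_top (by omega)] at e1 e3
        rw [sum_Ico_succ_top (by omega : 1 ≤ h)]
        rw [sum_Ico_succ_top (by omega : 1 ≤ h)] at e1
        omega
      · have key : ∀ h, 3 ≤ h → 2 * h * (β + 2) * 2 ≤ (2 * β + 3) ^ h + 2 := by
          intro h hh
          induction h, hh using Nat.le_induction with
          | base => nlinarith [sq_nonneg β]
          | succ h hh ih =>
            rw [pow_succ]
            nlinarith [Nat.zero_le (β * (2 * β + 3) ^ h)]
        -- For `g = 4` the required inequality `16 + 8β ≤ (2β + 3)^2 + 2` fails only at `β = 0`,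
        -- that is `B = 2`.
        rcases Nat.eq_or_lt_of_le hh2 with rfl | hh3
        · have : β ≠ 0 := by
            rintro rfl
            exact h4 rfl rfl
          have : 1 ≤ β := Nat.one_le_iff_ne_zero.2 this
          nlinarith
        · exact key h hh3
  · rcases Nat.eq_zero_or_pos h with rfl | hh
    · simp
      omega
    · refine finish h (h + 1) 3 hh (by omega) ?_ ?_
      · have e1 := hS1 h
        have e2 := hS2 h
        have e3 := hG h hh
        rw [hsplit h (by omega)]
        rw [show 2 * h + 1 - h = h + 1 by omega] at e2
        omega
      · have key : ∀ h, 2 ≤ h → (2 * h + 1) * (β + 2) * 3 ≤ (2 * β + 3) ^ (h + 1) + 3 := by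
          intro h hh
          induction h, hh using Nat.le_induction with
          | base =>
            have : (2 * β + 3) ^ (2 + 1) + 3 = 8 * β ^ 3 + 36 * β ^ 2 + 54 * β + 30 := by ring
            rw [this]
            nlinarith [Nat.zero_le (β ^ 3), Nat.zero_le (β ^ 2)]
          | succ h hh ih =>
            rw [pow_succ]
            nlinarith [Nat.zero_le (β * (2 * β + 3) ^ (h + 1))]
        -- For `g = 3` the required inequality `9(β + 2) ≤ (2β + 3)^2 + 3` again fails only at `B =
        -- 2`.
        rcases Nat.eq_or_lt_of_le hh with rfl | hh2
        · have : β ≠ 0 := by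
            rintro rfl
            exact h3 rfl rfl
          obtain ⟨γ, rfl⟩ := Nat.exists_eq_succ_of_ne_zero this
          have : (2 * (γ + 1) + 3) ^ (1 + 1) + 3 = 4 * γ ^ 2 + 20 * γ + 28 := by ring
          simp only [Nat.succ_eq_add_one, zero_add]
          rw [this]
          nlinarith [Nat.zero_le (γ ^ 2)]
        · exact key h hh2

end Growth

/-! ### Comparison of the two dimensions, and freeness of the Nichols algebra -/

section Comparison

open Finset

variable {n : ℕ}

/-- The exceptional degrees which are supported on two indices. -/
def IsExceptionalPair (m : Fin n → ℕ) : Prop :=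
  (∃ i j : Fin n, i ≠ j ∧ ∃ c : ℕ, 1 ≤ c ∧ m = Pi.single i 2 + Pi.single j (2 * c)) ∨
  (∃ i j : Fin n, i ≠ j ∧
    (m = Pi.single i 3 + Pi.single j 3 ∨ m = Pi.single i 4 + Pi.single j 4))

theorem smul_pair (t c d : ℕ) (i j : Fin n) :
    t • (Pi.single i c + Pi.single j d : Fin n → ℕ) =
      Pi.single i (t * c) + Pi.single j (t * d) := by
  ext l
  simp [Pi.single_apply, mul_add]

theorem totalDegree_pair (i j : Fin n) (c d : ℕ) :
    totalDegree (Pi.single i c + Pi.single j d : Fin n → ℕ) = c + d := by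
  simp [totalDegree, sum_add_distrib]

theorem eq_pair_of_forall {b : Fin n → ℕ} {i j : Fin n} (hij : i ≠ j)
    (h : ∀ l, l ≠ i → l ≠ j → b l = 0) : b = Pi.single i (b i) + Pi.single j (b j) := by
  ext l
  by_cases hi : l = i
  · subst hi
    simp [hij]
  · by_cases hj : l = j
    · subst hj
      simp [hi]
    · simp [hi, hj, h l hi hj]

/-- Equality at `t = 1` would require support on two indices with one coefficient of `b` equal to 1,
and then `2b` has the form `2 e_i + 2c e_j`. -/
theorem growth_lt_of_not_exceptional {b : Fin n → ℕ} {i j : Fin n} (hij : i ≠ j) (hi : 1 ≤ b i)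
    (hj : 1 ≤ b j) (hex : ¬ IsExceptionalPair (2 • b)) :
    (2 * totalDegree b - 1) * Nat.multinomial univ (1 • b) < Nat.multinomial univ (2 • b) := by
  by_cases h : ∃ l, l ≠ i ∧ l ≠ j ∧ 1 ≤ b l
  · obtain ⟨l, hli, hlj, hl⟩ := h
    exact multinomial_growth_lt_of_three (mem_univ i) (mem_univ j) (mem_univ l) hij hli.symm
      hlj.symm hi hj hl le_rfl
  · have hb := eq_pair_of_forall hij (b := b) fun l hli hlj => by
      by_contra h0
      exact h ⟨l, hli, hlj, Nat.one_le_iff_ne_zero.2 h0⟩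
    have hi2 : 2 ≤ b i := by
      by_contra hlt
      have h1 : b i = 1 := by omega
      refine hex (Or.inl ⟨i, j, hij, b j, hj, ?_⟩)
      conv_lhs => rw [hb, smul_pair, h1]
    have hj2 : 2 ≤ b j := by
      by_contra hlt
      have h1 : b j = 1 := by omega
      refine hex (Or.inl ⟨j, i, hij.symm, b i, hi, ?_⟩)
      conv_lhs => rw [hb, smul_pair, h1, add_comm]
    exact multinomial_growth_lt_of_two (mem_univ i) hi2 (hj2.trans
      (single_le_sum (f := b) (fun _ _ => Nat.zero_le _)
        (mem_erase.2 ⟨hij.symm, mem_univ j⟩))) le_rfl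

theorem eq_pair_of_totalDegree_two {b : Fin n → ℕ} {i j : Fin n} (hij : i ≠ j) (hi : 1 ≤ b i)
    (hj : 1 ≤ b j) (hb : totalDegree b = 2) : b = Pi.single i 1 + Pi.single j 1 := by
  have hle : ∀ s : Finset (Fin n), ∑ l ∈ s, b l ≤ 2 := fun s =>
    hb ▸ sum_le_sum_of_subset (subset_univ s)
  have h2 := hle {i, j}
  rw [sum_pair hij] at h2
  have h := eq_pair_of_forall hij (b := b) fun l hli hlj => by
    have h3 := hle {l, i, j}
    rw [sum_insert (by simp [hli, hlj]), sum_pair hij] at h3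
    omega
  rw [h, show b i = 1 by omega, show b j = 1 by omega]

theorem sum_range_gcd (f : ℕ → ℕ) {g : ℕ} (hg : 0 < g) :
    ∑ j ∈ range g, f (j.gcd g) = f g + ∑ j ∈ Ico 1 g, f (j.gcd g) := by
  rw [range_eq_Ico, sum_eq_sum_Ico_succ_bot hg, Nat.gcd_zero_left]

theorem exists_coprime_smul {m : Fin n → ℕ} (hm : 0 < totalDegree m) :
    ∃ g b, 0 < g ∧ m = g • b ∧ 0 < totalDegree b ∧ ∀ d, (∀ i, d ∣ b i) → d = 1 := by
  have hne : (univ : Finset (Fin n)).Nonempty := by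
    by_contra h
    rw [not_nonempty_iff_eq_empty] at h
    rw [totalDegree, h, sum_empty] at hm
    exact lt_irrefl _ hm
  obtain ⟨b, hb, hb1⟩ := Finset.extract_gcd m hne
  have hmb : m = univ.gcd m • b := funext fun i => hb i (mem_univ i)
  have hdeg : totalDegree m = univ.gcd m * totalDegree b := by
    conv_lhs => rw [hmb, totalDegree_smul]
  rw [hdeg] at hm
  refine ⟨univ.gcd m, b, Nat.pos_of_mul_pos_right hm, hmb, Nat.pos_of_mul_pos_left hm,
    fun d hd => ?_⟩
  have := Finset.dvd_gcd (s := univ) (f := b) fun i _ => hd i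
  rw [hb1] at this
  exact Nat.dvd_one.1 this

variable {k : Type*} [Field k] {q : k}

/-- Write `m = g b` with `b` primitive, `T` for the number of words and `S` for the Burnside
contribution of nontrivial rotations. If both dimensions were `r`, then `|m| r = T + S` and `(|m| -
1) r ≥ T` would give `r ≤ S`, so `T + S ≤ |m| S`, against `sum_gcd_lt`. -/
theorem finrank_ne_of_not_exceptional (hq0 : q ≠ 0) (hq : ∀ N : ℕ, 0 < N → q ^ N ≠ 1)
    (a : Matrix (Fin n) (Fin n) ℤ) {m : Fin n → ℕ} {i j : Fin n} (hij : i ≠ j) (hi : m i ≠ 0)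
    (hj : m j ≠ 0) (hex : ¬ IsExceptionalPair m) (hKm : quadForm a m = linForm a m) {N : ℕ}
    (hN : 0 < N) (hm : totalDegree m = N + 1) :
    Module.finrank k ↥(component k m ⊓ LinearMap.ker (LinearMap.id - rot (powerMatrix q a))) ≠
      Module.finrank k
        ↥(component k m ⊓ LinearMap.ker (LinearMap.id - rotTail (powerMatrix q a))) := by
  have h1 := finrank_rot hq0 hq a m (by omega) hKm
  have h2 := finrank_rotTail hq0 hq a m hN hm hKm
  have h3 := ncard_le_sum_tailRotate (m := m) hN
  obtain ⟨g, b, hg, rfl, hb, hcop⟩ := exists_coprime_smul (m := m) (by omega)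
  have hbi : 1 ≤ b i := Nat.one_le_iff_ne_zero.2 fun h => hi (by simp [h])
  have hbj : 1 ≤ b j := Nat.one_le_iff_ne_zero.2 fun h => hj (by simp [h])
  rw [sum_ncard_rotate_fixed hg hb hcop] at h1
  simp only [ncard_wordsOf] at h1 h3
  rw [sum_range_gcd (fun t => Nat.multinomial univ (t • b)) hg] at h1
  have hB : 2 ≤ totalDegree b := by
    have : ∑ l ∈ {i, j}, b l ≤ totalDegree b := sum_le_sum_of_subset (subset_univ _)
    rw [sum_pair hij] at this
    omega
  have key := sum_gcd_lt (f := fun t => Nat.multinomial univ (t • b)) hB hg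
    (Nat.multinomial_pos _ _)
    (fun t ht => multinomial_growth (mem_univ i) (mem_univ j) hij hbi hbj ht)
    (by
      rintro rfl
      exact growth_lt_of_not_exceptional hij hbi hbj hex)
    (by
      rintro hB2 rfl
      have := eq_pair_of_totalDegree_two hij hbi hbj hB2
      subst this
      exact hex (Or.inr ⟨i, j, hij, Or.inl (smul_pair _ _ _ _ _)⟩))
    (by
      rintro hB2 rfl
      have := eq_pair_of_totalDegree_two hij hbi hbj hB2
      subst this
      exact hex (Or.inr ⟨i, j, hij, Or.inr (smul_pair _ _ _ _ _)⟩))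
  rw [← totalDegree_smul] at key
  rw [← h2] at h3
  intro heq
  rw [← heq] at h3
  rw [hm] at h1 key
  set r := Module.finrank k
    ↥(component k (g • b) ⊓ LinearMap.ker (LinearMap.id - rot (powerMatrix q a)))
  set S := ∑ j ∈ Ico 1 g, Nat.multinomial univ (j.gcd g • b)
  have hr : r ≤ S := by linarith [Nat.succ_mul N r]
  have := Nat.mul_le_mul_left (N + 1) hr
  omega

/-- The hypothesis `hsum` reads `|m| S = T + S`, so the first dimension is `S`. The coprimality
assumptions exclude fixed words of nontrivial tail rotations, so the second is `T / (|m| - 1)`,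
which is `S` again. -/
theorem finrank_eq_of_sum_eq (hq0 : q ≠ 0) (hq : ∀ N : ℕ, 0 < N → q ^ N ≠ 1)
    (a : Matrix (Fin n) (Fin n) ℤ) {i j : Fin n} (hij : i ≠ j) {g d e : ℕ} (hg : 0 < g)
    (hcop : Nat.Coprime d e) (hd : 0 < d) (he : 0 < e)
    (hcop1 : Nat.Coprime (g * d - 1) (g * e)) (hcop2 : Nat.Coprime (g * d) (g * e - 1))
    (hsum : (g * d + g * e) * ∑ l ∈ Ico 1 g, (l.gcd g * d + l.gcd g * e).choose (l.gcd g * d) =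
      (g * d + g * e).choose (g * d) +
        ∑ l ∈ Ico 1 g, (l.gcd g * d + l.gcd g * e).choose (l.gcd g * d))
    {m : Fin n → ℕ} (hm : m = Pi.single i (g * d) + Pi.single j (g * e))
    (hKm : quadForm a m = linForm a m) :
    Module.finrank k ↥(component k m ⊓ LinearMap.ker (LinearMap.id - rot (powerMatrix q a))) =
      Module.finrank k
        ↥(component k m ⊓ LinearMap.ker (LinearMap.id - rotTail (powerMatrix q a))) := by
  have hgd : 0 < g * d := Nat.mul_pos hg hd
  have hge : 0 < g * e := Nat.mul_pos hg he
  have hdeg : totalDegree m = g * d + g * e := by rw [hm, totalDegree_pair]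
  obtain ⟨N, hN⟩ : ∃ N, totalDegree m = N + 1 :=
    Nat.exists_eq_succ_of_ne_zero (by omega)
  have hNpos : 0 < N := by omega
  have h1 := finrank_rot hq0 hq a m (by omega) hKm
  have h2 := finrank_rotTail hq0 hq a m hNpos hN hKm
  have hmi : m i = g * d := by simp [hm, hij]
  have hmj : m j = g * e := by simp [hm, hij.symm]
  rw [sum_tailRotate_eq hNpos hN] at h2
  · have hmb : m = g • (Pi.single i d + Pi.single j e) := by rw [hm, smul_pair]
    rw [hmb, sum_ncard_rotate_fixed hg (by rw [totalDegree_pair]; omega)] at h1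
    · simp only [ncard_wordsOf] at h1 h2
      have hgcd := sum_range_gcd (fun t : ℕ => Nat.multinomial univ
        (t • (Pi.single i d + Pi.single j e : Fin n → ℕ))) hg
      rw [hgcd] at h1
      simp only [smul_pair, multinomial_pair hij] at h1
      rw [← hm, ← hmb] at h1
      conv_rhs at h2 => rw [hm, multinomial_pair hij]
      rw [hdeg] at hN
      rw [hdeg, ← hsum] at h1
      have hr := Nat.eq_of_mul_eq_mul_left (by omega) h1
      rw [hN] at hsum h2
      rw [hr]
      refine (Nat.eq_of_mul_eq_mul_left hNpos ?_).symm
      rw [h2]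
      linarith [Nat.succ_mul N
        (∑ l ∈ Ico 1 g, (l.gcd g * d + l.gcd g * e).choose (l.gcd g * d))]
    · intro t ht
      have hti := ht i
      have htj := ht j
      simp only [Pi.add_apply, Pi.single_eq_same, Pi.single_eq_of_ne hij,
        Pi.single_eq_of_ne hij.symm, add_zero, zero_add] at hti htj
      exact Nat.eq_one_of_dvd_coprimes hcop hti htj
  · intro y hy t ht
    have hti := ht i
    have htj := ht j
    simp only [Pi.sub_apply, hmi, hmj] at hti htj
    by_cases hyi : y = i
    · subst hyi
      rw [Pi.single_eq_same] at hti
      rw [Pi.single_eq_of_ne hij.symm] at htj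
      exact Nat.eq_one_of_dvd_coprimes hcop1 hti htj
    · by_cases hyj : y = j
      · subst hyj
        rw [Pi.single_eq_same] at htj
        rw [Pi.single_eq_of_ne hij] at hti
        exact Nat.eq_one_of_dvd_coprimes hcop2 hti htj
      · exact absurd (by simp [hm, hyi, hyj]) hy

theorem finrank_eq_of_exceptional (hq0 : q ≠ 0) (hq : ∀ N : ℕ, 0 < N → q ^ N ≠ 1)
    (a : Matrix (Fin n) (Fin n) ℤ) {m : Fin n → ℕ} (hex : IsExceptionalPair m)
    (hKm : quadForm a m = linForm a m) :
    Module.finrank k ↥(component k m ⊓ LinearMap.ker (LinearMap.id - rot (powerMatrix q a))) =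
      Module.finrank k
        ↥(component k m ⊓ LinearMap.ker (LinearMap.id - rotTail (powerMatrix q a))) := by
  rcases hex with ⟨i, j, hij, c, hc, hm⟩ | ⟨i, j, hij, hm | hm⟩
  · refine finrank_eq_of_sum_eq hq0 hq a hij (g := 2) (d := 1) (e := c) (by norm_num)
      (Nat.coprime_one_left c) (by norm_num) hc (by simp) ?_ ?_ hm hKm
    · have : Odd (2 * c - 1) := ⟨c - 1, by omega⟩
      simpa using this.coprime_two_left
    · have h1 : (2 * 1 + 2 * c).choose (2 * 1) = (c + 1) * (2 * c + 1) := by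
        rw [mul_one, Nat.choose_two_right]
        refine Nat.div_eq_of_eq_mul_left (by norm_num) ?_
        have : 2 + 2 * c - 1 = 2 * c + 1 := by omega
        rw [this]
        ring
      rw [h1]
      simp
      ring
  · exact finrank_eq_of_sum_eq hq0 hq a hij (g := 3) (d := 1) (e := 1) (by norm_num) (by norm_num)
      (by norm_num) (by norm_num) (by norm_num) (by norm_num) (by decide) hm hKm
  · exact finrank_eq_of_sum_eq hq0 hq a hij (g := 4) (d := 1) (e := 1) (by norm_num) (by norm_num)
      (by norm_num) (by norm_num) (by norm_num) (by norm_num) (by decide) hm hKm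

/-- The values 2, 6 and 12 of `m_i (m_i - 1)` are invertible away from characteristics 2 and 3. This
is what the deformation argument needs. -/
theorem exists_mul_pred_ne_zero (h2 : (2 : k) ≠ 0) (h3 : (3 : k) ≠ 0) {m : Fin n → ℕ}
    (hex : IsExceptionalPair m) : ∃ i, ((m i * (m i - 1) : ℕ) : k) ≠ 0 := by
  rcases hex with ⟨i, j, hij, c, hc, rfl⟩ | ⟨i, j, hij, rfl | rfl⟩
  · exact ⟨i, by simpa [hij] using h2⟩
  · refine ⟨i, ?_⟩
    have : (6 : k) ≠ 0 := (by norm_num : (6 : k) = 3 * 2) ▸ mul_ne_zero h3 h2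
    simpa [hij] using this
  · refine ⟨i, ?_⟩
    have : (12 : k) ≠ 0 :=
      (by norm_num : (12 : k) = 2 * 2 * 3) ▸ mul_ne_zero (mul_ne_zero h2 h2) h3
    simpa [hij] using this

theorem single_or_pair {m : Fin n → ℕ} (hm : 0 < totalDegree m) :
    (∃ i, m = Pi.single i (m i)) ∨ ∃ i j, i ≠ j ∧ m i ≠ 0 ∧ m j ≠ 0 := by
  obtain ⟨i, -, hi⟩ : ∃ i ∈ univ, m i ≠ 0 := exists_ne_zero_of_sum_ne_zero hm.ne'
  by_cases h : ∃ j, i ≠ j ∧ m j ≠ 0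
  · obtain ⟨j, hij, hj⟩ := h
    exact Or.inr ⟨i, j, hij, hi, hj⟩
  · refine Or.inl ⟨i, ?_⟩
    ext l
    by_cases hl : l = i
    · subst hl
      simp
    · rw [Pi.single_eq_of_ne hl]
      by_contra h0
      exact h ⟨l, Ne.symm hl, h0⟩

theorem not_single_of_pair {m : Fin n → ℕ} {i j : Fin n} (hij : i ≠ j) (hi : m i ≠ 0)
    (hj : m j ≠ 0) (l : Fin n) (c : ℕ) : m ≠ Pi.single l c := by
  rintro rfl
  by_cases hil : i = l
  · subst hil
    simp [hij.symm] at hj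
  · simp [hil] at hi

theorem not_exceptionalPair_single (i : Fin n) (c : ℕ) :
    ¬ IsExceptionalPair (Pi.single i c : Fin n → ℕ) := by
  have h : ∀ (l j : Fin n) (d e : ℕ), l ≠ j → d ≠ 0 → e ≠ 0 →
      (Pi.single i c : Fin n → ℕ) ≠ Pi.single l d + Pi.single j e := by
    intro l j d e hlj hd he h
    exact not_single_of_pair hlj (m := Pi.single l d + Pi.single j e) (by simp [hlj, hd])
      (by simp [hlj.symm, he]) i c h.symm
  rintro (⟨l, j, hlj, d, hd, e⟩ | ⟨l, j, hlj, e | e⟩)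
  · exact h l j _ _ hlj (by norm_num) (by omega) e
  · exact h l j _ _ hlj (by norm_num) (by norm_num) e
  · exact h l j _ _ hlj (by norm_num) (by norm_num) e

/-- For `t = q^e ≠ 1` one has `(c)_t (t - 1) = t^c - 1 ≠ 0`, while `(c)_1 = c`. -/
theorem qNumber_zpow_eq_zero_iff (hq : ∀ N : ℕ, 0 < N → q ^ N ≠ 1) {c : ℕ} (hc : 0 < c)
    (e : ℤ) : qNumber c (q ^ e) = 0 ↔ e = 0 ∧ (c : k) = 0 := by
  by_cases he : e = 0
  · simp [he, qNumber]
  · simp only [he, false_and, iff_false]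
    intro h
    have h1 := geom_sum_mul (q ^ e) c
    rw [qNumber] at h
    rw [h, zero_mul, eq_comm, sub_eq_zero, ← zpow_natCast, ← zpow_mul,
      zpow_eq_one_iff_of_not_root hq] at h1
    have : (c : ℤ) ≠ 0 := by exact_mod_cast hc.ne'
    exact (mul_ne_zero he this) h1

theorem quadForm_single (a : Matrix (Fin n) (Fin n) ℤ) (i : Fin n) (c : ℕ) :
    quadForm a (Pi.single i c) = a i i * c * c := by
  simp [quadForm, Pi.single_apply]

theorem linForm_single (a : Matrix (Fin n) (Fin n) ℤ) (i : Fin n) (c : ℕ) :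
    linForm a (Pi.single i c) = a i i * c := by
  simp [linForm, Pi.single_apply]

theorem isExceptional_iff (a : Matrix (Fin n) (Fin n) ℤ) (m : Fin n → ℕ) :
    IsExceptional k a m ↔ (∃ i : Fin n, ∃ c : ℕ, 2 ≤ c ∧ (a i i ≠ 0 ∨ (c : k) ≠ 0) ∧
      m = Pi.single i c) ∨ IsExceptionalPair m := Iff.rfl

theorem isExceptional_single_iff (a : Matrix (Fin n) (Fin n) ℤ) {i : Fin n} {c : ℕ} (hc : 2 ≤ c) :
    IsExceptional k a (Pi.single i c) ↔ (a i i ≠ 0 ∨ (c : k) ≠ 0) := by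
  rw [isExceptional_iff]
  constructor
  · rintro (⟨l, d, hd, h, e⟩ | h)
    · have hli : i = l := by
        by_contra hne
        have := congrFun e i
        simp [hne] at this
        omega
      subst hli
      have := congrFun e i
      simp only [Pi.single_eq_same] at this
      subst this
      exact h
    · exact absurd h (not_exceptionalPair_single i c)
  · exact fun h => Or.inl ⟨i, c, hc, h, rfl⟩

theorem isExceptional_iff_pair (a : Matrix (Fin n) (Fin n) ℤ) {m : Fin n → ℕ} {i j : Fin n}
    (hij : i ≠ j) (hi : m i ≠ 0) (hj : m j ≠ 0) :
    IsExceptional k a m ↔ IsExceptionalPair m := by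
  rw [isExceptional_iff, or_iff_right]
  rintro ⟨l, c, -, -, h⟩
  exact not_single_of_pair hij hi hj l c h

theorem injectiveAt_of_exceptional_or_ne (h2 : (2 : k) ≠ 0) (h3 : (3 : k) ≠ 0) (hq0 : q ≠ 0)
    (hq : ∀ N : ℕ, 0 < N → q ^ N ≠ 1) (a : Matrix (Fin n) (Fin n) ℤ) {m : Fin n → ℕ}
    (hm : 2 ≤ totalDegree m)
    (hlow : ∀ m', totalDegree m' + 1 = totalDegree m → InjectiveAt (powerMatrix q a) m')
    (h : IsExceptional k a m ∨ quadForm a m ≠ linForm a m) :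
    InjectiveAt (powerMatrix q a) m := by
  obtain ⟨N, hN⟩ : ∃ N, totalDegree m = N + 1 := Nat.exists_eq_succ_of_ne_zero (by omega)
  by_cases hKm : quadForm a m = linForm a m
  · have hex := h.resolve_right (not_not.2 hKm)
    rcases single_or_pair (m := m) (by omega) with ⟨i, hi⟩ | ⟨i, j, hij, hi, hj⟩
    · have hc : 2 ≤ m i := by
        have : totalDegree m = m i := by
          conv_lhs => rw [hi]
          simp [totalDegree]
        omega
      rw [hi, isExceptional_single_iff a hc] at hex
      rw [hi, injectiveAt_single_iff]
      intro h0
      have := (qNumber_zpow_eq_zero_iff hq (by omega) (a i i)).1 h0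
      exact hex.elim (fun h => h this.1) fun h => h this.2
    · rw [isExceptional_iff_pair a hij hi hj] at hex
      obtain ⟨l, hl⟩ := exists_mul_pred_ne_zero h2 h3 hex
      refine injectiveAt_of_finrank_eq _ hlow hN (fun w hw => ?_)
        (finrank_eq_of_exceptional hq0 hq a hex hKm) l hl
      rw [monodromy_powerMatrix hq0 a hw, hKm, sub_self, zpow_zero]
  · refine injectiveAt_of_monodromy_ne_one _ hlow hN
      (fun w hw => monodromy_powerMatrix hq0 a hw) ?_
    rw [Ne, zpow_eq_one_iff_of_not_root hq, sub_eq_zero]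
    exact hKm

theorem not_injectiveAt_of_eq (hq0 : q ≠ 0) (hq : ∀ N : ℕ, 0 < N → q ^ N ≠ 1)
    (a : Matrix (Fin n) (Fin n) ℤ) {m : Fin n → ℕ} (hm : 2 ≤ totalDegree m)
    (hlow : ∀ m', totalDegree m' + 1 = totalDegree m → InjectiveAt (powerMatrix q a) m')
    (hex : ¬ IsExceptional k a m) (hKm : quadForm a m = linForm a m) :
    ¬ InjectiveAt (powerMatrix q a) m := by
  obtain ⟨N, hN⟩ : ∃ N, totalDegree m = N + 1 := Nat.exists_eq_succ_of_ne_zero (by omega)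
  rcases single_or_pair (m := m) (by omega) with ⟨i, hi⟩ | ⟨i, j, hij, hi, hj⟩
  · have hc : 2 ≤ m i := by
      have : totalDegree m = m i := by
        conv_lhs => rw [hi]
        simp [totalDegree]
      omega
    rw [hi, isExceptional_single_iff a hc, not_or, not_not, not_not] at hex
    rw [hi, injectiveAt_single_iff, not_not]
    exact (qNumber_zpow_eq_zero_iff hq (by omega) (a i i)).2 hex
  · rw [isExceptional_iff_pair a hij hi hj] at hex
    exact not_injectiveAt_of_finrank_ne _ hlow (by omega)
      (finrank_ne_of_not_exceptional hq0 hq a hij hi hj hex hKm (by omega) hN)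

theorem injectiveAt_of_totalDegree_one (Q : Matrix (Fin n) (Fin n) k) {m : Fin n → ℕ}
    (hm : totalDegree m = 1) : InjectiveAt Q m := by
  rcases single_or_pair (m := m) (by omega) with ⟨i, hi⟩ | ⟨i, j, hij, hi, hj⟩
  · have : m i = 1 := by
      have : totalDegree m = m i := by
        conv_lhs => rw [hi]
        simp [totalDegree]
      omega
    rw [hi, this, injectiveAt_single_iff]
    simp [qNumber]
  · have : ∑ l ∈ {i, j}, m l ≤ totalDegree m := sum_le_sum_of_subset (subset_univ _)
    rw [sum_pair hij] at this
    omega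

/-- Given freeness, lower degrees are injective as well, so a non-exceptional solution would
contradict injectivity in its own degree. The converse is a strong induction on `|m|`, starting at
degree 1. -/
theorem nicholsIsFree_powerMatrix_iff (h2 : (2 : k) ≠ 0) (h3 : (3 : k) ≠ 0) (hq0 : q ≠ 0)
    (hq : ∀ N : ℕ, 0 < N → q ^ N ≠ 1) {V : Type*} [AddCommGroup V] [Module k V]
    (x : Module.Basis (Fin n) k V) (a : Matrix (Fin n) (Fin n) ℤ) :
    NicholsIsFree x (powerMatrix q a) ↔
      ¬ ∃ m : Fin n → ℕ, 2 ≤ totalDegree m ∧ ¬ IsExceptional k a m ∧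
        quadForm a m = linForm a m := by
  rw [nicholsIsFree_iff_injectiveAt]
  constructor
  · rintro h ⟨m, hm, hex, hKm⟩
    exact not_injectiveAt_of_eq hq0 hq a hm (fun m' hm' => h m' (by omega)) hex hKm
      (h m (by omega))
  · intro h m hm
    induction hd : totalDegree m using Nat.strong_induction_on generalizing m with
    | _ d ih =>
      rcases Nat.lt_or_ge (totalDegree m) 2 with h1 | h1
      · exact injectiveAt_of_totalDegree_one _ (by omega)
      · refine injectiveAt_of_exceptional_or_ne h2 h3 hq0 hq a h1
          (fun m' hm' => ih _ (by omega) m' (by omega) rfl) ?_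
        by_contra hn
        rw [not_or, not_not] at hn
        exact h ⟨m, h1, hn⟩

end Comparison

/-! ### The values of `P_m` at `(q^{a_{ij}})` -/

section Values

open Finset

variable {n : ℕ} {k : Type*} [Field k] {q : k}

theorem quadForm_sub_linForm_pair (a : Matrix (Fin n) (Fin n) ℤ) (i j : Fin n)
    (c d : ℕ) :
    quadForm a (Pi.single i c + Pi.single j d) - linForm a (Pi.single i c + Pi.single j d) =
      a i i * (c * (c - 1)) + a j j * (d * (d - 1)) + (a i j + a j i) * (c * d) := by
  simp [quadForm, linForm, Pi.single_apply, mul_add, add_mul, sum_add_distrib]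
  ring

theorem one_add_zpow_ne_zero (h2 : (2 : k) ≠ 0) (hq : ∀ N : ℕ, 0 < N → q ^ N ≠ 1) (e : ℤ) :
    1 + q ^ e ≠ 0 := by
  have h := qNumber_zpow_eq_zero_iff hq (c := 2) (by norm_num) e
  simp only [qNumber, sum_range_succ, sum_range_zero, pow_zero, pow_one, zero_add] at h
  rw [Ne, h]
  exact fun h' => h2 (by exact_mod_cast h'.2)

theorem one_sub_zpow_eq_zero_iff (hq : ∀ N : ℕ, 0 < N → q ^ N ≠ 1) (e : ℤ) :
    1 - q ^ e = 0 ↔ e = 0 := by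
  rw [sub_eq_zero, eq_comm, zpow_eq_one_iff_of_not_root hq]

theorem qNumber_three_zpow_ne_zero (h3 : (3 : k) ≠ 0) (hq : ∀ N : ℕ, 0 < N → q ^ N ≠ 1) (e : ℤ) :
    qNumber 3 (q ^ e) ≠ 0 := by
  rw [Ne, qNumber_zpow_eq_zero_iff hq (by norm_num)]
  exact fun h' => h3 (by exact_mod_cast h'.2)

theorem map_qNumber {R S : Type*} [CommRing R] [CommRing S] (f : R →+* S) (c : ℕ) (t : R) :
    f (qNumber c t) = qNumber c (f t) := by
  simp [qNumber]

theorem aeval_qNumber (Q : Matrix (Fin n) (Fin n) k) (c : ℕ)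
    (t : MvPolynomial (Fin n × Fin n) ℤ) :
    MvPolynomial.aeval (fun ij : Fin n × Fin n => Q ij.1 ij.2) (qNumber c t) =
      qNumber c (MvPolynomial.aeval (fun ij : Fin n × Fin n => Q ij.1 ij.2) t) :=
  map_qNumber (MvPolynomial.aeval (R := ℤ) (fun ij : Fin n × Fin n => Q ij.1 ij.2)).toRingHom c t

/-- The monomials in the entries of `(q^{a_{ij}})`. -/
theorem powerMatrix_monomial (hq0 : q ≠ 0) (a : Matrix (Fin n) (Fin n) ℤ) (i j : Fin n)
    (r s t : ℕ) :
    powerMatrix q a i i ^ r * (powerMatrix q a i j * powerMatrix q a j i) ^ s *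
      powerMatrix q a j j ^ t = q ^ (a i i * r + (a i j + a j i) * s + a j j * t) := by
  have hQ : ∀ i j, powerMatrix q a i j = q ^ a i j := fun _ _ => rfl
  rw [hQ, hQ, hQ, hQ, zpow_add₀ hq0, zpow_add₀ hq0 (a i i * r), zpow_mul, zpow_mul,
    zpow_mul, zpow_natCast, zpow_natCast, zpow_natCast, zpow_add₀ hq0]

theorem evalP_single (a : Matrix (Fin n) (Fin n) ℤ) (i : Fin n) {c : ℕ} (hc : 0 < c) :
    evalP (powerMatrix q a) (Pi.single i c) = qNumber c (q ^ a i i) := by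
  rw [evalP, P_single i hc, aeval_qNumber]
  simp [p, powerMatrix]

theorem evalP_one (hq0 : q ≠ 0) (a : Matrix (Fin n) (Fin n) ℤ) {m : Fin n → ℕ} {i j : Fin n}
    {d : ℕ} (h : IsPair m (i, j) 1 d) :
    evalP (powerMatrix q a) m = 1 - q ^ (a j j * (d - 1) + (a i j + a j i)) := by
  have h1 := powerMatrix_monomial hq0 a i j 0 1 (d - 1)
  have hd : ((d - 1 : ℕ) : ℤ) = d - 1 := by
    rw [Nat.cast_sub h.2.2.1, Nat.cast_one]
  rw [hd] at h1
  rw [evalP, P_one h]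
  simp only [p, map_sub, map_mul, map_pow, map_one, MvPolynomial.aeval_X]
  rw [show a j j * (d - 1 : ℤ) + (a i j + a j i) =
    a i i * (0 : ℕ) + (a i j + a j i) * (1 : ℕ) + a j j * (d - 1) by push_cast; ring, ← h1]
  ring

/-- For an even multiplicity the sign in `(-s)^d` disappears, which leaves `1 + q^e`. Its
nonvanishing is what makes `2 e_i + 2c e_j` exceptional. -/
theorem evalP_two_even (hq0 : q ≠ 0) (a : Matrix (Fin n) (Fin n) ℤ) {m : Fin n → ℕ}
    {i j : Fin n} {c : ℕ} (h : IsPair m (i, j) 2 (2 * c)) :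
    ∃ e : ℤ, evalP (powerMatrix q a) m = 1 + q ^ e := by
  have h1 := powerMatrix_monomial hq0 a i j 1 (2 * c) (2 * c * (2 * c - 1) / 2)
  refine ⟨a i i * (1 : ℕ) + (a i j + a j i) * (2 * c : ℕ) +
    a j j * (2 * c * (2 * c - 1) / 2 : ℕ), ?_⟩
  rw [← h1, evalP, P_two h]
  simp only [p, map_add, map_mul, map_pow, map_neg, map_one, MvPolynomial.aeval_X]
  rw [(even_two_mul c).neg_pow]
  ring

/-- For an odd multiplicity the sign survives, and the exponent is half of `K(m) - λ(m)`. -/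
theorem evalP_two_odd (hq0 : q ≠ 0) (a : Matrix (Fin n) (Fin n) ℤ) {m : Fin n → ℕ}
    {i j : Fin n} {c : ℕ} (h : IsPair m (i, j) 2 (2 * c + 1)) :
    evalP (powerMatrix q a) m =
      1 - q ^ (a i i + (a i j + a j i) * (2 * c + 1) + a j j * ((2 * c + 1) * c)) := by
  have hdiv : (2 * c + 1) * (2 * c + 1 - 1) / 2 = (2 * c + 1) * c := by
    refine Nat.div_eq_of_eq_mul_left (by norm_num) ?_
    rw [Nat.add_sub_cancel]
    ring
  have h1 := powerMatrix_monomial hq0 a i j 1 (2 * c + 1) ((2 * c + 1) * c)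
  push_cast at h1
  rw [mul_one] at h1
  rw [← h1, evalP, P_two h, hdiv]
  simp only [p, map_add, map_mul, map_pow, map_neg, map_one, MvPolynomial.aeval_X]
  rw [(odd_two_mul_add_one c).neg_pow]
  ring

theorem evalP_three_three (hq0 : q ≠ 0) (a : Matrix (Fin n) (Fin n) ℤ) {m : Fin n → ℕ}
    {i j : Fin n} (h : IsPair m (i, j) 3 3) :
    ∃ e : ℤ, evalP (powerMatrix q a) m = qNumber 3 (q ^ e) := by
  rw [evalP, P_three_three h, aeval_qNumber]
  simp only [p, map_mul, map_pow, MvPolynomial.aeval_X]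
  rw [powerMatrix_monomial hq0]
  exact ⟨_, rfl⟩

theorem evalP_three_four (hq0 : q ≠ 0) (a : Matrix (Fin n) (Fin n) ℤ) {m : Fin n → ℕ}
    {i j : Fin n} (h : IsPair m (i, j) 3 4) :
    ∃ e : ℤ, evalP (powerMatrix q a) m =
      (1 - q ^ (a i i * 2 + (a i j + a j i) * 4 + a j j * 4)) * qNumber 3 (q ^ e) := by
  have h1 := powerMatrix_monomial hq0 a i j 2 4 4
  have h2 := powerMatrix_monomial hq0 a i j 1 2 2
  rw [pow_one] at h2
  rw [evalP, P_three_four h, map_mul, aeval_qNumber]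
  simp only [p, map_sub, map_one, map_mul, map_pow, MvPolynomial.aeval_X]
  rw [h1, h2]
  exact ⟨_, rfl⟩

theorem evalP_three_six (hq0 : q ≠ 0) (a : Matrix (Fin n) (Fin n) ℤ) {m : Fin n → ℕ}
    {i j : Fin n} (h : IsPair m (i, j) 3 6) :
    ∃ e : ℤ, evalP (powerMatrix q a) m =
      (1 - q ^ (a i i + (a i j + a j i) * 3 + a j j * 5)) * qNumber 3 (q ^ e) := by
  have h1 := powerMatrix_monomial hq0 a i j 1 3 5
  have h2 := powerMatrix_monomial hq0 a i j 2 6 10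
  rw [pow_one, Nat.cast_one, mul_one] at h1
  rw [evalP, P_three_six h, map_mul, aeval_qNumber]
  simp only [p, map_sub, map_one, map_mul, map_pow, MvPolynomial.aeval_X]
  rw [h1, h2]
  exact ⟨_, rfl⟩

theorem evalP_four_four (hq0 : q ≠ 0) (a : Matrix (Fin n) (Fin n) ℤ) {m : Fin n → ℕ}
    {i j : Fin n} (h : IsPair m (i, j) 4 4) :
    ∃ e e' : ℤ, evalP (powerMatrix q a) m = (1 + q ^ e) * (1 + q ^ e') := by
  rw [evalP, P_four_four h, map_mul]
  simp only [p, map_add, map_one, map_mul, map_pow, MvPolynomial.aeval_X]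
  rw [powerMatrix_monomial hq0, powerMatrix_monomial hq0]
  exact ⟨_, _, rfl⟩

theorem quadForm_sub_linForm (a : Matrix (Fin n) (Fin n) ℤ) (m : Fin n → ℕ) :
    quadForm a m - linForm a m = ∑ i, a i i * (m i * (m i - 1)) +
      ∑ i, ∑ j ∈ Ioi i, (a i j + a j i) * (m i * m j) := by
  have h1 : ∑ i, ∑ j ∈ Ioi i, (a i j + a j i) * ((m i : ℤ) * m j) =
      ∑ i, ∑ j ∈ Ioi i, (a i j * m i * m j + a j i * m j * m i) :=
    sum_congr rfl fun i _ => sum_congr rfl fun j _ => by ring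
  have h2 : ∀ i, ∑ j, a i j * (m i : ℤ) * m j =
      a i i * m i * m i + ∑ j ∈ {i}ᶜ, a i j * (m i : ℤ) * m j := fun i => by
    rw [← sum_add_sum_compl {i}, sum_singleton]
  rw [h1, sum_sum_Ioi_add_eq_sum_sum_off_diag (fun i j => a j i * (m j : ℤ) * m i), quadForm,
    linForm, sum_congr rfl fun i _ => h2 i, sum_add_distrib, add_sub_right_comm,
    ← sum_sub_distrib, sum_congr rfl fun i _ => (by ring :
      a i i * (m i : ℤ) * m i - a i i * m i = a i i * (m i * (m i - 1)))]

theorem natCast_mul_pred (c : ℕ) : ((c * (c - 1) : ℕ) : ℤ) = c * (c - 1) := by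
  cases c <;> simp

theorem zpow_sum₀ {ι : Type*} (hq0 : q ≠ 0) (s : Finset ι) (f : ι → ℤ) :
    q ^ ∑ i ∈ s, f i = ∏ i ∈ s, q ^ f i := by
  classical
  induction s using Finset.induction_on with
  | empty => simp
  | insert i s hi ih => rw [sum_insert hi, prod_insert hi, zpow_add₀ hq0, ih]

theorem evalP_generic (hq0 : q ≠ 0) (a : Matrix (Fin n) (Fin n) ℤ) {m : Fin n → ℕ}
    (h0 : ¬ ∃ i, m = Pi.single i (m i)) (h : ∀ ij c d, IsPair m ij c d → c ≠ 1 ∧ c ≠ 2 ∧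
      (c, d) ≠ (3, 3) ∧ (c, d) ≠ (3, 4) ∧ (c, d) ≠ (3, 6) ∧ (c, d) ≠ (4, 4)) :
    evalP (powerMatrix q a) m = 1 - q ^ (quadForm a m - linForm a m) := by
  rw [evalP, P, dif_neg h0, dif_neg, dif_neg, dif_neg, dif_neg, dif_neg, dif_neg,
    quadForm_sub_linForm, zpow_add₀ hq0, zpow_sum₀ hq0, zpow_sum₀ hq0]
  · simp only [p, map_sub, map_one, map_mul, map_prod, map_pow, MvPolynomial.aeval_X]
    congr 2
    · refine prod_congr rfl fun i _ => ?_
      rw [powerMatrix, Matrix.of_apply, ← natCast_mul_pred, zpow_mul, zpow_natCast]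
    · refine prod_congr rfl fun i _ => ?_
      rw [zpow_sum₀ hq0]
      refine prod_congr rfl fun j _ => ?_
      rw [powerMatrix, Matrix.of_apply, Matrix.of_apply, ← zpow_add₀ hq0, ← Nat.cast_mul,
        zpow_mul, zpow_natCast]
  all_goals
    rintro ⟨ij, hp⟩
    have := h _ _ _ hp
    simp at this

theorem IsPair.isExceptional (a : Matrix (Fin n) (Fin n) ℤ) {m : Fin n → ℕ} {i j : Fin n}
    {c d : ℕ} (h : IsPair m (i, j) c d) :
    IsExceptional k a m ↔ (c = 2 ∧ Even d) ∨ (d = 2 ∧ Even c) ∨ (c = 3 ∧ d = 3) ∨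
      (c = 4 ∧ d = 4) := by
  have hmi : m i = c := h.symm.snd
  have hmj : m j = d := h.snd
  obtain ⟨hij, hc, hd, hm⟩ := id h
  dsimp only at hij hm
  rw [isExceptional_iff_pair a hij (hmi ▸ hc.ne') (hmj ▸ hd.ne')]
  constructor
  · rintro (⟨i', j', hij', e, he, hm'⟩ | ⟨i', j', hij', hm' | hm'⟩)
    · have h' : IsPair m (i', j') 2 (2 * e) := ⟨hij', by norm_num, by omega, hm'⟩
      have he2 := even_two_mul e
      rcases h.unique h' with ⟨-, rfl, rfl⟩ | ⟨-, rfl, rfl⟩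
      · exact Or.inl ⟨rfl, he2⟩
      · exact Or.inr (Or.inl ⟨rfl, he2⟩)
    · have := h.unique (⟨hij', by norm_num, by norm_num, hm'⟩ : IsPair m (i', j') 3 3)
      omega
    · have := h.unique (⟨hij', by norm_num, by norm_num, hm'⟩ : IsPair m (i', j') 4 4)
      omega
  · rintro (⟨rfl, e, rfl⟩ | ⟨rfl, e, rfl⟩ | ⟨rfl, rfl⟩ | ⟨rfl, rfl⟩)
    · exact Or.inl ⟨i, j, hij, e, by omega, by rw [hm, two_mul]⟩
    · exact Or.inl ⟨j, i, hij.symm, e, by omega, by rw [h.symm.2.2.2, two_mul]⟩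
    · exact Or.inr ⟨i, j, hij, Or.inl hm⟩
    · exact Or.inr ⟨i, j, hij, Or.inr hm⟩

/-- Outside of the exceptional degrees `P_m` detects the solutions of `K(m) = λ(m)`, and in the
exceptional degrees it does not vanish. -/
def Detects (q : k) (a : Matrix (Fin n) (Fin n) ℤ) (m : Fin n → ℕ) : Prop :=
  (IsExceptional k a m ∧ evalP (powerMatrix q a) m ≠ 0) ∨
    (¬ IsExceptional k a m ∧ (evalP (powerMatrix q a) m = 0 ↔ quadForm a m = linForm a m))

theorem detects_single (hq : ∀ N : ℕ, 0 < N → q ^ N ≠ 1) (a : Matrix (Fin n) (Fin n) ℤ)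
    (i : Fin n) {c : ℕ} (hc : 2 ≤ c) : Detects q a (Pi.single i c) := by
  have h := qNumber_zpow_eq_zero_iff hq (c := c) (by omega) (a i i)
  rw [Detects, evalP_single a i (by omega), isExceptional_single_iff a hc, quadForm_single,
    linForm_single]
  simp only [ne_eq, h]
  by_cases h0 : a i i = 0 <;> by_cases h1 : (c : k) = 0 <;> simp [h0, h1]

theorem detects_one (hq0 : q ≠ 0) (hq : ∀ N : ℕ, 0 < N → q ^ N ≠ 1)
    (a : Matrix (Fin n) (Fin n) ℤ) {m : Fin n → ℕ} {i j : Fin n} {d : ℕ}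
    (h : IsPair m (i, j) 1 d) : Detects q a m := by
  have hD := quadForm_sub_linForm_pair a i j 1 d
  rw [← h.2.2.2] at hD
  have hd : (d : ℤ) ≠ 0 := by exact_mod_cast h.2.2.1.ne'
  refine Or.inr ⟨?_, ?_⟩
  · rw [h.isExceptional]
    rintro (h | ⟨-, h⟩ | h | h)
    · omega
    · exact absurd h (by decide)
    · omega
    · omega
  · rw [evalP_one hq0 a h, one_sub_zpow_eq_zero_iff hq, ← sub_eq_zero (a := quadForm a m), hD]
    have : a i i * (((1 : ℕ) : ℤ) * ((1 : ℕ) - 1)) + a j j * (d * (d - 1)) +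
      (a i j + a j i) * ((1 : ℕ) * d) = d * (a j j * (d - 1) + (a i j + a j i)) := by
        push_cast; ring
    rw [this, mul_eq_zero, or_iff_right hd]

theorem detects_two (h2 : (2 : k) ≠ 0) (hq0 : q ≠ 0) (hq : ∀ N : ℕ, 0 < N → q ^ N ≠ 1)
    (a : Matrix (Fin n) (Fin n) ℤ) {m : Fin n → ℕ} {i j : Fin n} {d : ℕ}
    (h : IsPair m (i, j) 2 d) : Detects q a m := by
  rcases Nat.even_or_odd' d with ⟨c, rfl | rfl⟩
  · refine Or.inl ⟨h.isExceptional a |>.2 (Or.inl ⟨rfl, even_two_mul c⟩), ?_⟩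
    obtain ⟨e, he⟩ := evalP_two_even hq0 a h
    rw [he]
    exact one_add_zpow_ne_zero h2 hq e
  · have hD := quadForm_sub_linForm_pair a i j 2 (2 * c + 1)
    rw [← h.2.2.2] at hD
    refine Or.inr ⟨?_, ?_⟩
    · rw [h.isExceptional]
      rintro (⟨-, h⟩ | h | h | h)
      · exact (Nat.not_even_two_mul_add_one c) h
      all_goals omega
    · rw [evalP_two_odd hq0 a h, one_sub_zpow_eq_zero_iff hq, ← sub_eq_zero (a := quadForm a m), hD]
      push_cast
      constructor
      · intro h
        linear_combination 2 * h
      · intro h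
        have h' : (2 : ℤ) * (a i i + (a i j + a j i) * (2 * c + 1) +
          a j j * ((2 * c + 1) * c)) = 0 := by linear_combination h
        exact (mul_eq_zero.1 h').resolve_left (by norm_num)

/-- The exponent in the first factor is a third of `K(m) - λ(m)`. The factor `(3)_{q^e}` never
vanishes in characteristic different from 3. -/
theorem detects_three_four (h3 : (3 : k) ≠ 0) (hq0 : q ≠ 0) (hq : ∀ N : ℕ, 0 < N → q ^ N ≠ 1)
    (a : Matrix (Fin n) (Fin n) ℤ) {m : Fin n → ℕ} {i j : Fin n}
    (h : IsPair m (i, j) 3 4) : Detects q a m := by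
  have hD := quadForm_sub_linForm_pair a i j 3 4
  rw [← h.2.2.2] at hD
  refine Or.inr ⟨by rw [h.isExceptional]; decide, ?_⟩
  obtain ⟨e, he⟩ := evalP_three_four hq0 a h
  rw [he, mul_eq_zero, or_iff_left (qNumber_three_zpow_ne_zero h3 hq e),
    one_sub_zpow_eq_zero_iff hq]
  push_cast at hD
  constructor <;> intro h' <;> linarith

/-- As for `detects_three_four`, with a sixth of `K(m) - λ(m)` in the exponent. -/
theorem detects_three_six (h3 : (3 : k) ≠ 0) (hq0 : q ≠ 0) (hq : ∀ N : ℕ, 0 < N → q ^ N ≠ 1)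
    (a : Matrix (Fin n) (Fin n) ℤ) {m : Fin n → ℕ} {i j : Fin n}
    (h : IsPair m (i, j) 3 6) : Detects q a m := by
  have hD := quadForm_sub_linForm_pair a i j 3 6
  rw [← h.2.2.2] at hD
  refine Or.inr ⟨by rw [h.isExceptional]; decide, ?_⟩
  obtain ⟨e, he⟩ := evalP_three_six hq0 a h
  rw [he, mul_eq_zero, or_iff_left (qNumber_three_zpow_ne_zero h3 hq e),
    one_sub_zpow_eq_zero_iff hq]
  push_cast at hD
  constructor <;> intro h' <;> linarith

theorem detects_generic (hq0 : q ≠ 0) (hq : ∀ N : ℕ, 0 < N → q ^ N ≠ 1)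
    (a : Matrix (Fin n) (Fin n) ℤ) {m : Fin n → ℕ}
    (h0 : ¬ ∃ i, m = Pi.single i (m i)) (h : ∀ ij c d, IsPair m ij c d → c ≠ 1 ∧ c ≠ 2 ∧
      (c, d) ≠ (3, 3) ∧ (c, d) ≠ (3, 4) ∧ (c, d) ≠ (3, 6) ∧ (c, d) ≠ (4, 4)) :
    Detects q a m := by
  refine Or.inr ⟨?_, ?_⟩
  · rintro (⟨i, c, -, -, rfl⟩ | ⟨i, j, hij, c, hc, hm⟩ | ⟨i, j, hij, hm | hm⟩)
    · exact h0 ⟨i, by simp⟩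
    · exact (h (i, j) 2 (2 * c) ⟨hij, by norm_num, by omega, hm⟩).2.1 rfl
    · exact (h (i, j) 3 3 ⟨hij, by norm_num, by norm_num, hm⟩).2.2.1 rfl
    · exact (h (i, j) 4 4 ⟨hij, by norm_num, by norm_num, hm⟩).2.2.2.2.2 rfl
  · rw [evalP_generic hq0 a h0 h, one_sub_zpow_eq_zero_iff hq, sub_eq_zero]

theorem detects (h2 : (2 : k) ≠ 0) (h3 : (3 : k) ≠ 0) (hq0 : q ≠ 0)
    (hq : ∀ N : ℕ, 0 < N → q ^ N ≠ 1) (a : Matrix (Fin n) (Fin n) ℤ) {m : Fin n → ℕ}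
    (hm : 2 ≤ totalDegree m) : Detects q a m := by
  by_cases h0 : ∃ i, m = Pi.single i (m i)
  · obtain ⟨i, hi⟩ := h0
    have : totalDegree m = m i := by
      conv_lhs => rw [hi]
      simp [totalDegree]
    rw [hi]
    exact detects_single hq a i (by omega)
  -- If `m` were not detected, it could have none of the special shapes, each of which is detected.
  -- Then the generic formula for `P_m` applies and detects it.
  by_contra hn
  refine hn (detects_generic hq0 hq a h0 ?_)
  rintro ⟨i, j⟩ c d h
  refine ⟨?_, ?_, ?_, ?_, ?_, ?_⟩
  · rintro rfl
    exact hn (detects_one hq0 hq a h)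
  · rintro rfl
    exact hn (detects_two h2 hq0 hq a h)
  all_goals
    rintro e
    obtain ⟨rfl, rfl⟩ := Prod.mk.inj e
  · obtain ⟨e, he⟩ := evalP_three_three hq0 a h
    exact hn (Or.inl ⟨by rw [h.isExceptional]; decide,
      he ▸ qNumber_three_zpow_ne_zero h3 hq e⟩)
  · exact hn (detects_three_four h3 hq0 hq a h)
  · exact hn (detects_three_six h3 hq0 hq a h)
  · obtain ⟨e, e', he⟩ := evalP_four_four hq0 a h
    exact hn (Or.inl ⟨by rw [h.isExceptional]; decide,
      he ▸ mul_ne_zero (one_add_zpow_ne_zero h2 hq e) (one_add_zpow_ne_zero h2 hq e')⟩)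

theorem evalP_ne_zero_of_isExceptional (h2 : (2 : k) ≠ 0) (h3 : (3 : k) ≠ 0) (hq0 : q ≠ 0)
    (hq : ∀ N : ℕ, 0 < N → q ^ N ≠ 1) (a : Matrix (Fin n) (Fin n) ℤ) {m : Fin n → ℕ}
    (hm : 2 ≤ totalDegree m) (hex : IsExceptional k a m) : evalP (powerMatrix q a) m ≠ 0 :=
  (detects h2 h3 hq0 hq a hm).elim And.right fun h => absurd hex h.1

theorem evalP_eq_zero_iff (h2 : (2 : k) ≠ 0) (h3 : (3 : k) ≠ 0) (hq0 : q ≠ 0)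
    (hq : ∀ N : ℕ, 0 < N → q ^ N ≠ 1) (a : Matrix (Fin n) (Fin n) ℤ) {m : Fin n → ℕ}
    (hm : 2 ≤ totalDegree m) (hex : ¬ IsExceptional k a m) :
    evalP (powerMatrix q a) m = 0 ↔ quadForm a m = linForm a m :=
  (detects h2 h3 hq0 hq a hm).elim (fun h => absurd h.1 hex) And.right

end Values

/-! ### The diophantine equation in rank two -/

section RankTwo

variable {k : Type*} [Field k] {q : k}

theorem natCast_ne_zero_of_ringChar_ne {r : ℕ} (hr : r.Prime) (h : ringChar k ≠ r) :
    (r : k) ≠ 0 := by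
  intro h0
  rcases (Nat.dvd_prime hr).1 ((ringChar.spec k r).1 h0) with h1 | h1
  · exact one_ne_zero (α := k) (by exact_mod_cast (ringChar.spec k 1).2 h1.dvd)
  · exact h h1

/-- On the axes only one positive term survives, and at `(1, 1)` the value is `-b`. Otherwise
`x(x-1) + y(y-1) ≥ xy`, whence the value is at least `(a - b) x y > 0`. -/
theorem not_exists_solution {a b x y : ℤ} (hb : 0 < b) (hab : b < a) (hx : 0 ≤ x) (hy : 0 ≤ y)
    (hxy : 2 ≤ x + y) : a * (x * (x - 1)) + a * (y * (y - 1)) - b * (x * y) ≠ 0 := by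
  have ha : 0 < a := hb.trans hab
  rcases hx.eq_or_lt with rfl | hx
  · have : 0 < a * (y * (y - 1)) := mul_pos ha (mul_pos (by omega) (by omega))
    intro h
    simp at h
    omega
  rcases hy.eq_or_lt with rfl | hy
  · have : 0 < a * (x * (x - 1)) := mul_pos ha (mul_pos (by omega) (by omega))
    intro h
    simp at h
    omega
  intro h
  by_cases h1 : x = 1 ∧ y = 1
  · obtain ⟨rfl, rfl⟩ := h1
    simp at h
    omega
  have hT : x * y ≤ x * (x - 1) + y * (y - 1) := by
    -- This integer equals `x(x-1) + y(y-1) - xy + 1`, so positivity is the claimed inequality.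
    have hsq : 0 < (x - 1) * (y - 1) + (x - y) ^ 2 := by
      by_cases hne : x = y
      · subst hne
        have : 0 < x - 1 := by omega
        have := mul_pos this this
        nlinarith
      · have h2 : 0 < (x - y) ^ 2 := by
          have : x - y ≠ 0 := sub_ne_zero.2 hne
          positivity
        have h3 : 0 ≤ (x - 1) * (y - 1) := mul_nonneg (by omega) (by omega)
        omega
    nlinarith
  have hpos : 0 < x * y := mul_pos hx hy
  nlinarith [mul_le_mul_of_nonneg_left hT ha.le, mul_lt_mul_of_pos_right hab hpos]

theorem nicholsIsFree_rankTwo (h2 : (2 : k) ≠ 0) (h3 : (3 : k) ≠ 0) (hq0 : q ≠ 0)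
    (hq : ∀ N : ℕ, 0 < N → q ^ N ≠ 1) {V : Type*} [AddCommGroup V] [Module k V]
    (x : Module.Basis (Fin 2) k V) (Q : Matrix (Fin 2) (Fin 2) k) {a b c d : ℤ} (hb : 0 < b)
    (hab : b < a) (h00 : Q 0 0 = q ^ a) (h11 : Q 1 1 = q ^ a) (h01 : Q 0 1 = q ^ c)
    (h10 : Q 1 0 = q ^ d) (hprod : Q 0 1 * Q 1 0 = q ^ (-b)) : NicholsIsFree x Q := by
  have hQ : Q = powerMatrix q !![a, c; d, a] := by
    ext i j
    fin_cases i <;> fin_cases j <;> simp [powerMatrix, h00, h11, h01, h10]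
  have hcd : c + d = -b := by
    rw [h01, h10, ← zpow_add₀ hq0, ← mul_inv_eq_one₀ (zpow_ne_zero _ hq0), ← zpow_neg,
      ← zpow_add₀ hq0, zpow_eq_one_iff_of_not_root hq] at hprod
    omega
  rw [hQ, nicholsIsFree_powerMatrix_iff h2 h3 hq0 hq]
  rintro ⟨m, hm, -, hK⟩
  rw [totalDegree, Fin.sum_univ_two] at hm
  refine not_exists_solution hb hab (Int.natCast_nonneg (m 0)) (Int.natCast_nonneg (m 1))
    (by exact_mod_cast hm) ?_
  simp only [quadForm, linForm, Fin.sum_univ_two, Matrix.of_apply, Matrix.cons_val',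
    Matrix.cons_val_zero, Matrix.cons_val_one, Matrix.cons_val_fin_one] at hK
  linear_combination hK - (m 0 : ℤ) * m 1 * hcd

end RankTwo

end DiagonalNichols

open DiagonalNichols in
theorem mainTheorem3 {k : Type*} [Field k] (hchar2 : ringChar k ≠ 2) (hchar3 : ringChar k ≠ 3)
    (q : k) (hq0 : q ≠ 0) (hq : ∀ N : ℕ, 0 < N → q ^ N ≠ 1)
    {V : Type*} [AddCommGroup V] [Module k V] :
    (∀ (n : ℕ) (x : Module.Basis (Fin n) k V) (a : Matrix (Fin n) (Fin n) ℤ),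
      (∀ m : Fin n → ℕ, 2 ≤ totalDegree m → IsExceptional k a m →
        evalP (powerMatrix q a) m ≠ 0) ∧
      (∀ m : Fin n → ℕ, 2 ≤ totalDegree m → ¬ IsExceptional k a m →
        (evalP (powerMatrix q a) m = 0 ↔ quadForm a m = linForm a m)) ∧
      (NicholsIsFree x (powerMatrix q a) ↔
        ¬ ∃ m : Fin n → ℕ, 2 ≤ totalDegree m ∧ ¬ IsExceptional k a m ∧
          quadForm a m = linForm a m)) ∧
    (∀ (x : Module.Basis (Fin 2) k V) (Q : Matrix (Fin 2) (Fin 2) k) (a b : ℤ),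
      0 < b → b < a →
      Q 0 0 = q ^ a → Q 1 1 = q ^ a →
      (∃ c : ℤ, Q 0 1 = q ^ c) → (∃ d : ℤ, Q 1 0 = q ^ d) →
      Q 0 1 * Q 1 0 = q ^ (-b) →
      NicholsIsFree x Q) := by
  have h2 : (2 : k) ≠ 0 := by
    exact_mod_cast natCast_ne_zero_of_ringChar_ne Nat.prime_two hchar2
  have h3 : (3 : k) ≠ 0 := by
    exact_mod_cast natCast_ne_zero_of_ringChar_ne Nat.prime_three hchar3
  refine ⟨fun n x a => ⟨fun m hm hex => evalP_ne_zero_of_isExceptional h2 h3 hq0 hq a hm hex,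
    fun m hm hex => evalP_eq_zero_iff h2 h3 hq0 hq a hm hex,
    nicholsIsFree_powerMatrix_iff h2 h3 hq0 hq x a⟩, ?_⟩
  rintro x Q a b hb hab h00 h11 ⟨c, h01⟩ ⟨d, h10⟩ hprod
  exact nicholsIsFree_rankTwo h2 h3 hq0 hq x Q hb hab h00 h11 h01 h10 hprod
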